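/- Let $a,b,\lambda,\beta\in\mathbb R$ be constants and consider, for complex-valued $u=u(t,x)$, the problem $$i u_t+a u_{xx}+ib u_x+iu_{xxx}+\lambda|u|u+i\beta(|u|u)_x+i d(x)u=0,\qquad u(0,x)=u_0(x),\quad x\in\mathbb R. \tag{1}$$ Write $x_+=\max(x,0)$, $\Pi_T=(0,T)\times\mathbb R$, $L_p=L_p(\mathbb R)$, $H^3=H^3(\mathbb R)$. For $\alpha\ge 0$ let $L_2^\alpha=\{\varphi:(1+x_+)^\alpha\varphi\in L_2\}$, and for a non-negative continuous function $\psi$ let $L_2^{\psi}=\{\varphi:\varphi\,\psi^{1/2}\in L_2\}$, with the natural (Hilbert) norms. $C_w([0,T];L_2^\alpha)$ denotes the weakly continuous maps from $[0,T]$ to $L_2^\alpha$. For $\epsilon>0$, $\rho_{\alpha,\epsilon}$ denotes any increasing function in $C^\infty(\mathbb R)$ with $\rho_{\alpha,\epsilon}(x)=e^{2\epsilon x}$ for $x\le-1$; for $x\ge 0$, $\rho_{\alpha,\epsilon}(x)=(1+x)^{2\alpha}$ if $\alpha>0$ and $\rho_{0,\epsilon}(x)=2-1/\ln(x+e)$;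 and $\rho'_{\alpha,\epsilon}(x)>0$ for $x\in(-1,0)$. For real-valued $d\in L_\infty$, $u_0\in L_2$ and $T>0$, a function $u\in L_\infty(0,T;L_2)$ is a weak solution of (1) in $\Pi_T$ if for every $\phi\in C^1([0,T];L_2)\cap C([0,T];H^3)$ with $\phi|_{t=T}=0$, $$\iint_{\Pi_T}\bigl(iu\phi_t-au\phi_{xx}+ibu\phi_x+iu\phi_{xxx}-\lambda|u|u\phi+i\beta|u|u\phi_x-id(x)u\phi\bigr)\,dx\,dt+i\int_{\mathbb R}u_0\,\phi|_{t=0}\,dx=0.$$ **Theorem.** There is a function $c(\cdot,\cdot,\cdot)\ge 0$ (determined by $a,b,\lambda,\beta$ only) such that for every $\alpha\ge0$, every complex-valued $u_0\in L_2^\alpha$ and every real-valued $d\in L_\infty$ there exists a function $u(t,x)$, $t\ge0$, $x\in\mathbb R$, with a weak derivative $u_x$ in $(0,\infty)\times\mathbb R$, such that for every $T>0$: $u$ is a weak solution of (1) in $\Pi_T$; $u\in C_w([0,T];L_2^\alpha)$; $$\sup_{x_0\in\mathbb R}\int_0^T\!\!\int_{x_0}^{x_0+1}|u_x|^2\,dx\,dt\le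 c\bigl(T,\|u_0\|_{L_2},\|d\|_{L_\infty}\bigr);$$ and $u_x\in L_2\bigl(0,T;L_2^{\rho'_{\alpha,\epsilon}}\bigr)$ for every $\epsilon>0$. -/

import Mathlib

open MeasureTheory Set
open scoped ENNReal NNReal ContDiff

namespace HNLS

/-- The open strip `Π_T = (0,T) × ℝ` (first coordinate: time `t`, second coordinate: space `x`). -/
def strip (T : ℝ) : Set (ℝ × ℝ) := Ioo 0 T ×ˢ univ

/-- The weight `(1 + x₊) ^ α`, with `x₊ = max x 0`. -/
noncomputable def powWeight (α x : ℝ) : ℝ := (1 + max x 0) ^ α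

/-- `φ ∈ L_2^α`, that is `(1 + x₊) ^ α φ ∈ L_2(ℝ)`. The weight is positive and continuous, so
this includes the measurability of `φ`. -/
def MemL2Alpha (α : ℝ) (φ : ℝ → ℂ) : Prop :=
  MemLp (fun x => (powWeight α x : ℂ) * φ x) 2 volume

/-- `u ∈ C_w([0,T]; L_2^α)`: all values `u(t,·)`, `t ∈ [0,T]`, lie in `L_2^α`, and
`t ↦ (u(t,·), ψ)` is continuous on `[0,T]` for every `ψ ∈ L_2^α`, where `(·,·)` is the inner
product `∫ φ ψ̄ (1 + x₊) ^ (2α) dx` of the Hilbert space `L_2^α`. -/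
def WeaklyContinuous (T α : ℝ) (u : ℝ → ℝ → ℂ) : Prop :=
  (∀ t ∈ Icc 0 T, MemL2Alpha α (u t)) ∧
  ∀ ψ : ℝ → ℂ, MemL2Alpha α ψ →
    ContinuousOn
      (fun t => ∫ x, ((powWeight α x : ℂ) * u t x) *
        starRingEnd ℂ ((powWeight α x : ℂ) * ψ x)) (Icc 0 T)

/-- `u ∈ L_∞(0,T; L_2(ℝ))`. -/
def MemLinftyL2 (T : ℝ) (u : ℝ → ℝ → ℂ) : Prop :=
  AEStronglyMeasurable (fun z : ℝ × ℝ => u z.1 z.2) (volume.restrict (strip T)) ∧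
  ∃ M : ℝ≥0, ∀ᵐ t ∂(volume.restrict (Ioo 0 T)), eLpNorm (u t) 2 volume ≤ M

/-- `g` is the weak (distributional) derivative of `f` on `ℝ`, for `f, g ∈ L_2(ℝ)`. -/
def IsWeakDeriv (f g : Lp ℂ 2 (volume : Measure ℝ)) : Prop :=
  ∀ θ : ℝ → ℂ, ContDiff ℝ ∞ θ → HasCompactSupport θ →
    ∫ x, f x * deriv θ x = - ∫ x, g x * θ x

/-- `φ ∈ C¹([0,T]; L_2) ∩ C([0,T]; H³)` with `φ(T) = 0`. Here `φt` is the time derivative of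
the curve `φ` in `L_2` (one-sided at the end points), and `φ1, φ2, φ3` are the weak space
derivatives of orders 1, 2, 3. Continuity into `H³` is continuity into `L_2` of `φ` (which
follows from its differentiability) and of `φ1, φ2, φ3`. -/
structure IsTestFunction (T : ℝ) (φ φt φ1 φ2 φ3 : ℝ → Lp ℂ 2 (volume : Measure ℝ)) : Prop where
  hasDeriv : ∀ t ∈ Icc 0 T, HasDerivWithinAt φ (φt t) (Icc 0 T) t
  continuous_t : ContinuousOn φt (Icc 0 T)
  weak1 : ∀ t ∈ Icc 0 T, IsWeakDeriv (φ t) (φ1 t)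
  weak2 : ∀ t ∈ Icc 0 T, IsWeakDeriv (φ1 t) (φ2 t)
  weak3 : ∀ t ∈ Icc 0 T, IsWeakDeriv (φ2 t) (φ3 t)
  continuous1 : ContinuousOn φ1 (Icc 0 T)
  continuous2 : ContinuousOn φ2 (Icc 0 T)
  continuous3 : ContinuousOn φ3 (Icc 0 T)
  final : φ T = 0

/-- Weak solution in the strip `Π_T` of
`i u_t + a u_xx + i b u_x + i u_xxx + lam |u| u + i β (|u| u)_x + i d(x) u = 0`, `u(0,·) = u₀`.
For fixed `t` the integrand is integrable in `x` (an element of `H³` is bounded together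
with its first derivative), so the iterated integral is the integral over `Π_T`. -/
def IsWeakSolution (a b lam β : ℝ) (d : ℝ → ℝ) (u₀ : ℝ → ℂ) (T : ℝ) (u : ℝ → ℝ → ℂ) : Prop :=
  MemLinftyL2 T u ∧
  ∀ φ φt φ1 φ2 φ3 : ℝ → Lp ℂ 2 (volume : Measure ℝ), IsTestFunction T φ φt φ1 φ2 φ3 →
    (∫ t in Ioo 0 T, ∫ x,
      (Complex.I * u t x * φt t x
        - a * u t x * φ2 t x
        + Complex.I * b * u t x * φ1 t x
        + Complex.I * u t x * φ3 t x
        - lam * (‖u t x‖ * u t x) * φ t x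
        + Complex.I * β * (‖u t x‖ * u t x) * φ1 t x
        - Complex.I * d x * u t x * φ t x))
    + Complex.I * ∫ x, u₀ x * φ 0 x = 0

/-- `v` is the weak (distributional) derivative `u_x` of `u` in the strip `Π_T`. -/
def IsWeakXDeriv (T : ℝ) (u v : ℝ → ℝ → ℂ) : Prop :=
  LocallyIntegrableOn (fun z : ℝ × ℝ => u z.1 z.2) (strip T) volume ∧
  LocallyIntegrableOn (fun z : ℝ × ℝ => v z.1 z.2) (strip T) volume ∧
  ∀ θ : ℝ × ℝ → ℂ, ContDiff ℝ ∞ θ → HasCompactSupport θ → tsupport θ ⊆ strip T →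
    ∫ z in strip T, u z.1 z.2 * deriv (fun y => θ (z.1, y)) z.2
      = - ∫ z in strip T, v z.1 z.2 * θ z

/-- `sup_{x₀} ∫_0^T ∫_{x₀}^{x₀+1} |v|² dx dt`, as a value in `[0,∞]`. -/
noncomputable def sigma (T : ℝ) (v : ℝ → ℝ → ℂ) : ℝ≥0∞ :=
  ⨆ x₀ : ℝ, ∫⁻ z in Ioo 0 T ×ˢ Ioo x₀ (x₀ + 1), ‖v z.1 z.2‖ₑ ^ 2

/-- `ρ` is an admissible weight function `ρ_{α,ε}`. -/
structure IsRhoWeight (α ε : ℝ) (ρ : ℝ → ℝ) : Prop where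
  smooth : ContDiff ℝ ∞ ρ
  increasing : StrictMono ρ
  left : ∀ x ≤ -1, ρ x = Real.exp (2 * ε * x)
  right_pos : 0 < α → ∀ x, 0 ≤ x → ρ x = (1 + x) ^ (2 * α)
  right_zero : α = 0 → ∀ x, 0 ≤ x → ρ x = 2 - (Real.log (x + Real.exp 1))⁻¹
  deriv_pos : ∀ x ∈ Ioo (-1 : ℝ) 0, 0 < deriv ρ x

/-- `v ∈ L_2(0,T; L_2^ψ)`, where `L_2^ψ = {φ : φ ψ^{1/2} ∈ L_2(ℝ)}`. -/
def MemL2L2Weighted (T : ℝ) (ψ : ℝ → ℝ) (v : ℝ → ℝ → ℂ) : Prop :=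
  MemLp (fun z : ℝ × ℝ => (Real.sqrt (ψ z.2) : ℂ) * v z.1 z.2) 2 (volume.restrict (strip T))

end HNLS

/-!
The equation has two a priori estimates. Pairing it with `u` gives the growth bound
`‖u(t)‖ ≤ exp (‖d‖_∞ t) ‖u₀‖`. Pairing it with `ρ u`, for an increasing bounded weight `ρ` with
`|ρ''|, |ρ'''| ≤ ρ' ≤ ρ`, gives Kato's smoothing effect: the term `u_xxx` produces
`-(3/2) ∫ |u_x|² ρ'`, and all other terms, including the cubic term of the derivative nonlinearity,
are bounded by a part of it and a multiple of `∫ |u|² ρ`. With the logistic steps `ρ = σ(x - x₀)` this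
bounds `∫∫ |u_x|² σ'(x - x₀)` uniformly in `x₀`, by a constant that depends only on `T`, `‖u₀‖` and
`‖d‖_∞`; this is the local smoothing bound (`sigma_le`). The estimates for single steps are then
integrated over `x₀` against a density. Superpositions of steps produce the weight `(1 + x₊)^(2α)`, and
the corresponding superpositions of bumps `σ'` dominate `ρ'_{α,ε}`, so that the weighted statements
follow from the unweighted scheme (`exists_powWeight_bound`, `memL2L2Weighted_deriv_rho`).

Solutions are obtained from regularized problems in which everything is projected to the frequencies
`|ξ| ≤ k`, the nonlinearity is truncated to `min(|u|, N) u`, and a dissipation `-ε u_xxxx` is added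
(`vf`). These are ordinary differential equations in `L_2` with a Lipschitz right-hand side, hence
globally solvable (`exists_global_solution`). The truncated nonlinearity has the same algebraic
structure as the original one, so both estimates survive (`re_inner_vf_le`,
`re_inner_weight_vf_le`). The projection does not commute with the weight; the resulting error is
`O(N / k)` times norms of `u` and `u_xx`, and it is absorbed by the dissipation if the weight is bounded
below by `η > 0` and `k` is large compared with `N / (ε η)`. If `N → ∞`, `ε, η → 0` and
`k → ∞` are chosen accordingly, all bounds are uniform (`exists_approximation`).

For the limit, weak compactness at rational times and equicontinuity against band-limited functions
give weak convergence at every time (`exists_weak_limit`). On bounded sets the convergence is strong: the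
oscillation on small cells is controlled by the bound for `u_x`, and the finitely many mean values
converge (`eventually_integral_cut_sub_le`), which yields strong convergence in `L_2(-R, R)` at almost every
time (`exists_strong_limit`). As functions in `H¹` are bounded and vanish at infinity, this suffices for
the quadratic terms in the weak form (`integral_weak_form`). The weak derivative `u_x` is the weak limit of
the weighted gradients and inherits their bounds (`exists_weakXDeriv`).
-/

open FourierTransform Filter Topology

namespace HNLS

/-! ### Multiplication operators on `L_2` -/

/-- The Hilbert space `L_2(ℝ)` of complex-valued functions. -/
abbrev L2 : Type := Lp ℂ 2 (volume : Measure ℝ)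

section MulOp

variable {X : Type*} [MeasureSpace X]

/-- Multiplication by an essentially bounded function, as an operator on `L_2`; it is the zero
operator when `m` is not in `L_∞`. -/
noncomputable def mulOp (m : X → ℂ) : Lp ℂ 2 (volume : Measure X) →L[ℂ] Lp ℂ 2 (volume : Measure X) :=
  open Classical in
  if h : MemLp m ⊤ volume then
    (ContinuousLinearMap.mul ℂ ℂ).holderL volume ⊤ 2 2 (h.toLp m)
  else 0

lemma memLp_top_of_forall_norm_le {m : X → ℂ} (hm : AEStronglyMeasurable m volume) {C : ℝ}
    (hC : ∀ x, ‖m x‖ ≤ C) : MemLp m ⊤ volume :=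
  memLp_top_of_bound hm C (Filter.Eventually.of_forall hC)

lemma mulOp_coe {m : X → ℂ} (h : MemLp m ⊤ volume) (f : Lp ℂ 2 (volume : Measure X)) :
    mulOp m f =ᵐ[volume] fun x => m x * f x := by
  unfold mulOp
  rw [dif_pos h]
  filter_upwards [(ContinuousLinearMap.mul ℂ ℂ).coeFn_holder (r := 2) (h.toLp m) f, h.coeFn_toLp] with x h1 h2
  rw [← h2]
  exact h1

/-- The norm of an element of `L_2` is controlled by a pointwise bound. -/
lemma norm_le_of_ae_bound {f g : Lp ℂ 2 (volume : Measure X)} {C : ℝ}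
    (h : ∀ᵐ x ∂(volume : Measure X), ‖f x‖ ≤ C * ‖g x‖) : ‖f‖ ≤ C * ‖g‖ :=
  Lp.norm_le_mul_norm_of_ae_le_mul h

lemma norm_mulOp_le {m : X → ℂ} {C : ℝ} (hC0 : 0 ≤ C)
    (hC : ∀ᵐ x ∂(volume : Measure X), ‖m x‖ ≤ C) (f : Lp ℂ 2 (volume : Measure X)) : ‖mulOp m f‖ ≤ C * ‖f‖ := by
  by_cases h : MemLp m ⊤ volume
  · refine norm_le_of_ae_bound ?_
    filter_upwards [hC, mulOp_coe h f] with x hx h1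
    rw [h1, norm_mul]
    gcongr
  · have : mulOp m = 0 := by unfold mulOp; rw [dif_neg h]
    rw [this]
    simpa using by positivity

lemma inner_eq_integral (f g : Lp ℂ 2 (volume : Measure X)) : inner ℂ f g = ∫ x, starRingEnd ℂ (f x) * g x := by
  rw [L2.inner_def]
  refine integral_congr_ae (Filter.Eventually.of_forall fun x => ?_)
  simp only [RCLike.inner_apply]
  ring

/-- The inner product computed from representatives. -/
lemma inner_eq_integral_of_ae {f g : Lp ℂ 2 (volume : Measure X)} {F G : X → ℂ} (hf : f =ᵐ[volume] F)
    (hg : g =ᵐ[volume] G) : inner ℂ f g = ∫ x, starRingEnd ℂ (F x) * G x := by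
  rw [inner_eq_integral]
  refine integral_congr_ae ?_
  filter_upwards [hf, hg] with x h1 h2
  rw [h1, h2]

end MulOp

lemma norm_sq_eq_integral {f : L2} {F : ℝ → ℂ} (hf : f =ᵐ[volume] F) :
    ‖f‖ ^ 2 = ∫ x, ‖F x‖ ^ 2 := by
  have h := inner_eq_integral_of_ae hf hf
  have h2 := inner_self_eq_norm_sq (𝕜 := ℂ) f
  rw [← h2, h]
  have : (fun x => starRingEnd ℂ (F x) * F x) = fun x => ((‖F x‖ ^ 2 : ℝ) : ℂ) := by
    funext x
    rw [mul_comm, Complex.mul_conj, Complex.normSq_eq_norm_sq]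
  rw [this, integral_complex_ofReal]
  simp

/-- Multiplication operators are adjoint to multiplication by the conjugate. -/
lemma inner_mulOp {m : ℝ → ℂ} (h : MemLp m ⊤ volume) (f g : L2) :
    inner ℂ f (mulOp m g) = ∫ x, starRingEnd ℂ (f x) * (m x * g x) :=
  inner_eq_integral_of_ae (Filter.EventuallyEq.refl _ _) (mulOp_coe h g)

lemma inner_mulOp_left {m : ℝ → ℂ} (h : MemLp m ⊤ volume) (f g : L2) :
    inner ℂ (mulOp m f) g = ∫ x, starRingEnd ℂ (m x * f x) * g x :=
  inner_eq_integral_of_ae (mulOp_coe h f) (Filter.EventuallyEq.refl _ _)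

lemma inner_mulOp_conj {m : ℝ → ℂ} (h : MemLp m ⊤ volume) (f g : L2) :
    inner ℂ (mulOp m f) g = inner ℂ f (mulOp (fun x => starRingEnd ℂ (m x)) g) := by
  have h' : MemLp (fun x => starRingEnd ℂ (m x)) ⊤ volume := h.star
  rw [inner_mulOp_left h, inner_mulOp h']
  congr 1
  funext x
  rw [map_mul]
  ring

lemma inner_mulOp_real {m : ℝ → ℝ} (h : MemLp (fun x => (m x : ℂ)) ⊤ volume) (f g : L2) :
    inner ℂ (mulOp (fun x => (m x : ℂ)) f) g = inner ℂ f (mulOp (fun x => (m x : ℂ)) g) := by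
  rw [inner_mulOp_conj h]
  simp

lemma mulOp_comp {m m' : ℝ → ℂ} (h : MemLp m ⊤ volume) (h' : MemLp m' ⊤ volume) (f : L2) :
    mulOp m (mulOp m' f) = mulOp (fun x => m x * m' x) f := by
  have h'' : MemLp (fun x => m x * m' x) ⊤ volume := h'.mul' h
  ext1
  filter_upwards [mulOp_coe h (mulOp m' f), mulOp_coe h' f, mulOp_coe h'' f] with x h1 h2 h3
  rw [h1, h2, h3, mul_assoc]

lemma integrable_mul_L2 {f g : ℝ → ℂ} (hf : MemLp f 2 volume) (hg : MemLp g 2 volume) :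
    Integrable (fun x => f x * g x) volume :=
  memLp_one_iff_integrable.1 (hg.mul' (r := 1) hf)

/-! ### Band-limited derivatives -/

/-- The inverse Fourier transform on `L_2`, defined by density, is given by the integral for integrable
functions: both sides agree when tested against smooth functions with compact support. -/
lemma fourierInv_lp_ae_eq (g : L2) (hg : Integrable (fun x => g x) volume) :
    (𝓕⁻ g : L2) =ᵐ[volume] fun x => 𝓕⁻ (fun ξ => g ξ) x := by
  have hcont : Continuous (fun x => 𝓕⁻ (fun ξ => g ξ) x) := by
    have h1 : Continuous (𝓕 (fun ξ => g ξ)) :=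
      VectorFourier.fourierIntegral_continuous Real.continuous_fourierChar
        (by exact continuous_inner) hg
    have : (fun x => 𝓕⁻ (fun ξ => g ξ) x) = fun x => 𝓕 (fun ξ => g ξ) (-x) := by
      funext x; rw [Real.fourierInv_eq_fourier_neg]
    rw [this]
    exact h1.comp continuous_neg
  have hloc : LocallyIntegrable (fun x => (𝓕⁻ g : L2) x) volume :=
    (Lp.memLp (𝓕⁻ g : L2)).locallyIntegrable (by norm_num)
  refine ae_eq_of_integral_contDiff_smul_eq hloc hcont.locallyIntegrable ?_
  intro θ hθ hθc
  have hθ' : ContDiff ℝ ∞ (fun x => (θ x : ℂ)) := Complex.ofRealCLM.contDiff.comp hθ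
  have hθc' : HasCompactSupport (fun x => (θ x : ℂ)) := hθc.comp_left (g := fun y : ℝ => (y : ℂ)) (by simp)
  set S : SchwartzMap ℝ ℂ := hθc'.toSchwartzMap hθ' with hS
  have hSx : ∀ x, S x = (θ x : ℂ) := fun x => by simp [hS]
  have h1 := congrArg (fun (L : TemperedDistribution ℝ ℂ) => L S) (Lp.fourierInv_toTemperedDistribution_eq g)
  simp only [TemperedDistribution.fourierInv_apply, Lp.toTemperedDistribution_apply] at h1
  have h2 : ∫ x, (𝓕⁻ S) x • g x = ∫ x, S x • 𝓕⁻ (fun ξ => g ξ) x := by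
    have := VectorFourier.integral_fourierIntegral_smul_eq_flip (L := -innerₗ ℝ) (μ := volume) (ν := volume)
      Real.continuous_fourierChar (by fun_prop) S.integrable hg
    rw [SchwartzMap.fourierInv_coe]
    refine Eq.trans rfl (this.trans (integral_congr_ae (Filter.Eventually.of_forall fun x => ?_)))
    simp only [Real.fourierInv_eq, VectorFourier.fourierIntegral]
    simp [mul_comm]
  rw [h2] at h1
  simp only [hSx] at h1
  simp only [Complex.real_smul]
  exact h1.symm

/-- The symbol `(2πiξ) ^ j 1_{|ξ| ≤ k}`. -/
noncomputable def symb (k : ℝ) (j : ℕ) (ξ : ℝ) : ℂ :=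
  (Icc (-k) k).indicator (fun ξ => (2 * Real.pi * Complex.I * ξ) ^ j) ξ

lemma norm_symb_le {k : ℝ} (j : ℕ) (ξ : ℝ) : ‖symb k j ξ‖ ≤ (2 * Real.pi * |k|) ^ j := by
  unfold symb
  by_cases h : ξ ∈ Icc (-k) k
  · rw [indicator_of_mem h]
    simp only [norm_pow, norm_mul, Complex.norm_I, Complex.norm_real, Complex.norm_ofNat,
      Real.norm_eq_abs, abs_of_pos Real.pi_pos, mul_one]
    exact pow_le_pow_left₀ (by positivity) (mul_le_mul_of_nonneg_left
      ((abs_le.2 h).trans (le_abs_self k)) (by positivity)) _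
  · rw [indicator_of_notMem h, norm_zero]
    positivity

lemma measurable_symb (k : ℝ) (j : ℕ) : Measurable (symb k j) := by
  unfold symb
  exact Measurable.indicator (by fun_prop) measurableSet_Icc

lemma memLp_top_symb (k : ℝ) (j : ℕ) : MemLp (symb k j) ⊤ volume :=
  memLp_top_of_forall_norm_le (measurable_symb k j).aestronglyMeasurable (norm_symb_le j)

lemma memLp_two_symb (k : ℝ) (j : ℕ) : MemLp (symb k j) 2 volume := by
  have h : MemLp ((Icc (-k) k).indicator (symb k j)) 2 volume := by
    rw [memLp_indicator_iff_restrict measurableSet_Icc]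
    exact MemLp.of_bound (measurable_symb k j).aestronglyMeasurable _
      (Filter.Eventually.of_forall (norm_symb_le j))
  have e : (Icc (-k) k).indicator (symb k j) = symb k j := by
    funext ξ
    unfold symb
    simp [indicator_indicator]
  rwa [e] at h

lemma symb_mul (k : ℝ) (i j : ℕ) (ξ : ℝ) : symb k i ξ * symb k j ξ = symb k (i + j) ξ := by
  unfold symb
  by_cases h : ξ ∈ Icc (-k) k
  · simp only [indicator_of_mem h, pow_add]
  · simp only [indicator_of_notMem h, mul_zero]

lemma symb_zero_of_le {k l : ℝ} (h : k ≤ l) (j : ℕ) (ξ : ℝ) :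
    symb l 0 ξ * symb k j ξ = symb k j ξ := by
  unfold symb
  by_cases hx : ξ ∈ Icc (-k) k
  · have : ξ ∈ Icc (-l) l := ⟨by linarith [hx.1], by linarith [hx.2]⟩
    simp [indicator_of_mem hx, indicator_of_mem this]
  · simp [indicator_of_notMem hx]

lemma conj_symb (k : ℝ) (j : ℕ) (ξ : ℝ) :
    starRingEnd ℂ (symb k j ξ) = (-1) ^ j * symb k j ξ := by
  unfold symb
  by_cases h : ξ ∈ Icc (-k) k
  · simp only [indicator_of_mem h, map_pow, map_mul, Complex.conj_ofReal, Complex.conj_I,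
      ← mul_pow, map_ofNat]
    congr 1
    ring
  · simp only [indicator_of_notMem h, map_zero, mul_zero]

/-- The band-limited derivative `P_k ∂_x ^ j`, where `P_k` is the projector onto the frequencies
`|ξ| ≤ k`; in particular `bandD k 0 = P_k`. -/
noncomputable def bandD (k : ℝ) (j : ℕ) : L2 →L[ℂ] L2 :=
  ((Lp.fourierTransformₗᵢ ℝ ℂ).symm : L2 →L[ℂ] L2) ∘L mulOp (symb k j) ∘L
    ((Lp.fourierTransformₗᵢ ℝ ℂ) : L2 →L[ℂ] L2)

lemma bandD_eq (k : ℝ) (j : ℕ) (u : L2) : bandD k j u = 𝓕⁻ (mulOp (symb k j) (𝓕 u)) := rfl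

lemma fourier_bandD (k : ℝ) (j : ℕ) (u : L2) :
    𝓕 (bandD k j u) = mulOp (symb k j) (𝓕 u) := by
  rw [bandD_eq, fourier_fourierInv_eq]

lemma bandD_bandD (k : ℝ) (i j : ℕ) (u : L2) : bandD k i (bandD k j u) = bandD k (i + j) u := by
  rw [bandD_eq, fourier_bandD, mulOp_comp (memLp_top_symb k i) (memLp_top_symb k j), bandD_eq]
  simp only [symb_mul]

lemma bandD_zero_bandD {k l : ℝ} (h : k ≤ l) (j : ℕ) (u : L2) :
    bandD l 0 (bandD k j u) = bandD k j u := by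
  rw [bandD_eq, fourier_bandD, mulOp_comp (memLp_top_symb l 0) (memLp_top_symb k j), bandD_eq]
  simp only [symb_zero_of_le h]

lemma norm_bandD_le (k : ℝ) (j : ℕ) (u : L2) :
    ‖bandD k j u‖ ≤ (2 * Real.pi * |k|) ^ j * ‖u‖ := by
  rw [← Lp.norm_fourier_eq, fourier_bandD, ← Lp.norm_fourier_eq u]
  exact norm_mulOp_le (by positivity) (Filter.Eventually.of_forall (norm_symb_le j)) _

lemma norm_bandD_zero_le (k : ℝ) (u : L2) : ‖bandD k 0 u‖ ≤ ‖u‖ := by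
  simpa using norm_bandD_le k 0 u

/-- Integration by parts for band-limited derivatives. -/
lemma inner_bandD (k : ℝ) (j : ℕ) (u v : L2) :
    inner ℂ (bandD k j u) v = (-1) ^ j * inner ℂ u (bandD k j v) := by
  rw [← Lp.inner_fourier_eq, fourier_bandD, ← Lp.inner_fourier_eq u, fourier_bandD,
    inner_mulOp_left (memLp_top_symb k j), inner_mulOp (memLp_top_symb k j), ← integral_const_mul]
  congr 1
  funext ξ
  rw [map_mul, conj_symb]
  ring

lemma inner_bandD_zero (k : ℝ) (u v : L2) :
    inner ℂ (bandD k 0 u) v = inner ℂ u (bandD k 0 v) := by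
  simpa using inner_bandD k 0 u v

/-- The classical (smooth) representative of `P_k ∂_x ^ j u`. -/
noncomputable def wave (k : ℝ) (j : ℕ) (u : L2) (x : ℝ) : ℂ :=
  𝓕⁻ (fun ξ => symb k j ξ * (𝓕 u : L2) ξ) x

lemma integrable_symb_mul (k : ℝ) (j : ℕ) (u : L2) :
    Integrable (fun ξ => symb k j ξ * u ξ) volume :=
  integrable_mul_L2 (memLp_two_symb k j) (Lp.memLp u)

lemma bandD_ae_eq_wave (k : ℝ) (j : ℕ) (u : L2) : bandD k j u =ᵐ[volume] wave k j u := by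
  have h := mulOp_coe (memLp_top_symb k j) (𝓕 u : L2)
  have h1 := fourierInv_lp_ae_eq (mulOp (symb k j) (𝓕 u)) ((integrable_symb_mul k j (𝓕 u)).congr h.symm)
  rw [bandD_eq]
  refine h1.trans (Filter.Eventually.of_forall fun x => ?_)
  exact Real.fourierInv_congr_ae h x

lemma memLp_wave (k : ℝ) (j : ℕ) (u : L2) : MemLp (wave k j u) 2 volume :=
  (memLp_congr_ae (bandD_ae_eq_wave k j u)).1 (Lp.memLp _)

lemma hasDerivAt_wave (k : ℝ) (j : ℕ) (u : L2) (x : ℝ) :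
    HasDerivAt (wave k j u) (wave k (j + 1) u x) x := by
  have hx : ∀ ξ, symb k (j + 1) ξ = 2 * Real.pi * Complex.I * ξ * symb k j ξ := by
    intro ξ
    unfold symb
    by_cases h : ξ ∈ Icc (-k) k
    · simp only [indicator_of_mem h]; ring
    · simp only [indicator_of_notMem h, mul_zero]
  have hi2 : Integrable (fun ξ : ℝ => ξ • (symb k j ξ * (𝓕 u : L2) ξ)) volume := by
    have := (integrable_symb_mul k (j + 1) (𝓕 u)).const_mul (1 / (2 * Real.pi * Complex.I))
    refine this.congr (Filter.Eventually.of_forall fun ξ => ?_)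
    simp only [hx, Complex.real_smul]
    have : (Real.pi : ℂ) ≠ 0 := by exact_mod_cast Real.pi_ne_zero
    have := Complex.I_ne_zero
    field_simp
  have h := Real.hasDerivAt_fourier (integrable_symb_mul k j (𝓕 u)) hi2 (-x)
  have h2 := h.scomp x (hasDerivAt_neg x)
  have e : (𝓕 (fun ξ => symb k j ξ * (𝓕 u : L2) ξ) ∘ fun y => -y) = wave k j u := by
    funext y
    simp only [Function.comp, wave, Real.fourierInv_eq_fourier_neg]
  rw [show (𝓕 (fun ξ => symb k j ξ * (𝓕 u : L2) ξ) ∘ Neg.neg) = wave k j u from e] at h2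
  have e3 : wave k (j + 1) u x =
      (-1 : ℝ) • 𝓕 (fun x : ℝ => (-2 * Real.pi * Complex.I * x) • (symb k j x * (𝓕 u : L2) x)) (-x) := by
    rw [wave, Real.fourierInv_eq_fourier_neg, neg_one_smul, Real.fourier_eq, Real.fourier_eq,
      ← integral_neg]
    congr 1
    funext ξ
    simp only [hx, smul_eq_mul, Circle.smul_def]
    ring
  rw [e3]
  exact h2

lemma continuous_wave (k : ℝ) (j : ℕ) (u : L2) : Continuous (wave k j u) :=
  continuous_iff_continuousAt.2 fun x => (hasDerivAt_wave k j u x).continuousAt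

/-- The `L_2` norm of the symbol, which bounds band-limited functions pointwise. -/
noncomputable def symbNorm (k : ℝ) (j : ℕ) : ℝ := ‖(memLp_two_symb k j).toLp‖

lemma norm_wave_le (k : ℝ) (j : ℕ) (u : L2) (x : ℝ) : ‖wave k j u x‖ ≤ symbNorm k j * ‖u‖ := by
  rw [wave, Real.fourierInv_eq]
  refine (norm_integral_le_integral_norm _).trans ?_
  simp only [Circle.norm_smul, norm_mul]
  have h := (memLp_two_symb k j)
  have hh := integral_mul_norm_le_Lp_mul_Lq (μ := volume) (f := symb k j) (g := fun ξ => (𝓕 u : L2) ξ)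
    (p := 2) (q := 2) (by rw [Real.holderConjugate_iff]; norm_num) (by simpa using h)
    (by simpa using Lp.memLp (𝓕 u : L2))
  refine hh.trans (le_of_eq ?_)
  have e1 : ∀ (f : ℝ → ℂ) (hf : MemLp f 2 volume), (∫ a, ‖f a‖ ^ (2:ℝ)) ^ (1 / (2:ℝ)) = ‖hf.toLp‖ := by
    intro f hf
    rw [← Real.sqrt_eq_rpow, ← Real.sqrt_sq (norm_nonneg (hf.toLp)), norm_sq_eq_integral hf.coeFn_toLp]
    simp
  rw [e1 _ h, e1 _ (Lp.memLp (𝓕 u : L2)), symbNorm]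
  congr 1
  rw [Lp.toLp_coeFn, Lp.norm_fourier_eq]

lemma wave_sub (k : ℝ) (j : ℕ) (u v : L2) (x : ℝ) :
    wave k j (u - v) x = wave k j u x - wave k j v x := by
  have hc : Continuous fun x => wave k j (u - v) x := continuous_wave k j _
  have hc' : Continuous fun x => wave k j u x - wave k j v x :=
    (continuous_wave k j _).sub (continuous_wave k j _)
  have : (fun x => wave k j (u - v) x) = fun x => wave k j u x - wave k j v x := by
    refine Continuous.ae_eq_iff_eq volume hc hc' |>.1 ?_
    have h := bandD_ae_eq_wave k j (u - v)
    rw [map_sub] at h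
    filter_upwards [h, bandD_ae_eq_wave k j u, bandD_ae_eq_wave k j v,
      Lp.coeFn_sub (bandD k j u) (bandD k j v)] with x h1 h2 h3 h4
    rw [← h1, h4, Pi.sub_apply, h2, h3]
  exact congrFun this x

/-! ### Weak derivatives and the Fourier transform -/

lemma contDiff_wave (k : ℝ) (j : ℕ) (u : L2) : ContDiff ℝ ∞ (wave k j u) := by
  rw [contDiff_infty]
  intro n
  induction n generalizing j with
  | zero => exact_mod_cast contDiff_zero.2 (continuous_wave k j u)
  | succ n ih =>
    have hd : deriv (wave k j u) = wave k (j + 1) u := funext fun x => (hasDerivAt_wave k j u x).deriv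
    have : ContDiff ℝ ((n : WithTop ℕ∞) + 1) (wave k j u) := by
      rw [contDiff_succ_iff_deriv]
      refine ⟨fun x => (hasDerivAt_wave k j u x).differentiableAt, by simp, ?_⟩
      rw [hd]
      exact ih (j + 1)
    exact_mod_cast this

/-- A smooth cut-off function, equal to `1` on `[-1,1]` and supported in `[-2,2]`. -/
lemma exists_cutoff : ∃ χ : ℝ → ℝ, ContDiff ℝ ∞ χ ∧ HasCompactSupport χ ∧ (∀ x, |x| ≤ 1 → χ x = 1) ∧
    (∀ x, 0 ≤ χ x ∧ χ x ≤ 1) ∧ ∃ C, ∀ x, |deriv χ x| ≤ C := by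
  let b : ContDiffBump (0 : ℝ) := ⟨1, 2, by norm_num, by norm_num⟩
  refine ⟨b, b.contDiff, b.hasCompactSupport, ?_, fun x => ⟨b.nonneg, b.le_one⟩, ?_⟩
  · intro x hx
    exact b.one_of_mem_closedBall (by simpa [b] using hx)
  · have hc : Continuous (deriv b) := (show ContDiff ℝ 1 b from b.contDiff).continuous_deriv le_rfl
    obtain ⟨C, hC⟩ := hc.bounded_above_of_compact_support b.hasCompactSupport.deriv
    exact ⟨C, fun x => hC x⟩

/-- Weak derivatives may be tested against smooth functions which lie in `L_2` together with
their first derivative. -/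
lemma IsWeakDeriv.integral_mul_deriv {f g : L2} (h : IsWeakDeriv f g) {θ : ℝ → ℂ}
    (hθ : ContDiff ℝ ∞ θ) (h0 : MemLp θ 2 volume) (h1 : MemLp (deriv θ) 2 volume) :
    ∫ x, f x * deriv θ x = - ∫ x, g x * θ x := by
  obtain ⟨χ, hχ, hχc, hχ1, hχb, C, hC⟩ := exists_cutoff
  have hC0 : 0 ≤ C := (abs_nonneg _).trans (hC 0)
  set s : ℕ → ℝ := fun n => 1 / ((n : ℝ) + 1) with hs
  have hs0 : Tendsto s atTop (𝓝 0) := tendsto_one_div_add_atTop_nhds_zero_nat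
  have hspos : ∀ n, 0 < s n := fun n => by simp only [hs]; positivity
  have hsle : ∀ n, s n ≤ 1 := fun n => by
    simp only [hs]; rw [div_le_one (by positivity)]; linarith [(Nat.cast_nonneg n : (0:ℝ) ≤ n)]
  set η : ℕ → ℝ → ℂ := fun n x => ((χ (s n * x) : ℝ) : ℂ) with hη
  have hχs : ∀ n, ContDiff ℝ ∞ (fun x => χ (s n * x)) := fun n => hχ.comp (by fun_prop)
  have hηs : ∀ n, ContDiff ℝ ∞ (η n) := fun n => Complex.ofRealCLM.contDiff.comp (hχs n)
  have hηd : ∀ n x, HasDerivAt (η n) (((s n * deriv χ (s n * x) : ℝ)) : ℂ) x := by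
    intro n x
    have h1 : HasDerivAt χ (deriv χ (s n * x)) (s n * x) :=
      (hχ.differentiable (by simp) _).hasDerivAt
    have h2 : HasDerivAt (fun x => s n * x) (s n) x := by simpa using (hasDerivAt_id x).const_mul (s n)
    have h3 := h1.comp x h2
    rw [mul_comm] at h3
    exact h3.ofReal_comp
  have hηc : ∀ n, HasCompactSupport (η n) := by
    intro n
    have : HasCompactSupport (fun x => χ (s n * x)) :=
      hχc.comp_homeomorph (Homeomorph.mulLeft₀ (s n) (hspos n).ne')
    exact this.comp_left (g := fun y : ℝ => (y : ℂ)) (by simp)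
  have hθd : ∀ x, HasDerivAt θ (deriv θ x) x := fun x => (hθ.differentiable (by simp) _).hasDerivAt
  have key : ∀ n, ∫ x, f x * (((s n * deriv χ (s n * x) : ℝ) : ℂ) * θ x + η n x * deriv θ x)
      = - ∫ x, g x * (η n x * θ x) := by
    intro n
    have := h (fun x => η n x * θ x) ((hηs n).mul hθ) ((hηc n).mul_right)
    rw [← this]
    congr 1
    funext x
    rw [show deriv (fun x => η n x * θ x) x = _ from ((hηd n x).mul (hθd x)).deriv]
  have hlim : ∀ x, ∀ᶠ n in atTop, η n x = 1 := by
    intro x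
    have : Tendsto (fun n => |s n * x|) atTop (𝓝 0) := by
      simpa using (hs0.mul_const x).abs
    filter_upwards [this.eventually (gt_mem_nhds zero_lt_one)] with n hn
    simp only [hη]
    rw [hχ1 _ hn.le]; simp
  have hlimd : ∀ x, Tendsto (fun n => ((s n * deriv χ (s n * x) : ℝ) : ℂ)) atTop (𝓝 0) := by
    intro x
    rw [tendsto_zero_iff_norm_tendsto_zero]
    refine squeeze_zero (fun _ => norm_nonneg _) (fun n => ?_) (by simpa using hs0.mul_const C)
    rw [Complex.norm_real, Real.norm_eq_abs, abs_mul, abs_of_pos (hspos n)]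
    exact mul_le_mul_of_nonneg_left (hC _) (hspos n).le
  have hηb : ∀ n x, ‖η n x‖ ≤ 1 := by
    intro n x
    simp only [hη]
    rw [Complex.norm_real, Real.norm_eq_abs, abs_of_nonneg (hχb _).1]
    exact (hχb _).2
  have hf := Lp.memLp f
  have hg := Lp.memLp g
  have L1 : Tendsto (fun n => ∫ x, f x * (((s n * deriv χ (s n * x) : ℝ) : ℂ) * θ x + η n x * deriv θ x))
      atTop (𝓝 (∫ x, f x * deriv θ x)) := by
    refine tendsto_integral_of_dominated_convergence (fun x => ‖f x * θ x‖ * C + ‖f x * deriv θ x‖) ?_ ?_ ?_ ?_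
    · intro n
      refine hf.1.mul (AEStronglyMeasurable.add ?_ ((hηs n).continuous.aestronglyMeasurable.mul h1.1))
      refine AEStronglyMeasurable.mul ?_ h0.1
      exact Continuous.aestronglyMeasurable (Complex.continuous_ofReal.comp
        (continuous_const.mul ((hχ.continuous_deriv (by simp)).comp (by fun_prop))))
    · exact ((integrable_mul_L2 hf h0).norm.mul_const C).add (integrable_mul_L2 hf h1).norm
    · intro n
      refine Eventually.of_forall fun x => ?_
      rw [mul_add]
      refine (norm_add_le _ _).trans (add_le_add ?_ ?_)
      · rw [mul_left_comm, norm_mul, mul_comm]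
        refine mul_le_mul_of_nonneg_left ?_ (norm_nonneg _)
        rw [Complex.norm_real, Real.norm_eq_abs, abs_mul, abs_of_pos (hspos n)]
        calc s n * |deriv χ (s n * x)| ≤ 1 * C := mul_le_mul (hsle n) (hC _) (abs_nonneg _) zero_le_one
          _ = C := one_mul C
      · rw [mul_left_comm, norm_mul]
        exact mul_le_of_le_one_left (norm_nonneg _) (hηb n x)
    · refine Eventually.of_forall fun x => ?_
      have : Tendsto (fun n => η n x) atTop (𝓝 1) :=
        tendsto_const_nhds.congr' ((hlim x).mono fun n hn => hn.symm)
      simpa using (((hlimd x).mul_const (θ x)).add (this.mul_const (deriv θ x))).const_mul (f x)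
  have L2 : Tendsto (fun n => - ∫ x, g x * (η n x * θ x)) atTop (𝓝 (- ∫ x, g x * θ x)) := by
    refine (tendsto_integral_of_dominated_convergence (fun x => ‖g x * θ x‖) ?_ ?_ ?_ ?_).neg
    · intro n
      exact hg.1.mul ((hηs n).continuous.aestronglyMeasurable.mul h0.1)
    · exact (integrable_mul_L2 hg h0).norm
    · intro n
      refine Eventually.of_forall fun x => ?_
      rw [mul_left_comm, norm_mul]
      exact mul_le_of_le_one_left (norm_nonneg _) (hηb n x)
    · refine Eventually.of_forall fun x => ?_
      have : Tendsto (fun n => η n x) atTop (𝓝 1) :=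
        tendsto_const_nhds.congr' ((hlim x).mono fun n hn => hn.symm)
      simpa using (this.mul_const (θ x)).const_mul (g x)
  exact tendsto_nhds_unique L1 (L2.congr fun n => (key n).symm)

/-- On band-limited parts, weak derivatives are given by the Fourier symbol. -/
lemma IsWeakDeriv.bandD_one {f g : L2} (h : IsWeakDeriv f g) (k : ℝ) : bandD k 1 f = bandD k 0 g := by
  refine ext_inner_left ℂ fun u => ?_
  have h1 : inner ℂ u (bandD k 1 f) = - inner ℂ (bandD k 1 u) f := by
    rw [inner_bandD]; ring
  rw [h1, ← inner_bandD_zero,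
    inner_eq_integral_of_ae (bandD_ae_eq_wave k 1 u) (Filter.EventuallyEq.refl _ _),
    inner_eq_integral_of_ae (bandD_ae_eq_wave k 0 u) (Filter.EventuallyEq.refl _ _)]
  set θ : ℝ → ℂ := fun x => starRingEnd ℂ (wave k 0 u x) with hθ
  have hd : deriv θ = fun x => starRingEnd ℂ (wave k 1 u x) := by
    funext x
    exact ((hasDerivAt_wave k 0 u x).star).deriv
  have hs : ContDiff ℝ ∞ θ := Complex.conjCLE.contDiff.comp (contDiff_wave k 0 u)
  have := h.integral_mul_deriv hs (memLp_wave k 0 u).star (by rw [hd]; exact (memLp_wave k 1 u).star)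
  rw [hd] at this
  simp only [hθ] at this
  simp only [mul_comm (starRingEnd ℂ _)]
  rw [this, neg_neg]

lemma IsWeakDeriv.bandD_succ {f g : L2} (h : IsWeakDeriv f g) (k : ℝ) (j : ℕ) :
    bandD k (j + 1) f = bandD k j g := by
  rw [← bandD_bandD, h.bandD_one, bandD_bandD, add_zero]

lemma IsWeakDeriv.fourier {f g : L2} (h : IsWeakDeriv f g) :
    ∀ᵐ ξ ∂(volume : Measure ℝ), (𝓕 g : L2) ξ = 2 * Real.pi * Complex.I * ξ * (𝓕 f : L2) ξ := by
  have h1 : ∀ n : ℕ, ∀ᵐ ξ ∂(volume : Measure ℝ), symb n 1 ξ * (𝓕 f : L2) ξ = symb n 0 ξ * (𝓕 g : L2) ξ := by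
    intro n
    have := congrArg (fun v : L2 => (𝓕 v : L2)) (h.bandD_one n)
    simp only [fourier_bandD] at this
    have e := mulOp_coe (memLp_top_symb n 1) (𝓕 f : L2)
    rw [this] at e
    filter_upwards [e, mulOp_coe (memLp_top_symb n 0) (𝓕 g : L2)] with ξ h1 h2
    rw [← h1, h2]
  rw [← ae_all_iff] at h1
  filter_upwards [h1] with ξ hξ
  obtain ⟨n, hn⟩ := exists_nat_ge |ξ|
  have := hξ n
  have hm : ξ ∈ Icc (-(n : ℝ)) n := abs_le.1 hn
  unfold symb at this
  simp only [indicator_of_mem hm, pow_one, pow_zero, one_mul] at this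
  exact this.symm

/-- The frequencies above `k` of a function are controlled by its weak derivative. -/
lemma IsWeakDeriv.norm_sub_bandD_le {f g : L2} (h : IsWeakDeriv f g) {k : ℝ} (hk : 0 < k) :
    ‖f - bandD k 0 f‖ ≤ (2 * Real.pi * k)⁻¹ * ‖g‖ := by
  rw [← Lp.norm_fourier_eq, ← Lp.norm_fourier_eq g]
  refine norm_le_of_ae_bound ?_
  have e : (𝓕 (f - bandD k 0 f) : L2) = 𝓕 f - mulOp (symb k 0) (𝓕 f) := by
    rw [← fourier_bandD]
    exact map_sub (Lp.fourierTransformₗᵢ ℝ ℂ) f (bandD k 0 f)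
  rw [e]
  filter_upwards [h.fourier, mulOp_coe (memLp_top_symb k 0) (𝓕 f : L2),
    Lp.coeFn_sub (𝓕 f : L2) (mulOp (symb k 0) (𝓕 f))] with ξ h1 h2 h3
  rw [h3, Pi.sub_apply, h2, h1]
  unfold symb
  by_cases hx : ξ ∈ Icc (-k) k
  · simp only [indicator_of_mem hx, pow_zero, one_mul, sub_self, norm_zero]
    positivity
  · simp only [indicator_of_notMem hx, zero_mul, sub_zero, norm_mul, Complex.norm_I, Complex.norm_real,
      Complex.norm_ofNat, Real.norm_eq_abs, abs_of_pos Real.pi_pos, mul_one]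
    have hx' : k ≤ |ξ| := by
      by_contra hc
      exact hx (abs_le.1 (not_le.1 hc).le)
    rw [← mul_assoc]
    refine le_mul_of_one_le_left (norm_nonneg _) ?_
    rw [inv_mul_eq_div, one_le_div (by positivity)]
    gcongr

/-- The band-limited parts of an `L_2` function converge to it. -/
lemma tendsto_bandD_zero (f : L2) : Tendsto (fun k : ℝ => bandD k 0 f) atTop (𝓝 f) := by
  set v : L2 := 𝓕 f with hv
  have hi : Integrable (fun x => ‖v x‖ ^ 2) volume :=
    (memLp_two_iff_integrable_sq_norm (Lp.memLp v).1).1 (Lp.memLp v)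
  have e : ∀ k : ℝ, ‖bandD k 0 f - f‖ ^ 2 = ∫ ξ, ‖(symb k 0 ξ - 1) * v ξ‖ ^ 2 := by
    intro k
    rw [← Lp.norm_fourier_eq]
    refine norm_sq_eq_integral ?_
    have e : (𝓕 (bandD k 0 f - f) : L2) = mulOp (symb k 0) v - v := by
      rw [hv, ← fourier_bandD]
      exact map_sub (Lp.fourierTransformₗᵢ ℝ ℂ) (bandD k 0 f) f
    rw [e]
    filter_upwards [mulOp_coe (memLp_top_symb k 0) v, Lp.coeFn_sub (mulOp (symb k 0) v) v] with ξ h1 h2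
    rw [h2, Pi.sub_apply, h1]
    ring
  have h0 : Tendsto (fun k : ℝ => ∫ ξ, ‖(symb k 0 ξ - 1) * v ξ‖ ^ 2) atTop (𝓝 (∫ _ξ : ℝ, (0 : ℝ))) := by
    refine tendsto_integral_filter_of_dominated_convergence (fun ξ => 4 * ‖v ξ‖ ^ 2) ?_ ?_ (hi.const_mul 4) ?_
    · refine Eventually.of_forall fun k => ?_
      exact (((measurable_symb k 0).sub_const 1).aestronglyMeasurable.mul (Lp.memLp v).1).norm.pow 2
    · refine Eventually.of_forall fun k => Eventually.of_forall fun ξ => ?_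
      have h1 : ‖symb k 0 ξ - 1‖ ≤ 2 := by
        refine (norm_sub_le _ _).trans ?_
        have := norm_symb_le (k := k) 0 ξ
        rw [pow_zero] at this
        rw [norm_one]; linarith
      rw [norm_pow, norm_norm, norm_mul, mul_pow]
      have : ‖symb k 0 ξ - 1‖ ^ 2 ≤ 4 := by nlinarith [norm_nonneg (symb k 0 ξ - 1)]
      exact mul_le_mul_of_nonneg_right this (by positivity)
    · refine Eventually.of_forall fun ξ => ?_
      refine tendsto_const_nhds.congr' ?_
      filter_upwards [eventually_ge_atTop |ξ|] with k hk
      have : symb k 0 ξ = 1 := by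
        unfold symb
        rw [indicator_of_mem (show ξ ∈ Icc (-k) k from abs_le.1 hk)]; simp
      rw [this]; simp
  rw [integral_zero] at h0
  rw [tendsto_iff_norm_sub_tendsto_zero]
  have h1 := (h0.congr fun k => (e k).symm).sqrt
  simpa using h1

/-- One-dimensional Sobolev embedding: a continuous representative which is bounded and vanishes at
infinity. -/
lemma IsWeakDeriv.exists_rep {f g : L2} (h : IsWeakDeriv f g) :
    ∃ F : ℝ → ℂ, f =ᵐ[volume] F ∧ (∀ x, ‖F x‖ ≤ Real.pi + ‖f‖ ^ 2 + ‖g‖ ^ 2) ∧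
      Tendsto F (cocompact ℝ) (𝓝 0) := by
  have hb : ∀ᵐ ξ ∂(volume : Measure ℝ), ‖(𝓕 f : L2) ξ‖ ≤
      (1 + ξ ^ 2)⁻¹ + (‖(𝓕 f : L2) ξ‖ ^ 2 + ‖(𝓕 g : L2) ξ‖ ^ 2) := by
    filter_upwards [h.fourier] with ξ hξ
    set a := ‖(𝓕 f : L2) ξ‖
    have e : ‖(𝓕 g : L2) ξ‖ = 2 * Real.pi * |ξ| * a := by
      rw [hξ]
      simp only [norm_mul, Complex.norm_I, Complex.norm_real,
        Complex.norm_ofNat, Real.norm_eq_abs, abs_of_pos Real.pi_pos, mul_one]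
      rfl
    have e1 : ξ ^ 2 * a ^ 2 ≤ ‖(𝓕 g : L2) ξ‖ ^ 2 := by
      rw [e, mul_pow, mul_pow, sq_abs]
      have : 1 ≤ (2 * Real.pi) ^ 2 := by nlinarith [Real.pi_gt_three]
      have h2 : 0 ≤ ξ ^ 2 * a ^ 2 := by positivity
      nlinarith
    have hp : 0 < 1 + ξ ^ 2 := by positivity
    have h3 : a ≤ (1 + ξ ^ 2)⁻¹ + (1 + ξ ^ 2) * a ^ 2 := by
      set b := 1 + ξ ^ 2
      have : b⁻¹ + b * a ^ 2 - a = b⁻¹ * ((b * a - 1 / 2) ^ 2 + 3 / 4) := by field_simp; ring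
      have h4 : 0 ≤ b⁻¹ * ((b * a - 1 / 2) ^ 2 + 3 / 4) := by positivity
      linarith
    linarith
  have hsq : ∀ v : L2, Integrable (fun x => ‖v x‖ ^ 2) volume := fun v =>
    (memLp_two_iff_integrable_sq_norm (Lp.memLp v).1).1 (Lp.memLp v)
  have hi0 : Integrable (fun ξ : ℝ => (1 + ξ ^ 2)⁻¹ + (‖(𝓕 f : L2) ξ‖ ^ 2 + ‖(𝓕 g : L2) ξ‖ ^ 2)) volume :=
    integrable_inv_one_add_sq.add ((hsq _).add (hsq _))
  have hi1 : Integrable (fun ξ : ℝ => ‖(𝓕 f : L2) ξ‖ ^ 2 + ‖(𝓕 g : L2) ξ‖ ^ 2) volume :=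
    (hsq _).add (hsq _)
  have hint : Integrable (fun ξ => (𝓕 f : L2) ξ) volume :=
    hi0.mono' (Lp.memLp _).1 hb
  refine ⟨fun x => 𝓕⁻ (fun ξ => (𝓕 f : L2) ξ) x, ?_, ?_, ?_⟩
  · have := fourierInv_lp_ae_eq (𝓕 f : L2) hint
    rwa [fourierInv_fourier_eq] at this
  · intro x
    simp only [Real.fourierInv_eq]
    refine (norm_integral_le_integral_norm _).trans ?_
    simp only [Circle.norm_smul]
    refine (integral_mono_ae hint.norm hi0 hb).trans (le_of_eq ?_)
    rw [integral_add integrable_inv_one_add_sq hi1, integral_add (hsq _) (hsq _),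
      integral_univ_inv_one_add_sq, ← norm_sq_eq_integral (Filter.EventuallyEq.refl _ _),
      ← norm_sq_eq_integral (Filter.EventuallyEq.refl _ _), Lp.norm_fourier_eq, Lp.norm_fourier_eq, add_assoc]
  · have := Real.zero_at_infty_fourier (fun ξ => (𝓕 f : L2) ξ)
    simp only [Real.fourierInv_eq_fourier_neg]
    exact this.comp (Homeomorph.neg ℝ).isClosedEmbedding.tendsto_cocompact

/-- Classical derivatives are weak derivatives. -/
lemma isWeakDeriv_of_hasDerivAt {f g : L2} {F G : ℝ → ℂ} (hf : f =ᵐ[volume] F) (hg : g =ᵐ[volume] G)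
    (hF : ∀ x, HasDerivAt F (G x) x) (hG : Continuous G) : IsWeakDeriv f g := by
  intro θ hθ hθc
  have hθd : ∀ x, HasDerivAt θ (deriv θ x) x := fun x => (hθ.differentiable (by simp) _).hasDerivAt
  have hFc : Continuous F := continuous_iff_continuousAt.2 fun x => (hF x).continuousAt
  have hθ'c : Continuous (deriv θ) := hθ.continuous_deriv (by simp)
  have e1 : ∫ x, f x * deriv θ x = ∫ x, F x * deriv θ x := integral_congr_ae (by
    filter_upwards [hf] with x hx; rw [hx])
  have e2 : ∫ x, g x * θ x = ∫ x, G x * θ x := integral_congr_ae (by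
    filter_upwards [hg] with x hx; rw [hx])
  rw [e1, e2]
  refine integral_mul_deriv_eq_deriv_mul_of_integrable (fun x _ => hF x) (fun x _ => hθd x) ?_ ?_ ?_
  · exact (hFc.mul hθ'c).integrable_of_hasCompactSupport hθc.deriv.mul_left
  · exact (hG.mul hθ.continuous).integrable_of_hasCompactSupport hθc.mul_left
  · exact (hFc.mul hθ.continuous).integrable_of_hasCompactSupport hθc.mul_left

/-! ### Ordinary differential equations with a Lipschitz right-hand side -/

/-- Global existence for ordinary differential equations with a globally Lipschitz right-hand side.
The fixed point is taken in the space of curves growing at most like `exp ((2 K + 1) t)`, in which the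
Picard map is a contraction on the whole half-line at once. -/
theorem exists_global_solution {E : Type*} [NormedAddCommGroup E] [NormedSpace ℝ E]
    [CompleteSpace E] {F : E → E} {K : ℝ≥0} (hF : LipschitzWith K F) (x₀ : E) :
    ∃ u : ℝ → E, u 0 = x₀ ∧ ∀ t, 0 ≤ t → HasDerivAt u (F (u t)) t := by
  set L : ℝ := 2 * K + 1 with hL
  have hL0 : 0 < L := by positivity
  have hKL : (K : ℝ) / L ≤ 1 / 2 := by
    rw [div_le_div_iff₀ hL0 two_pos]; rw [hL]; linarith
  have hFb : ∀ x, ‖F x‖ ≤ ‖F 0‖ + K * ‖x‖ := by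
    intro x
    have h1 := hF.dist_le_mul x 0
    rw [dist_eq_norm, dist_zero_right] at h1
    calc ‖F x‖ = ‖F 0 + (F x - F 0)‖ := by rw [add_sub_cancel]
      _ ≤ _ := (norm_add_le _ _).trans (by gcongr)
  -- the integrand attached to a curve
  let G : BoundedContinuousFunction ℝ E → ℝ → E := fun v s => F (Real.exp (L * s) • v s)
  have hGc : ∀ v, Continuous (G v) := fun v => hF.continuous.comp (by fun_prop)
  have hexp : ∀ t, 0 ≤ t → ∫ s in (0 : ℝ)..t, Real.exp (L * s) = (Real.exp (L * t) - 1) / L := by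
    intro t _
    rw [intervalIntegral.integral_comp_mul_left (fun s => Real.exp s) hL0.ne']
    simp [integral_exp, div_eq_inv_mul]
  have hcalc : ∀ t, 0 ≤ t → Real.exp (-(L * t)) * ((Real.exp (L * t) - 1) / L) ≤ 1 / L := by
    intro t ht
    have : Real.exp (-(L * t)) * Real.exp (L * t) = 1 := by rw [← Real.exp_add]; simp
    rw [← mul_div_assoc]
    refine div_le_div_of_nonneg_right ?_ hL0.le
    rw [mul_sub, this, mul_one]
    linarith [Real.exp_pos (-(L * t))]
  let Ψf : BoundedContinuousFunction ℝ E → ℝ → E := fun v t =>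
    Real.exp (-(L * max t 0)) • (x₀ + ∫ s in (0 : ℝ)..(max t 0), G v s)
  have hΨc : ∀ v, Continuous (Ψf v) := by
    intro v
    have h1 : Continuous (fun t : ℝ => ∫ s in (0 : ℝ)..t, G v s) :=
      intervalIntegral.continuous_primitive (fun a b => (hGc v).intervalIntegrable a b) 0
    have h2 : Continuous (fun t : ℝ => ∫ s in (0 : ℝ)..(max t 0), G v s) :=
      h1.comp (continuous_id.max continuous_const)
    exact Continuous.smul (by fun_prop) (continuous_const.add h2)
  have hΨb : ∀ v t, ‖Ψf v t‖ ≤ ‖x₀‖ + (‖F 0‖ + K * ‖v‖) * (1 / L) := by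
    intro v t
    have ht : 0 ≤ max t 0 := le_max_right _ _
    set τ := max t 0
    have h1 : ‖∫ s in (0 : ℝ)..τ, G v s‖ ≤ ∫ s in (0 : ℝ)..τ, (‖F 0‖ + K * ‖v‖) * Real.exp (L * s) := by
      refine intervalIntegral.norm_integral_le_of_norm_le ht ?_ (Continuous.intervalIntegrable (by fun_prop) _ _)
      refine Eventually.of_forall fun s hs => ?_
      have hs1 : 1 ≤ Real.exp (L * s) := Real.one_le_exp (by have := hs.1; positivity)
      refine (hFb _).trans ?_
      rw [norm_smul, Real.norm_eq_abs, abs_of_pos (Real.exp_pos _), add_mul (‖F 0‖)]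
      have h3 := v.norm_coe_le_norm s
      have h4 : 0 ≤ ‖F 0‖ := norm_nonneg _
      have h5 : (K : ℝ) * (Real.exp (L * s) * ‖v s‖) ≤ K * ‖v‖ * Real.exp (L * s) := by
        have : Real.exp (L * s) * ‖v s‖ ≤ Real.exp (L * s) * ‖v‖ := by gcongr
        calc (K : ℝ) * (Real.exp (L * s) * ‖v s‖) ≤ K * (Real.exp (L * s) * ‖v‖) := by gcongr
          _ = _ := by ring
      exact add_le_add (le_mul_of_one_le_right h4 hs1) h5
    rw [intervalIntegral.integral_const_mul, hexp τ ht] at h1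
    simp only [Ψf, norm_smul, Real.norm_eq_abs, abs_of_pos (Real.exp_pos _)]
    have hle : Real.exp (-(L * τ)) ≤ 1 := Real.exp_le_one_iff.2 (by have := mul_nonneg hL0.le ht; linarith)
    calc Real.exp (-(L * τ)) * ‖x₀ + ∫ s in (0 : ℝ)..τ, G v s‖
        ≤ Real.exp (-(L * τ)) * (‖x₀‖ + (‖F 0‖ + K * ‖v‖) * ((Real.exp (L * τ) - 1) / L)) := by
          gcongr
          exact (norm_add_le _ _).trans (by gcongr)
      _ = Real.exp (-(L * τ)) * ‖x₀‖ + (‖F 0‖ + K * ‖v‖) *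
          (Real.exp (-(L * τ)) * ((Real.exp (L * τ) - 1) / L)) := by ring
      _ ≤ 1 * ‖x₀‖ + (‖F 0‖ + K * ‖v‖) * (1 / L) := by
          gcongr
          exact hcalc τ ht
      _ = _ := by rw [one_mul]
  let Ψ : BoundedContinuousFunction ℝ E → BoundedContinuousFunction ℝ E := fun v =>
    BoundedContinuousFunction.ofNormedAddCommGroup (Ψf v) (hΨc v) _ (hΨb v)
  have hΨapp : ∀ v t, Ψ v t = Ψf v t := fun v t => rfl
  have hcontr : ContractingWith (1 / 2) Ψ := by
    refine ⟨by norm_num, LipschitzWith.of_dist_le_mul fun v w => ?_⟩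
    rw [BoundedContinuousFunction.dist_le (by positivity)]
    intro t
    rw [hΨapp, hΨapp, dist_eq_norm]
    have ht : 0 ≤ max t 0 := le_max_right _ _
    simp only [Ψf]
    set τ := max t 0
    rw [← smul_sub, add_sub_add_left_eq_sub, ← intervalIntegral.integral_sub
      ((hGc v).intervalIntegrable _ _) ((hGc w).intervalIntegrable _ _), norm_smul, Real.norm_eq_abs,
      abs_of_pos (Real.exp_pos _)]
    have h1 : ‖∫ s in (0 : ℝ)..τ, (G v s - G w s)‖ ≤ ∫ s in (0 : ℝ)..τ, (K * dist v w) * Real.exp (L * s) := by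
      refine intervalIntegral.norm_integral_le_of_norm_le ht ?_ (Continuous.intervalIntegrable (by fun_prop) _ _)
      refine Eventually.of_forall fun s hs => ?_
      have h2 := hF.dist_le_mul (Real.exp (L * s) • v s) (Real.exp (L * s) • w s)
      rw [dist_eq_norm, dist_eq_norm, ← smul_sub, norm_smul, Real.norm_eq_abs,
        abs_of_pos (Real.exp_pos _), ← dist_eq_norm (v s)] at h2
      refine h2.trans ?_
      have h3 : dist (v s) (w s) ≤ dist v w := BoundedContinuousFunction.dist_coe_le_dist s
      calc (K : ℝ) * (Real.exp (L * s) * dist (v s) (w s)) ≤ K * (Real.exp (L * s) * dist v w) := by gcongr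
        _ = _ := by ring
    rw [intervalIntegral.integral_const_mul, hexp τ ht] at h1
    calc _ ≤ Real.exp (-(L * τ)) * (K * dist v w * ((Real.exp (L * τ) - 1) / L)) := by gcongr
      _ = K * dist v w * (Real.exp (-(L * τ)) * ((Real.exp (L * τ) - 1) / L)) := by ring
      _ ≤ K * dist v w * (1 / L) := by gcongr; exact hcalc τ ht
      _ = K / L * dist v w := by ring
      _ ≤ ((1 / 2 : ℝ≥0) : ℝ) * dist v w := by
          refine mul_le_mul_of_nonneg_right ?_ dist_nonneg
          simpa using hKL
  set v := hcontr.fixedPoint Ψ with hv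
  have hfix : ∀ t, v t = Ψf v t := by
    intro t
    have : Ψ v = v := hcontr.fixedPoint_isFixedPt
    conv_lhs => rw [← this]
    rfl
  refine ⟨fun t => x₀ + ∫ s in (0 : ℝ)..t, G v s, by simp, fun t ht => ?_⟩
  have h1 : HasDerivAt (fun t => x₀ + ∫ s in (0 : ℝ)..t, G v s) (G v t) t :=
    (intervalIntegral.integral_hasDerivAt_right ((hGc v).intervalIntegrable _ _)
      ((hGc v).stronglyMeasurableAtFilter _ _) (hGc v).continuousAt).const_add x₀
  have h2 : Real.exp (L * t) • v t = x₀ + ∫ s in (0 : ℝ)..t, G v s := by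
    rw [hfix t]
    simp only [Ψf, max_eq_left ht]
    rw [smul_smul, ← Real.exp_add]
    simp
  have h3 : G v t = F (x₀ + ∫ s in (0 : ℝ)..t, G v s) := by
    simp only [G]
    rw [h2]
  rw [← h3]
  exact h1

/-! ### Weights and the linear energy estimate -/

/-- A bounded increasing weight `ρ` with three derivatives `ρ1, ρ2, ρ3`, each of them controlled by
the previous ones; the last two are dominated by `ρ1`, so that commutators of `∂_x ^ 3` with `ρ` are
absorbed by the gain `∫ |u_x|² ρ1`. -/
structure Weight where
  ρ : ℝ → ℝ
  ρ1 : ℝ → ℝ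
  ρ2 : ℝ → ℝ
  ρ3 : ℝ → ℝ
  hasDeriv : ∀ x, HasDerivAt ρ (ρ1 x) x
  hasDeriv1 : ∀ x, HasDerivAt ρ1 (ρ2 x) x
  hasDeriv2 : ∀ x, HasDerivAt ρ2 (ρ3 x) x
  continuous3 : Continuous ρ3
  pos : ∀ x, 0 < ρ x
  le_two : ∀ x, ρ x ≤ 2
  nonneg1 : ∀ x, 0 ≤ ρ1 x
  le1 : ∀ x, ρ1 x ≤ ρ x
  le2 : ∀ x, |ρ2 x| ≤ ρ1 x
  le3 : ∀ x, |ρ3 x| ≤ ρ1 x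

namespace Weight

variable (W : Weight)

lemma continuous : Continuous W.ρ := continuous_iff_continuousAt.2 fun x => (W.hasDeriv x).continuousAt
lemma continuous1 : Continuous W.ρ1 := continuous_iff_continuousAt.2 fun x => (W.hasDeriv1 x).continuousAt
lemma continuous2 : Continuous W.ρ2 := continuous_iff_continuousAt.2 fun x => (W.hasDeriv2 x).continuousAt
lemma abs_le (x : ℝ) : |W.ρ x| ≤ 2 := by rw [abs_of_pos (W.pos x)]; exact W.le_two x
lemma abs1_le (x : ℝ) : |W.ρ1 x| ≤ 2 := by
  rw [abs_of_nonneg (W.nonneg1 x)]; exact (W.le1 x).trans (W.le_two x)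
lemma abs2_le (x : ℝ) : |W.ρ2 x| ≤ 2 := (W.le2 x).trans ((W.le1 x).trans (W.le_two x))
lemma abs3_le (x : ℝ) : |W.ρ3 x| ≤ 2 := (W.le3 x).trans ((W.le1 x).trans (W.le_two x))

end Weight

lemma integrable_weight_mul {c f g : ℝ → ℝ} (hc : Continuous c) {C : ℝ} (hC : ∀ x, |c x| ≤ C)
    (hf : MemLp f 2 volume) (hg : MemLp g 2 volume) :
    Integrable (fun x => c x * (f x * g x)) volume := by
  have h : Integrable (fun x => f x * g x) volume := memLp_one_iff_integrable.1 (hg.mul' (r := 1) hf)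
  exact h.bdd_mul hc.aestronglyMeasurable (Eventually.of_forall hC)

lemma integral_le_of_le_add_deriv {A B Ψ Ψ' : ℝ → ℝ} (hA : Integrable A volume)
    (hB : Integrable B volume) (hΨ : Integrable Ψ volume) (hΨ' : Integrable Ψ' volume)
    (hd : ∀ x, HasDerivAt Ψ (Ψ' x) x) (h : ∀ x, A x ≤ B x + Ψ' x) : ∫ x, A x ≤ ∫ x, B x := by
  have h0 := integral_eq_zero_of_hasDerivAt_of_integrable hd hΨ' hΨ
  calc ∫ x, A x ≤ ∫ x, (B x + Ψ' x) := integral_mono hA (hB.add hΨ') h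
    _ = ∫ x, B x := by rw [integral_add hB hΨ', h0, add_zero]

/-- The weighted energy estimate for the linear part of the equation, for a smooth function
`p 0 + i q 0` with derivatives `p j + i q j`. The integrand differs from the claimed bound by a
total derivative. -/
lemma linear_energy (W : Weight) {p q : ℕ → ℝ → ℝ} (hp : ∀ j x, HasDerivAt (p j) (p (j + 1) x) x)
    (hq : ∀ j x, HasDerivAt (q j) (q (j + 1) x) x) (hp2 : ∀ j, MemLp (p j) 2 volume)
    (hq2 : ∀ j, MemLp (q j) 2 volume) (a b : ℝ) {ε : ℝ} (hε : 0 ≤ ε) :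
    ∫ x, W.ρ x * (p 0 x * (-p 3 x - a * q 2 x - b * p 1 x - ε * p 4 x) +
        q 0 x * (-q 3 x + a * p 2 x - b * q 1 x - ε * q 4 x)) ≤
      -(5 / 4 - 4 * ε) * (∫ x, W.ρ1 x * (p 1 x ^ 2 + q 1 x ^ 2)) +
      (1 / 2 + a ^ 2 + |b| / 2 + ε) * (∫ x, W.ρ1 x * (p 0 x ^ 2 + q 0 x ^ 2)) -
      ε / 2 * (∫ x, W.ρ x * (p 2 x ^ 2 + q 2 x ^ 2)) := by
  have i0 : ∀ {f g : ℝ → ℝ}, MemLp f 2 volume → MemLp g 2 volume →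
      Integrable (fun x => W.ρ x * (f x * g x)) volume := integrable_weight_mul W.continuous W.abs_le
  have i1 : ∀ {f g : ℝ → ℝ}, MemLp f 2 volume → MemLp g 2 volume →
      Integrable (fun x => W.ρ1 x * (f x * g x)) volume := integrable_weight_mul W.continuous1 W.abs1_le
  have i2 : ∀ {f g : ℝ → ℝ}, MemLp f 2 volume → MemLp g 2 volume →
      Integrable (fun x => W.ρ2 x * (f x * g x)) volume := integrable_weight_mul W.continuous2 W.abs2_le
  have i3 : ∀ {f g : ℝ → ℝ}, MemLp f 2 volume → MemLp g 2 volume →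
      Integrable (fun x => W.ρ3 x * (f x * g x)) volume := integrable_weight_mul W.continuous3 W.abs3_le
  have iZ : Integrable (fun x => W.ρ1 x * (p 1 x ^ 2 + q 1 x ^ 2)) volume :=
    ((i1 (hp2 1) (hp2 1)).add (i1 (hq2 1) (hq2 1))).congr (Eventually.of_forall fun x => by
      simp only [Pi.add_apply]; ring)
  have iQ : Integrable (fun x => W.ρ1 x * (p 0 x ^ 2 + q 0 x ^ 2)) volume :=
    ((i1 (hp2 0) (hp2 0)).add (i1 (hq2 0) (hq2 0))).congr (Eventually.of_forall fun x => by
      simp only [Pi.add_apply]; ring)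
  have iH : Integrable (fun x => W.ρ x * (p 2 x ^ 2 + q 2 x ^ 2)) volume :=
    ((i0 (hp2 2) (hp2 2)).add (i0 (hq2 2) (hq2 2))).congr (Eventually.of_forall fun x => by
      simp only [Pi.add_apply]; ring)
  have iZQ : Integrable (fun x => -(5 / 4 - 4 * ε) * (W.ρ1 x * (p 1 x ^ 2 + q 1 x ^ 2)) +
      (1 / 2 + a ^ 2 + |b| / 2 + ε) * (W.ρ1 x * (p 0 x ^ 2 + q 0 x ^ 2))) volume :=
    (iZ.const_mul _).add (iQ.const_mul _)
  rw [← integral_const_mul, ← integral_const_mul, ← integral_const_mul,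
    ← integral_add (iZ.const_mul _) (iQ.const_mul _),
    ← integral_sub iZQ (iH.const_mul _)]
  set A : ℝ → ℝ := fun x => W.ρ x * (p 0 x * (-p 3 x - a * q 2 x - b * p 1 x - ε * p 4 x) +
        q 0 x * (-q 3 x + a * p 2 x - b * q 1 x - ε * q 4 x)) with hA
  -- the boundary term of the integrations by parts
  set Ψ : ℝ → ℝ := fun x => -(W.ρ x * (p 0 x * p 2 x)) - W.ρ x * (q 0 x * q 2 x)
      + 1 / 2 * (W.ρ x * (p 1 x * p 1 x)) + 1 / 2 * (W.ρ x * (q 1 x * q 1 x))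
      + W.ρ1 x * (p 0 x * p 1 x) + W.ρ1 x * (q 0 x * q 1 x)
      - 1 / 2 * (W.ρ2 x * (p 0 x * p 0 x)) - 1 / 2 * (W.ρ2 x * (q 0 x * q 0 x))
      - a * (W.ρ x * (p 0 x * q 1 x)) + a * (W.ρ x * (q 0 x * p 1 x))
      - b / 2 * (W.ρ x * (p 0 x * p 0 x)) - b / 2 * (W.ρ x * (q 0 x * q 0 x))
      - ε * (W.ρ x * (p 0 x * p 3 x)) - ε * (W.ρ x * (q 0 x * q 3 x))
      + ε * (W.ρ1 x * (p 0 x * p 2 x)) + ε * (W.ρ1 x * (q 0 x * q 2 x))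
      + ε * (W.ρ x * (p 1 x * p 2 x)) + ε * (W.ρ x * (q 1 x * q 2 x)) with hΨ
  -- the remainder
  set R : ℝ → ℝ := fun x => -(3 / 2) * (W.ρ1 x * (p 1 x * p 1 x)) - 3 / 2 * (W.ρ1 x * (q 1 x * q 1 x))
      + 1 / 2 * (W.ρ3 x * (p 0 x * p 0 x)) + 1 / 2 * (W.ρ3 x * (q 0 x * q 0 x))
      + a * (W.ρ1 x * (p 0 x * q 1 x)) - a * (W.ρ1 x * (q 0 x * p 1 x))
      + b / 2 * (W.ρ1 x * (p 0 x * p 0 x)) + b / 2 * (W.ρ1 x * (q 0 x * q 0 x))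
      - ε * (W.ρ2 x * (p 0 x * p 2 x)) - ε * (W.ρ2 x * (q 0 x * q 2 x))
      - 2 * ε * (W.ρ1 x * (p 1 x * p 2 x)) - 2 * ε * (W.ρ1 x * (q 1 x * q 2 x))
      - ε * (W.ρ x * (p 2 x * p 2 x)) - ε * (W.ρ x * (q 2 x * q 2 x)) with hR
  have iA : Integrable A volume := by
    have := (((((((i0 (hp2 0) (hp2 3)).neg.sub ((i0 (hp2 0) (hq2 2)).const_mul a)).sub
      ((i0 (hp2 0) (hp2 1)).const_mul b)).sub ((i0 (hp2 0) (hp2 4)).const_mul ε)).sub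
      (i0 (hq2 0) (hq2 3))).add ((i0 (hq2 0) (hp2 2)).const_mul a)).sub
      ((i0 (hq2 0) (hq2 1)).const_mul b)).sub ((i0 (hq2 0) (hq2 4)).const_mul ε)
    refine this.congr (Eventually.of_forall fun x => ?_)
    simp only [hA, Pi.add_apply, Pi.sub_apply, Pi.neg_apply]
    ring
  have iΨ : Integrable Ψ volume :=
    (((((((((((((((((i0 (hp2 0) (hp2 2)).neg.sub (i0 (hq2 0) (hq2 2))).add
      ((i0 (hp2 1) (hp2 1)).const_mul _)).add ((i0 (hq2 1) (hq2 1)).const_mul _)).add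
      (i1 (hp2 0) (hp2 1))).add (i1 (hq2 0) (hq2 1))).sub ((i2 (hp2 0) (hp2 0)).const_mul _)).sub
      ((i2 (hq2 0) (hq2 0)).const_mul _)).sub ((i0 (hp2 0) (hq2 1)).const_mul _)).add
      ((i0 (hq2 0) (hp2 1)).const_mul _)).sub ((i0 (hp2 0) (hp2 0)).const_mul _)).sub
      ((i0 (hq2 0) (hq2 0)).const_mul _)).sub ((i0 (hp2 0) (hp2 3)).const_mul _)).sub
      ((i0 (hq2 0) (hq2 3)).const_mul _)).add ((i1 (hp2 0) (hp2 2)).const_mul _)).add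
      ((i1 (hq2 0) (hq2 2)).const_mul _)).add ((i0 (hp2 1) (hp2 2)).const_mul _)).add
      ((i0 (hq2 1) (hq2 2)).const_mul _)
  have iR : Integrable R volume :=
    (((((((((((((i1 (hp2 1) (hp2 1)).const_mul _).sub ((i1 (hq2 1) (hq2 1)).const_mul _)).add
      ((i3 (hp2 0) (hp2 0)).const_mul _)).add ((i3 (hq2 0) (hq2 0)).const_mul _)).add
      ((i1 (hp2 0) (hq2 1)).const_mul _)).sub ((i1 (hq2 0) (hp2 1)).const_mul _)).add
      ((i1 (hp2 0) (hp2 0)).const_mul _)).add ((i1 (hq2 0) (hq2 0)).const_mul _)).sub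
      ((i2 (hp2 0) (hp2 2)).const_mul _)).sub ((i2 (hq2 0) (hq2 2)).const_mul _)).sub
      ((i1 (hp2 1) (hp2 2)).const_mul _)).sub ((i1 (hq2 1) (hq2 2)).const_mul _)).sub
      ((i0 (hp2 2) (hp2 2)).const_mul _) |>.sub ((i0 (hq2 2) (hq2 2)).const_mul _)
  have hder : ∀ x, HasDerivAt Ψ (A x - R x) x := by
    intro x
    have r0 := W.hasDeriv x
    have r1 := W.hasDeriv1 x
    have r2 := W.hasDeriv2 x
    have p0 := hp 0 x
    have p1 := hp 1 x
    have p2 := hp 2 x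
    have p3 := hp 3 x
    have q0 := hq 0 x
    have q1 := hq 1 x
    have q2 := hq 2 x
    have q3 := hq 3 x
    simp only [zero_add, Nat.reduceAdd] at p0 p1 p2 p3 q0 q1 q2 q3
    have := ((((((((((((((((((r0.mul (p0.mul p2)).neg.sub (r0.mul (q0.mul q2))).add
      ((r0.mul (p1.mul p1)).const_mul (1 / 2))).add ((r0.mul (q1.mul q1)).const_mul (1 / 2))).add
      (r1.mul (p0.mul p1))).add (r1.mul (q0.mul q1))).sub ((r2.mul (p0.mul p0)).const_mul (1 / 2))).sub
      ((r2.mul (q0.mul q0)).const_mul (1 / 2))).sub ((r0.mul (p0.mul q1)).const_mul a)).add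
      ((r0.mul (q0.mul p1)).const_mul a)).sub ((r0.mul (p0.mul p0)).const_mul (b / 2))).sub
      ((r0.mul (q0.mul q0)).const_mul (b / 2))).sub ((r0.mul (p0.mul p3)).const_mul ε)).sub
      ((r0.mul (q0.mul q3)).const_mul ε)).add ((r1.mul (p0.mul p2)).const_mul ε)).add
      ((r1.mul (q0.mul q2)).const_mul ε)).add ((r0.mul (p1.mul p2)).const_mul ε)).add
      ((r0.mul (q1.mul q2)).const_mul ε))
    refine this.congr_deriv ?_
    simp only [hA, hR, Pi.mul_apply]
    ring
  refine integral_le_of_le_add_deriv iA (iZQ.sub (iH.const_mul _)) iΨ (iA.sub iR) hder ?_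
  intro x
  have hRle : R x ≤ -(5 / 4 - 4 * ε) * (W.ρ1 x * (p 1 x ^ 2 + q 1 x ^ 2)) +
      (1 / 2 + a ^ 2 + |b| / 2 + ε) * (W.ρ1 x * (p 0 x ^ 2 + q 0 x ^ 2)) -
      ε / 2 * (W.ρ x * (p 2 x ^ 2 + q 2 x ^ 2)) := by
    have h0 := W.pos x
    have h1 := W.nonneg1 x
    have h1' := W.le1 x
    obtain ⟨h2, h2'⟩ := _root_.abs_le.1 (W.le2 x)
    obtain ⟨h3, h3'⟩ := _root_.abs_le.1 (W.le3 x)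
    have t1 : 1 / 2 * (W.ρ3 x * (p 0 x * p 0 x)) + 1 / 2 * (W.ρ3 x * (q 0 x * q 0 x)) ≤
        1 / 2 * (W.ρ1 x * (p 0 x ^ 2 + q 0 x ^ 2)) := by
      nlinarith [mul_nonneg (sub_nonneg.2 h3') (add_nonneg (sq_nonneg (p 0 x)) (sq_nonneg (q 0 x)))]
    have t2 : a * (W.ρ1 x * (p 0 x * q 1 x)) - a * (W.ρ1 x * (q 0 x * p 1 x)) ≤
        a ^ 2 * (W.ρ1 x * (p 0 x ^ 2 + q 0 x ^ 2)) + 1 / 4 * (W.ρ1 x * (p 1 x ^ 2 + q 1 x ^ 2)) := by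
      nlinarith [mul_nonneg h1 (add_nonneg (sq_nonneg (a * p 0 x - q 1 x / 2))
        (sq_nonneg (a * q 0 x + p 1 x / 2)))]
    have t3 : b / 2 * (W.ρ1 x * (p 0 x * p 0 x)) + b / 2 * (W.ρ1 x * (q 0 x * q 0 x)) ≤
        |b| / 2 * (W.ρ1 x * (p 0 x ^ 2 + q 0 x ^ 2)) := by
      nlinarith [mul_nonneg (sub_nonneg.2 (le_abs_self b)) (mul_nonneg h1
        (add_nonneg (sq_nonneg (p 0 x)) (sq_nonneg (q 0 x))))]
    -- Young's inequality for the fourth order terms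
    have y : ∀ u v c d : ℝ, 0 ≤ d → |c| ≤ d → d ≤ W.ρ x → -(c * (u * v)) ≤ d * u ^ 2 + 1 / 4 * (W.ρ x * v ^ 2) := by
      intro u v c d hd hc hdρ
      have e1 : -(c * (u * v)) ≤ d * (|u| * |v|) := by
        rw [← abs_mul]
        calc -(c * (u * v)) ≤ |c * (u * v)| := neg_le_abs _
          _ = |c| * |u * v| := abs_mul _ _
          _ ≤ d * |u * v| := by gcongr
      have e2 : d * (|u| * |v|) ≤ d * (|u| ^ 2 + 1 / 4 * |v| ^ 2) := by
        gcongr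
        nlinarith [sq_nonneg (|u| - |v| / 2)]
      rw [sq_abs, sq_abs] at e2
      nlinarith [mul_nonneg (sub_nonneg.2 hdρ) (sq_nonneg v)]
    have y1 := y (p 0 x) (p 2 x) (W.ρ2 x) (W.ρ1 x) h1 (W.le2 x) h1'
    have y2 := y (q 0 x) (q 2 x) (W.ρ2 x) (W.ρ1 x) h1 (W.le2 x) h1'
    have y3 := y (2 * p 1 x) (p 2 x) (W.ρ1 x) (W.ρ1 x) h1 (abs_of_nonneg h1).le h1'
    have y4 := y (2 * q 1 x) (q 2 x) (W.ρ1 x) (W.ρ1 x) h1 (abs_of_nonneg h1).le h1'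
    have t4 : - ε * (W.ρ2 x * (p 0 x * p 2 x)) - ε * (W.ρ2 x * (q 0 x * q 2 x))
      - 2 * ε * (W.ρ1 x * (p 1 x * p 2 x)) - 2 * ε * (W.ρ1 x * (q 1 x * q 2 x)) ≤
      ε * (W.ρ1 x * (p 0 x ^ 2 + q 0 x ^ 2) + 4 * (W.ρ1 x * (p 1 x ^ 2 + q 1 x ^ 2))
        + 1 / 2 * (W.ρ x * (p 2 x ^ 2 + q 2 x ^ 2))) := by
      have := mul_le_mul_of_nonneg_left (add_le_add (add_le_add y1 y2) (add_le_add y3 y4)) hε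
      linarith
    simp only [hR]
    linarith
  have : A x ≤ A x - R x + (-(5 / 4 - 4 * ε) * (W.ρ1 x * (p 1 x ^ 2 + q 1 x ^ 2)) +
      (1 / 2 + a ^ 2 + |b| / 2 + ε) * (W.ρ1 x * (p 0 x ^ 2 + q 0 x ^ 2)) -
      ε / 2 * (W.ρ x * (p 2 x ^ 2 + q 2 x ^ 2))) := by linarith
  rw [Pi.sub_apply]
  change A x ≤ _
  linarith

/-! ### The truncated nonlinearity -/

/-- The truncation `min(|z|, N) z` of the nonlinearity `|z| z`. -/
noncomputable def trunc (N : ℝ≥0) (z : ℂ) : ℂ := ((min ‖z‖ N : ℝ) : ℂ) * z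

lemma trunc_zero (N : ℝ≥0) : trunc N 0 = 0 := by simp [trunc]

lemma norm_trunc (N : ℝ≥0) (z : ℂ) : ‖trunc N z‖ = min ‖z‖ N * ‖z‖ := by
  rw [trunc, norm_mul, Complex.norm_real, Real.norm_eq_abs, abs_of_nonneg (by positivity)]

lemma norm_trunc_le (N : ℝ≥0) (z : ℂ) : ‖trunc N z‖ ≤ N * ‖z‖ := by
  rw [norm_trunc]
  gcongr
  exact min_le_right _ _

/-- The truncation is locally Lipschitz like the quadratic nonlinearity, with a constant that does not
depend on `N`. -/
lemma norm_trunc_sub_le (N : ℝ≥0) (z w : ℂ) :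
    ‖trunc N z - trunc N w‖ ≤ (min ‖z‖ N + min ‖w‖ N) * ‖z - w‖ := by
  wlog h : ‖w‖ ≤ ‖z‖ generalizing z w
  · have := this w z (not_le.1 h).le
    rwa [norm_sub_rev, norm_sub_rev w z, add_comm] at this
  have e : trunc N z - trunc N w = ((min ‖z‖ N : ℝ) : ℂ) * (z - w)
      + ((min ‖z‖ N - min ‖w‖ N : ℝ) : ℂ) * w := by
    simp only [trunc]; push_cast; ring
  rw [e, add_mul]
  refine (norm_add_le _ _).trans (add_le_add ?_ ?_)
  · rw [norm_mul, Complex.norm_real, Real.norm_eq_abs, abs_of_nonneg (by positivity)]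
  · have h1 : min ‖w‖ (N : ℝ) ≤ min ‖z‖ N := min_le_min_right _ h
    rw [norm_mul, Complex.norm_real, Real.norm_eq_abs, abs_of_nonneg (sub_nonneg.2 h1)]
    have h2 : ‖z‖ - ‖w‖ ≤ ‖z - w‖ := norm_sub_norm_le _ _
    rcases le_total ‖w‖ (N : ℝ) with hw | hw
    · rw [min_eq_left hw, mul_comm]
      have : min ‖z‖ (N : ℝ) ≤ ‖z‖ := min_le_left _ _
      gcongr
      linarith
    · rw [min_eq_right hw, min_eq_right (hw.trans h), sub_self, zero_mul]
      positivity

lemma lipschitz_trunc (N : ℝ≥0) : LipschitzWith (2 * N) (trunc N) := by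
  refine LipschitzWith.of_dist_le_mul fun z w => ?_
  rw [dist_eq_norm, dist_eq_norm]
  refine (norm_trunc_sub_le N z w).trans ?_
  gcongr
  have h1 : min ‖z‖ (N : ℝ) ≤ N := min_le_right _ _
  have h2 : min ‖w‖ (N : ℝ) ≤ N := min_le_right _ _
  push_cast
  linarith

/-- The truncated nonlinearity tested against `(ρ w)_x`, `w = p + i q`. Since the coefficient
`min(|w|, N)` is a function of `|w|²`, the part with `w_x` is `ρ` times a total derivative, and only
terms with `ρ'` remain. -/
lemma nonlinear_energy {ρ ρ1 : ℝ → ℝ} (hρ : ∀ x, HasDerivAt ρ (ρ1 x) x) (hρ1 : Continuous ρ1)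
    (hb : ∀ x, |ρ x| ≤ 2) (hb1 : ∀ x, |ρ1 x| ≤ 2) (h1 : ∀ x, 0 ≤ ρ1 x)
    {p p' q q' : ℝ → ℝ} (hp : ∀ x, HasDerivAt p (p' x) x) (hq : ∀ x, HasDerivAt q (q' x) x)
    (hp2 : MemLp p 2 volume) (hq2 : MemLp q 2 volume) (hp2' : MemLp p' 2 volume)
    (hq2' : MemLp q' 2 volume) (N : ℝ≥0) :
    |∫ x, min (Real.sqrt (p x ^ 2 + q x ^ 2)) N *
      ((ρ1 x * p x + ρ x * p' x) * p x + (ρ1 x * q x + ρ x * q' x) * q x)| ≤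
    ∫ x, ρ1 x * (min (Real.sqrt (p x ^ 2 + q x ^ 2)) N * (p x ^ 2 + q x ^ 2)) := by
  set h : ℝ → ℝ := fun s => min (Real.sqrt s) N with hh
  have hhc : Continuous h := Real.continuous_sqrt.min continuous_const
  have hh0 : ∀ s, 0 ≤ h s := fun s => le_min (Real.sqrt_nonneg _) N.2
  have hhN : ∀ s, h s ≤ N := fun s => min_le_right _ _
  have hhm : Monotone h := fun s t hst => min_le_min_right _ (Real.sqrt_le_sqrt hst)
  -- `ρ h(s) (p p' + q q') = ρ (G(s))'` for the primitive `G` of `h / 2`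
  set G : ℝ → ℝ := fun s => 1 / 2 * ∫ σ in (0 : ℝ)..s, h σ with hG
  have hGd : ∀ s, HasDerivAt G (1 / 2 * h s) s := fun s =>
    (intervalIntegral.integral_hasDerivAt_right (hhc.intervalIntegrable _ _)
      (hhc.stronglyMeasurableAtFilter _ _) hhc.continuousAt).const_mul _
  have hG0 : ∀ s, 0 ≤ s → 0 ≤ G s := fun s hs =>
    mul_nonneg (by norm_num) (intervalIntegral.integral_nonneg hs fun σ _ => hh0 σ)
  have hG1 : ∀ s, 0 ≤ s → G s ≤ h s * s := fun s hs => by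
    have : ∫ σ in (0 : ℝ)..s, h σ ≤ ∫ σ in (0 : ℝ)..s, h s :=
      intervalIntegral.integral_mono_on hs (hhc.intervalIntegrable _ _)
        (continuous_const.intervalIntegrable _ _) fun σ hσ => hhm hσ.2
    rw [intervalIntegral.integral_const, smul_eq_mul, sub_zero] at this
    have h2 : 0 ≤ h s * s := mul_nonneg (hh0 s) hs
    simp only [hG]
    linarith
  have hρc : Continuous ρ := continuous_iff_continuousAt.2 fun x => (hρ x).continuousAt
  have hpc : Continuous p := continuous_iff_continuousAt.2 fun x => (hp x).continuousAt
  have hqc : Continuous q := continuous_iff_continuousAt.2 fun x => (hq x).continuousAt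
  have hGc : Continuous G := continuous_iff_continuousAt.2 fun x => (hGd x).continuousAt
  set s : ℝ → ℝ := fun x => p x ^ 2 + q x ^ 2 with hs
  have hsc : Continuous s := by fun_prop
  have hs0 : ∀ x, 0 ≤ s x := fun x => by simp only [hs]; positivity
  have hsi : Integrable s volume := hp2.integrable_sq.add hq2.integrable_sq
  have habs : ∀ x, |h (s x)| ≤ N := fun x => by rw [abs_of_nonneg (hh0 _)]; exact hhN _
  have bnd : ∀ {c : ℝ → ℝ}, (∀ x, |c x| ≤ 2) → ∀ x, |c x * h (s x)| ≤ 2 * N := fun hc x => by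
    rw [abs_mul]
    exact mul_le_mul (hc x) (habs x) (abs_nonneg _) (by norm_num)
  have i1 : Integrable (fun x => ρ1 x * (h (s x) * s x)) volume := by
    refine (hsi.bdd_mul (c := 2 * N) (hρ1.mul (hhc.comp hsc)).aestronglyMeasurable
      (Eventually.of_forall (bnd hb1))).congr (Eventually.of_forall fun x => ?_)
    simp only [Pi.mul_apply, Function.comp_apply]; ring
  have iG : ∀ {c : ℝ → ℝ}, Continuous c → (∀ x, |c x| ≤ 2) → Integrable (fun x => c x * G (s x)) volume := by
    intro c hc hcb
    refine Integrable.mono' (hsi.const_mul (2 * (N : ℝ))) (hc.mul (hGc.comp hsc)).aestronglyMeasurable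
      (Eventually.of_forall fun x => ?_)
    rw [Real.norm_eq_abs, abs_mul, abs_of_nonneg (hG0 _ (hs0 x))]
    calc |c x| * G (s x) ≤ 2 * (N * s x) := by
          refine mul_le_mul (hcb x) ((hG1 _ (hs0 x)).trans ?_) (hG0 _ (hs0 x)) (by norm_num)
          exact mul_le_mul_of_nonneg_right (hhN _) (hs0 x)
      _ = _ := by ring
  have i2 : Integrable (fun x => ρ x * h (s x) * (p x * p' x)) volume :=
    integrable_weight_mul (hρc.mul (hhc.comp hsc)) (bnd hb) hp2 hp2'
  have i3 : Integrable (fun x => ρ x * h (s x) * (q x * q' x)) volume :=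
    integrable_weight_mul (hρc.mul (hhc.comp hsc)) (bnd hb) hq2 hq2'
  have i23 : Integrable (fun x => ρ x * h (s x) * (p x * p' x) + ρ x * h (s x) * (q x * q' x)) volume :=
    i2.add i3
  have hd : ∀ x, HasDerivAt (fun x => ρ x * G (s x))
      (ρ1 x * G (s x) + (ρ x * h (s x) * (p x * p' x) + ρ x * h (s x) * (q x * q' x))) x := by
    intro x
    have e1 : HasDerivAt s (2 * p x * p' x + 2 * q x * q' x) x := by
      have := ((hp x).pow 2).add ((hq x).pow 2)
      refine this.congr_deriv ?_
      norm_num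
    have e2 := (hρ x).mul ((hGd (s x)).comp x e1)
    refine e2.congr_deriv ?_
    simp only [Function.comp_apply]
    ring
  have hz := integral_eq_zero_of_hasDerivAt_of_integrable hd ((iG hρ1 hb1).add i23) (iG hρc hb)
  rw [integral_add (iG hρ1 hb1) i23] at hz
  have key : ∫ x, h (s x) * ((ρ1 x * p x + ρ x * p' x) * p x + (ρ1 x * q x + ρ x * q' x) * q x) =
      ∫ x, (ρ1 x * (h (s x) * s x) - ρ1 x * G (s x)) := by
    rw [integral_sub i1 (iG hρ1 hb1)]
    have : ∫ x, h (s x) * ((ρ1 x * p x + ρ x * p' x) * p x + (ρ1 x * q x + ρ x * q' x) * q x) =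
        (∫ x, ρ1 x * (h (s x) * s x)) +
          ∫ x, (ρ x * h (s x) * (p x * p' x) + ρ x * h (s x) * (q x * q' x)) := by
      rw [← integral_add i1 i23]
      congr 1
      funext x
      simp only [hs]
      ring
    rw [this]
    linarith
  rw [key, abs_of_nonneg (integral_nonneg fun x => ?_)]
  · refine integral_mono (i1.sub (iG hρ1 hb1)) i1 fun x => ?_
    have := mul_nonneg (h1 x) (hG0 _ (hs0 x))
    simp only
    linarith
  · simp only [Pi.zero_apply]
    rw [← mul_sub]
    exact mul_nonneg (h1 x) (sub_nonneg.2 (hG1 _ (hs0 x)))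

/-- A function in `L_1` with derivative in `L_1` is bounded by the integral of its derivative. -/
lemma le_integral_of_hasDerivAt {f f' B : ℝ → ℝ} (hd : ∀ x, HasDerivAt f (f' x) x)
    (hf : Integrable f volume) (hf' : Integrable f' volume) (hB : Integrable B volume)
    (h : ∀ x, |f' x| ≤ B x) (x : ℝ) : f x ≤ ∫ y, B y := by
  have hz : Tendsto f atBot (𝓝 0) :=
    tendsto_zero_of_hasDerivAt_of_integrableOn_Iic (a := x) (fun y _ => hd y) hf'.integrableOn hf.integrableOn
  have e := integral_Iic_of_hasDerivAt_of_tendsto' (a := x) (fun y _ => hd y) hf'.integrableOn hz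
  rw [sub_zero] at e
  rw [← e]
  calc ∫ y in Iic x, f' y ≤ ∫ y in Iic x, B y :=
        integral_mono hf'.integrableOn hB.integrableOn fun y => (le_abs_self _).trans (h y)
    _ ≤ ∫ y, B y := setIntegral_le_integral hB (Eventually.of_forall fun y => (abs_nonneg _).trans (h y))

/-- The cubic term produced by the nonlinearity is absorbed by the smoothing gain, by a weighted
Gagliardo–Nirenberg inequality. -/
lemma cubic_bound (W : Weight)
    {p p' q q' : ℝ → ℝ} (hp : ∀ x, HasDerivAt p (p' x) x) (hq : ∀ x, HasDerivAt q (q' x) x)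
    (hp2 : MemLp p 2 volume) (hq2 : MemLp q 2 volume) (hp2' : MemLp p' 2 volume)
    (hq2' : MemLp q' 2 volume) (N : ℝ≥0) {K M : ℝ} (hK : 0 ≤ K) (hM : 0 < M)
    (hm : ∫ x, (p x ^ 2 + q x ^ 2) ≤ M ^ 2) :
    K * ∫ x, W.ρ1 x * (min (Real.sqrt (p x ^ 2 + q x ^ 2)) N * (p x ^ 2 + q x ^ 2)) ≤
      (1 / 2 + K ^ 2 * M ^ 2) * (∫ x, W.ρ1 x * (p x ^ 2 + q x ^ 2)) +
      1 / 4 * ∫ x, W.ρ1 x * (p' x ^ 2 + q' x ^ 2) := by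
  have hpc : Continuous p := continuous_iff_continuousAt.2 fun x => (hp x).continuousAt
  have hqc : Continuous q := continuous_iff_continuousAt.2 fun x => (hq x).continuousAt
  set s : ℝ → ℝ := fun x => p x ^ 2 + q x ^ 2 with hs
  have hsc : Continuous s := by fun_prop
  have hs0 : ∀ x, 0 ≤ s x := fun x => by simp only [hs]; positivity
  have hsi : Integrable s volume := hp2.integrable_sq.add hq2.integrable_sq
  have i1 : ∀ {f g : ℝ → ℝ}, MemLp f 2 volume → MemLp g 2 volume →
      Integrable (fun x => W.ρ1 x * (f x * g x)) volume := integrable_weight_mul W.continuous1 W.abs1_le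
  have i2 : ∀ {f g : ℝ → ℝ}, MemLp f 2 volume → MemLp g 2 volume →
      Integrable (fun x => W.ρ2 x * (f x * g x)) volume := integrable_weight_mul W.continuous2 W.abs2_le
  have iQ : Integrable (fun x => W.ρ1 x * s x) volume :=
    ((i1 hp2 hp2).add (i1 hq2 hq2)).congr (Eventually.of_forall fun x => by
      simp only [Pi.add_apply, hs]; ring)
  have iZ : Integrable (fun x => W.ρ1 x * (p' x ^ 2 + q' x ^ 2)) volume :=
    ((i1 hp2' hp2').add (i1 hq2' hq2')).congr (Eventually.of_forall fun x => by
      simp only [Pi.add_apply]; ring)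
  set Q := ∫ x, W.ρ1 x * s x with hQ
  set Z := ∫ x, W.ρ1 x * (p' x ^ 2 + q' x ^ 2) with hZ
  -- the integral of `|(ρ1 s)'|`, by `|ρ2| ≤ ρ1`
  have hsup : ∀ x, W.ρ1 x * s x ≤ 2 * Q + Z := by
    intro x
    have hd : ∀ x, HasDerivAt (fun x => W.ρ1 x * s x)
        (W.ρ2 x * s x + 2 * (W.ρ1 x * (p x * p' x)) + 2 * (W.ρ1 x * (q x * q' x))) x := by
      intro x
      have e1 : HasDerivAt s (2 * p x * p' x + 2 * q x * q' x) x := by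
        have := ((hp x).pow 2).add ((hq x).pow 2)
        refine this.congr_deriv ?_
        norm_num
      exact ((W.hasDeriv1 x).mul e1).congr_deriv (by ring)
    have iρ2 : Integrable (fun x => W.ρ2 x * s x) volume :=
      ((i2 hp2 hp2).add (i2 hq2 hq2)).congr (Eventually.of_forall fun x => by
        simp only [Pi.add_apply, hs]; ring)
    have iB : Integrable (fun x => 2 * (W.ρ1 x * s x) + W.ρ1 x * (p' x ^ 2 + q' x ^ 2)) volume :=
      (iQ.const_mul 2).add iZ
    have := le_integral_of_hasDerivAt hd iQ
      ((iρ2.add ((i1 hp2 hp2').const_mul 2)).add ((i1 hq2 hq2').const_mul 2)) iB ?_ x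
    · rw [integral_add (iQ.const_mul 2) iZ, integral_const_mul] at this
      exact this
    · intro x
      have h1 := W.nonneg1 x
      have e2 : |W.ρ2 x * s x| ≤ W.ρ1 x * s x := by
        rw [abs_mul, abs_of_nonneg (hs0 x)]
        exact mul_le_mul_of_nonneg_right (W.le2 x) (hs0 x)
      obtain ⟨e3, e4⟩ := abs_le.1 e2
      rw [abs_le]
      simp only [hs] at *
      constructor
      · nlinarith [mul_nonneg h1 (add_nonneg (sq_nonneg (p x + p' x)) (sq_nonneg (q x + q' x)))]
      · nlinarith [mul_nonneg h1 (add_nonneg (sq_nonneg (p x - p' x)) (sq_nonneg (q x - q' x)))]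
  have hS0 : 0 ≤ 2 * Q + Z := (mul_nonneg (W.nonneg1 0) (hs0 0)).trans (hsup 0)
  rw [← integral_const_mul]
  calc ∫ x, K * (W.ρ1 x * (min (Real.sqrt (s x)) N * s x))
      ≤ ∫ x, ((2 * Q + Z) / (4 * M ^ 2) * s x + K ^ 2 * M ^ 2 * (W.ρ1 x * s x)) := by
        refine integral_mono_of_nonneg (Eventually.of_forall fun x => ?_)
          ((hsi.const_mul _).add (iQ.const_mul _)) (Eventually.of_forall fun x => ?_)
        · have := W.nonneg1 x
          have := hs0 x
          simp only [Pi.zero_apply]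
          positivity
        · simp only
          have h1 := W.nonneg1 x
          set r := Real.sqrt (s x) with hr
          have hr2 : r ^ 2 = s x := Real.sq_sqrt (hs0 x)
          have hr0 : 0 ≤ r := Real.sqrt_nonneg _
          have e1 : K * (W.ρ1 x * (min r N * s x)) ≤ K * (W.ρ1 x * (r * s x)) := by
            have := hs0 x
            gcongr
            exact min_le_left _ _
          -- Young's inequality with the constant that leaves `Z / 4` after integration against `s`
          have e2 : K * W.ρ1 x * r ≤ (W.ρ1 x * s x) / (4 * M ^ 2) + K ^ 2 * M ^ 2 * W.ρ1 x := by
            have : (W.ρ1 x * s x) / (4 * M ^ 2) + K ^ 2 * M ^ 2 * W.ρ1 x - K * W.ρ1 x * r =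
                W.ρ1 x * (r / (2 * M) - K * M) ^ 2 := by
              rw [← hr2]; field_simp; ring
            have h3 : 0 ≤ W.ρ1 x * (r / (2 * M) - K * M) ^ 2 := by positivity
            linarith
          have e3 : (W.ρ1 x * s x) / (4 * M ^ 2) ≤ (2 * Q + Z) / (4 * M ^ 2) := by
            gcongr
            exact hsup x
          have e4 := mul_le_mul_of_nonneg_right (e2.trans (add_le_add_left e3 _)) (hs0 x)
          calc _ ≤ _ := e1
            _ = K * W.ρ1 x * r * s x := by ring
            _ ≤ _ := e4
            _ = _ := by ring
    _ = (2 * Q + Z) / (4 * M ^ 2) * (∫ x, s x) + K ^ 2 * M ^ 2 * Q := by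
        rw [integral_add (hsi.const_mul _) (iQ.const_mul _), integral_const_mul, integral_const_mul]
    _ ≤ (2 * Q + Z) / (4 * M ^ 2) * M ^ 2 + K ^ 2 * M ^ 2 * Q := by gcongr
    _ = _ := by field_simp; ring

/-! ### The regularized equation and the mass estimate -/

/-- The coefficients of the equation, named as there, with a bound `δ` for the damping `d`. -/
structure Coeffs where
  a : ℝ
  b : ℝ
  lam : ℝ
  β : ℝ
  δ : ℝ
  d : ℝ → ℝ
  memLp_d : MemLp (fun x => (d x : ℂ)) ⊤ volume
  δ_nonneg : 0 ≤ δ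
  abs_d_le : ∀ᵐ x ∂(volume : Measure ℝ), ‖(d x : ℂ)‖ ≤ δ

/-- The truncated nonlinearity as a map of `L_2`. -/
noncomputable def truncOp (N : ℝ≥0) : L2 → L2 := (lipschitz_trunc N).compLp (trunc_zero N)

lemma truncOp_coe (N : ℝ≥0) (u : L2) : truncOp N u =ᵐ[volume] fun x => trunc N (u x) :=
  (lipschitz_trunc N).coeFn_compLp (trunc_zero N) u

lemma truncOp_coe_of_ae (N : ℝ≥0) {u : L2} {U : ℝ → ℂ} (h : u =ᵐ[volume] U) :
    truncOp N u =ᵐ[volume] fun x => trunc N (U x) := by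
  filter_upwards [truncOp_coe N u, h] with x h1 h2
  rw [h1, h2]

lemma lipschitz_truncOp (N : ℝ≥0) : LipschitzWith (2 * N) (truncOp N) :=
  (lipschitz_trunc N).lipschitzWith_compLp (trunc_zero N)

lemma norm_truncOp_le (N : ℝ≥0) (u : L2) : ‖truncOp N u‖ ≤ N * ‖u‖ := by
  refine norm_le_of_ae_bound ?_
  filter_upwards [truncOp_coe N u] with x h
  rw [h]
  exact norm_trunc_le N _

lemma re_inner_eq_integral {f g : L2} {F G : ℝ → ℂ} (hf : f =ᵐ[volume] F) (hg : g =ᵐ[volume] G) :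
    (inner ℂ f g).re = ∫ x, ((F x).re * (G x).re + (F x).im * (G x).im) := by
  have hF : MemLp F 2 volume := (memLp_congr_ae hf).1 (Lp.memLp f)
  have hG : MemLp G 2 volume := (memLp_congr_ae hg).1 (Lp.memLp g)
  rw [inner_eq_integral_of_ae hf hg]
  have := integral_re (𝕜 := ℂ) (integrable_mul_L2 hF.star hG)
  refine Eq.trans this.symm ?_
  congr 1
  funext x
  simp

/-- The weighted square `∫ c |v|²` as a continuous function on `L_2`. -/
noncomputable def wsq (c : ℝ → ℝ) (v : L2) : ℝ := (inner ℂ (mulOp (fun x => (c x : ℂ)) v) v).re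

lemma memLp_top_ofReal {c : ℝ → ℝ} (hc : Continuous c) {C : ℝ} (hC : ∀ x, |c x| ≤ C) :
    MemLp (fun x => (c x : ℂ)) ⊤ volume :=
  memLp_top_of_forall_norm_le (Complex.continuous_ofReal.comp hc).aestronglyMeasurable
    (fun x => by rw [Complex.norm_real]; exact hC x)

lemma wsq_eq {c : ℝ → ℝ} (hc : MemLp (fun x => (c x : ℂ)) ⊤ volume) {v : L2} {V : ℝ → ℂ}
    (hv : v =ᵐ[volume] V) : wsq c v = ∫ x, c x * ((V x).re ^ 2 + (V x).im ^ 2) := by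
  have h : mulOp (fun x => (c x : ℂ)) v =ᵐ[volume] fun x => (c x : ℂ) * V x := by
    filter_upwards [mulOp_coe hc v, hv] with x h1 h2
    rw [h1, h2]
  rw [wsq, re_inner_eq_integral h hv]
  congr 1
  funext x
  simp only [Complex.re_ofReal_mul, Complex.im_ofReal_mul]
  ring

lemma continuous_wsq (c : ℝ → ℝ) : Continuous (wsq c) := by
  unfold wsq
  exact Complex.continuous_re.comp (((mulOp _).continuous).inner continuous_id)

lemma hasDerivAt_wsq {c : ℝ → ℝ} (hc : MemLp (fun x => (c x : ℂ)) ⊤ volume) {u : ℝ → L2} {u' : L2}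
    {t : ℝ} (hu : HasDerivAt u u' t) : HasDerivAt (fun t => wsq c (u t))
      (2 * (inner ℂ (mulOp (fun x => (c x : ℂ)) (u t)) u').re) t := by
  have h1 : HasDerivAt (fun t => mulOp (fun x => (c x : ℂ)) (u t)) (mulOp (fun x => (c x : ℂ)) u') t :=
    ((mulOp (fun x => (c x : ℂ))).restrictScalars ℝ).hasFDerivAt.comp_hasDerivAt t hu
  have h2 := (h1.inner ℂ hu)
  have h3 := Complex.reCLM.hasFDerivAt.comp_hasDerivAt t h2
  refine h3.congr_deriv ?_
  rw [Complex.reCLM_apply, Complex.add_re, inner_mulOp_real hc u', ← inner_conj_symm u',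
    Complex.conj_re]
  ring

section VectorField

variable (D : Coeffs) (N : ℝ≥0) (ε k : ℝ)

/-- The linear differential part, restricted to frequencies `|ξ| ≤ k`, with the parabolic
regularization `- ε ∂_x ^ 4`. -/
noncomputable def linOp : L2 →L[ℂ] L2 :=
  -(bandD k 3) + (Complex.I * D.a) • bandD k 2 - (D.b : ℂ) • bandD k 1 - (ε : ℂ) • bandD k 4

/-- The zero order terms. -/
noncomputable def sourceOp (u : L2) : L2 :=
  (Complex.I * D.lam) • truncOp N u - mulOp (fun x => (D.d x : ℂ)) u

/-- The regularized right-hand side: everything is projected to the frequencies `|ξ| ≤ k`, the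
nonlinearity is truncated at height `N`, and the dissipation `- ε ∂_x ^ 4` is added. -/
noncomputable def vf (u : L2) : L2 :=
  linOp D ε k u + bandD k 0 (sourceOp D N u) - (D.β : ℂ) • bandD k 1 (truncOp N u)

lemma lipschitz_vf : ∃ K, LipschitzWith K (vf D N ε k) := by
  have h1 : LipschitzWith _ (sourceOp D N) :=
    ((lipschitzWith_smul (Complex.I * D.lam)).comp (lipschitz_truncOp N)).sub
      (mulOp (fun x => (D.d x : ℂ))).lipschitz
  exact ⟨_, ((linOp D ε k).lipschitz.add ((bandD k 0).lipschitz.comp h1)).sub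
    ((lipschitzWith_smul (D.β : ℂ)).comp ((bandD k 1).lipschitz.comp (lipschitz_truncOp N)))⟩

lemma bandD_zero_vf (u : L2) : bandD k 0 (vf D N ε k u) = vf D N ε k u := by
  simp only [vf, linOp, map_add, map_sub, map_smul, map_neg, bandD_bandD, zero_add,
    add_apply, sub_apply, smul_apply,
    neg_apply]

/-- The regularized equation is an ordinary differential equation in the space of band-limited functions,
which the flow preserves. -/
lemma exists_band_solution (u₀ : L2) : ∃ u : ℝ → L2, u 0 = bandD k 0 u₀ ∧
    (∀ t, 0 ≤ t → HasDerivAt u (vf D N ε k (u t)) t) ∧ ∀ t, 0 ≤ t → bandD k 0 (u t) = u t := by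
  obtain ⟨K, hK⟩ := lipschitz_vf D N ε k
  obtain ⟨u, hu0, hu⟩ := exists_global_solution hK (bandD k 0 u₀)
  refine ⟨u, hu0, hu, fun t ht => ?_⟩
  have hd : ∀ s, 0 ≤ s → HasDerivAt (fun s => bandD k 0 (u s) - u s) 0 s := by
    intro s hs
    have h1 : HasDerivAt (fun s => bandD k 0 (u s)) (bandD k 0 (vf D N ε k (u s))) s :=
      ((bandD k 0).restrictScalars ℝ).hasFDerivAt.comp_hasDerivAt s (hu s hs)
    have h2 := h1.sub (hu s hs)
    rwa [bandD_zero_vf, sub_self] at h2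
  have := constant_of_has_deriv_right_zero (f := fun s => bandD k 0 (u s) - u s) (a := 0) (b := t)
    (fun s hs => (hd s hs.1).continuousAt.continuousWithinAt)
    (fun s hs => (hd s hs.1).hasDerivWithinAt) t ⟨ht, le_rfl⟩
  simp only [hu0, bandD_bandD, add_zero, sub_self] at this
  exact sub_eq_zero.1 this

end VectorField

section Energy

variable (D : Coeffs) (N : ℝ≥0) {ε k : ℝ}

lemma hasDerivAt_wave_re (k : ℝ) (u : L2) (j : ℕ) (x : ℝ) :
    HasDerivAt (fun x => (wave k j u x).re) ((wave k (j + 1) u x).re) x :=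
  Complex.reCLM.hasFDerivAt.comp_hasDerivAt x (hasDerivAt_wave k j u x)

lemma hasDerivAt_wave_im (k : ℝ) (u : L2) (j : ℕ) (x : ℝ) :
    HasDerivAt (fun x => (wave k j u x).im) ((wave k (j + 1) u x).im) x :=
  Complex.imCLM.hasFDerivAt.comp_hasDerivAt x (hasDerivAt_wave k j u x)

lemma memLp_wave_re (k : ℝ) (u : L2) (j : ℕ) : MemLp (fun x => (wave k j u x).re) 2 volume :=
  (memLp_wave k j u).re

lemma memLp_wave_im (k : ℝ) (u : L2) (j : ℕ) : MemLp (fun x => (wave k j u x).im) 2 volume :=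
  (memLp_wave k j u).im

lemma norm_eq_sqrt (z : ℂ) : ‖z‖ = Real.sqrt (z.re ^ 2 + z.im ^ 2) := by
  rw [Complex.norm_def, Complex.normSq_apply]
  ring_nf

lemma re_inner_trunc {u v : L2} {U V : ℝ → ℂ} (hu : u =ᵐ[volume] U) (hv : v =ᵐ[volume] V) :
    (inner ℂ v (truncOp N u)).re = ∫ x, min (Real.sqrt ((U x).re ^ 2 + (U x).im ^ 2)) N *
      ((V x).re * (U x).re + (V x).im * (U x).im) := by
  rw [re_inner_eq_integral hv (truncOp_coe_of_ae N hu)]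
  congr 1
  funext x
  simp only [trunc, Complex.re_ofReal_mul, Complex.im_ofReal_mul, ← norm_eq_sqrt]
  ring

lemma abs_re_inner_le (u v : L2) : |(inner ℂ u v).re| ≤ ‖u‖ * ‖v‖ :=
  (Complex.abs_re_le_norm _).trans (norm_inner_le_norm u v)

/-- Interpolation between the orders `0` and `2`. -/
lemma norm_bandD_one_le {u : L2} : ‖bandD k 1 u‖ ≤ ‖u‖ + ‖bandD k 2 u‖ := by
  have h1 : ‖bandD k 1 u‖ ^ 2 ≤ ‖u‖ * ‖bandD k 2 u‖ := by
    have e : inner ℂ (bandD k 1 u) (bandD k 1 u) = - inner ℂ u (bandD k 2 u) := by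
      rw [inner_bandD, bandD_bandD]; norm_num
    have e2 := inner_self_eq_norm_sq (𝕜 := ℂ) (bandD k 1 u)
    rw [e] at e2
    rw [← e2]
    have := abs_re_inner_le u (bandD k 2 u)
    refine le_trans ?_ this
    simp only [map_neg]
    exact neg_le_abs _
  have h2 := norm_nonneg u
  have h3 := norm_nonneg (bandD k 2 u)
  by_contra hc
  push Not at hc
  nlinarith

/-- The mass estimate: the nonlinearity conserves the `L_2` norm. -/
lemma re_inner_vf_le {u : L2} (hu : bandD k 0 u = u) :
    (inner ℂ u (vf D N ε k u)).re ≤ -ε * ‖bandD k 2 u‖ ^ 2 + D.δ * ‖u‖ ^ 2 := by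
  have hodd : ∀ j, Odd j → (inner ℂ u (bandD k j u)).re = 0 := by
    intro j hj
    have h1 := inner_bandD k j u u
    rw [hj.neg_one_pow, neg_one_mul] at h1
    have h2 := congrArg Complex.re h1
    rw [← inner_conj_symm, Complex.conj_re, Complex.neg_re] at h2
    linarith
  have h2 : ((Complex.I * D.a) * inner ℂ u (bandD k 2 u)).re = 0 := by
    have h1 := inner_bandD k 2 u u
    rw [even_two.neg_one_pow, one_mul, ← inner_conj_symm] at h1
    have := congrArg Complex.im h1
    rw [Complex.conj_im] at this
    have him : (inner ℂ u (bandD k 2 u)).im = 0 := by linarith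
    simp [him]
  have h4 : (inner ℂ u (bandD k 4 u)).re = ‖bandD k 2 u‖ ^ 2 := by
    have h1 := inner_bandD k 2 u (bandD k 2 u)
    rw [even_two.neg_one_pow, one_mul, bandD_bandD] at h1
    rw [← h1]
    exact inner_self_eq_norm_sq (𝕜 := ℂ) (bandD k 2 u)
  have hw : u =ᵐ[volume] wave k 0 u := by
    have := bandD_ae_eq_wave k 0 u
    rwa [hu] at this
  have ht : ((Complex.I * D.lam) * inner ℂ u (truncOp N u)).re = 0 := by
    have him : (inner ℂ u (truncOp N u)).im = 0 := by
      rw [inner_eq_integral_of_ae (Filter.EventuallyEq.refl _ _) (truncOp_coe N u)]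
      have : ∀ x, starRingEnd ℂ (u x) * trunc N (u x) = ((min ‖u x‖ N * ‖u x‖ ^ 2 : ℝ) : ℂ) := by
        intro x
        simp only [trunc]
        rw [mul_left_comm, mul_comm (starRingEnd ℂ _), Complex.mul_conj, Complex.normSq_eq_norm_sq]
        push_cast; ring
      simp only [this]
      rw [integral_complex_ofReal, Complex.ofReal_im]
    simp [him]
  have hd : -(inner ℂ u (mulOp (fun x => (D.d x : ℂ)) u)).re ≤ D.δ * ‖u‖ ^ 2 := by
    refine (neg_le_abs _).trans ((abs_re_inner_le _ _).trans ?_)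
    have := norm_mulOp_le D.δ_nonneg D.abs_d_le u
    nlinarith [norm_nonneg u]
  have hn : (inner ℂ u (bandD k 1 (truncOp N u))).re = 0 := by
    have h1 := inner_bandD k 1 u (truncOp N u)
    rw [pow_one, neg_one_mul] at h1
    have e : (inner ℂ (bandD k 1 u) (truncOp N u)).re = 0 := by
      rw [re_inner_trunc N hw (bandD_ae_eq_wave k 1 u)]
      have := nonlinear_energy (ρ := fun _ => 1) (ρ1 := fun _ => 0) (fun x => hasDerivAt_const x 1)
        continuous_const (by simp) (by simp) (by simp) (hasDerivAt_wave_re k u 0) (hasDerivAt_wave_im k u 0)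
        (memLp_wave_re k u 0) (memLp_wave_im k u 0) (memLp_wave_re k u 1) (memLp_wave_im k u 1) N
      simp only [zero_mul, integral_zero, zero_add, one_mul] at this
      exact abs_eq_zero.1 (le_antisymm this (abs_nonneg _))
    rw [h1, Complex.neg_re] at e
    linarith
  have hP : ∀ g : L2, inner ℂ u (bandD k 0 g) = inner ℂ u g := fun g => by
    rw [← inner_bandD_zero, hu]
  have e : (inner ℂ u (vf D N ε k u)).re = -(inner ℂ u (bandD k 3 u)).re
      + ((Complex.I * D.a) * inner ℂ u (bandD k 2 u)).re - D.b * (inner ℂ u (bandD k 1 u)).re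
      - ε * (inner ℂ u (bandD k 4 u)).re + ((Complex.I * D.lam) * inner ℂ u (truncOp N u)).re
      - (inner ℂ u (mulOp (fun x => (D.d x : ℂ)) u)).re
      - D.β * (inner ℂ u (bandD k 1 (truncOp N u))).re := by
    simp only [vf, linOp, sourceOp, add_apply, sub_apply,
      smul_apply, neg_apply, inner_add_right, inner_sub_right,
      inner_neg_right, inner_smul_right, hP, Complex.add_re, Complex.sub_re, Complex.neg_re,
      Complex.re_ofReal_mul]
    ring
  rw [e, hodd 3 (by decide), hodd 1 (by decide), h2, h4, ht, hn]
  linarith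

end Energy

/-! ### The weighted smoothing estimate -/

namespace Weight

variable (W : Weight)

lemma memLp_top : MemLp (fun x => (W.ρ x : ℂ)) ⊤ volume := memLp_top_ofReal W.continuous W.abs_le
lemma memLp_top1 : MemLp (fun x => (W.ρ1 x : ℂ)) ⊤ volume := memLp_top_ofReal W.continuous1 W.abs1_le
lemma memLp_top2 : MemLp (fun x => (W.ρ2 x : ℂ)) ⊤ volume := memLp_top_ofReal W.continuous2 W.abs2_le

lemma norm_mulOp_le (u : L2) : ‖mulOp (fun x => (W.ρ x : ℂ)) u‖ ≤ 2 * ‖u‖ :=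
  HNLS.norm_mulOp_le (by norm_num) (Eventually.of_forall fun x => by
    rw [Complex.norm_real]; exact W.abs_le x) u

lemma norm_mulOp1_le (u : L2) : ‖mulOp (fun x => (W.ρ1 x : ℂ)) u‖ ≤ 2 * ‖u‖ :=
  HNLS.norm_mulOp_le (by norm_num) (Eventually.of_forall fun x => by
    rw [Complex.norm_real]; exact W.abs1_le x) u

lemma norm_mulOp2_le (u : L2) : ‖mulOp (fun x => (W.ρ2 x : ℂ)) u‖ ≤ 2 * ‖u‖ :=
  HNLS.norm_mulOp_le (by norm_num) (Eventually.of_forall fun x => by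
    rw [Complex.norm_real]; exact W.abs2_le x) u

end Weight

lemma wsq_mono {c c' : ℝ → ℝ} (hc : MemLp (fun x => (c x : ℂ)) ⊤ volume)
    (hc' : MemLp (fun x => (c' x : ℂ)) ⊤ volume) (h : ∀ x, c x ≤ c' x) (v : L2) :
    wsq c v ≤ wsq c' v := by
  rw [wsq_eq hc (Filter.EventuallyEq.refl _ _), wsq_eq hc' (Filter.EventuallyEq.refl _ _)]
  have hsq : Integrable (fun x => (v x).re ^ 2 + (v x).im ^ 2) volume :=
    (Lp.memLp v).re.integrable_sq.add (Lp.memLp v).im.integrable_sq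
  have key : ∀ {c : ℝ → ℝ}, MemLp (fun x => (c x : ℂ)) ⊤ volume →
      Integrable (fun x => c x * ((v x).re ^ 2 + (v x).im ^ 2)) volume := by
    intro c hc
    have := hc.re
    exact hsq.bdd_mul (c := (eLpNorm (fun x => (c x : ℂ)) ⊤ volume).toReal) this.1 (by
      filter_upwards [ae_le_eLpNormEssSup (f := fun x => (c x : ℂ)) (μ := volume)] with x hx
      have h2 := hc.2.ne
      rw [eLpNorm_exponent_top] at h2 ⊢
      have h3 := ENNReal.toReal_mono h2 hx
      simpa using h3)
  refine integral_mono (key hc) (key hc') fun x => ?_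
  exact mul_le_mul_of_nonneg_right (h x) (by positivity)

lemma wsq_const_mul {C : ℝ} (v : L2) : wsq (fun _ => C) v = C * ‖v‖ ^ 2 := by
  have h : MemLp (fun _ : ℝ => ((C : ℝ) : ℂ)) ⊤ volume := memLp_top_const _
  have : mulOp (fun _ : ℝ => ((C : ℝ) : ℂ)) v = (C : ℂ) • v := by
    ext1
    filter_upwards [mulOp_coe h v, Lp.coeFn_smul (C : ℂ) v] with x h1 h2
    rw [h1, h2, Pi.smul_apply, smul_eq_mul]
  rw [wsq, this, inner_smul_left, Complex.conj_ofReal, Complex.re_ofReal_mul]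
  congr 1
  exact inner_self_eq_norm_sq (𝕜 := ℂ) v

section Energy

variable (D : Coeffs) (N : ℝ≥0) {ε k : ℝ}

/-- The growth constant of the weighted estimate, for solutions of `L_2` norm at most `M`. -/
def Coeffs.rate (M : ℝ) : ℝ := D.a ^ 2 + |D.b| + D.β ^ 2 * M ^ 2 + D.δ + 2

set_option maxHeartbeats 1000000 in
/-- The weighted (Kato smoothing) estimate at a fixed time. The error made by the frequency
projection is `O(1/k)` times norms of two derivatives of `u`; it is absorbed by the dissipation
`ε ∫ |u_xx|² ρ`, which is why `ρ ≥ η > 0` and `k` large depending on `N`, `ε`, `η` are required. -/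
lemma re_inner_weight_vf_le (W : Weight) {η : ℝ} (hη : 0 < η) (hWη : ∀ x, η ≤ W.ρ x)
    (hε : 0 ≤ ε) (hε1 : ε ≤ 1 / 16) (hk : 0 < k)
    (hkη : (2 * Real.pi * k)⁻¹ * (4 * (|D.lam| * N + D.δ) + 6 * |D.β| * N) ≤ ε * η / 4)
    {u : L2} (hu : bandD k 0 u = u) {M : ℝ} (hM : 0 < M) (huM : ‖u‖ ≤ M) :
    (inner ℂ (mulOp (fun x => (W.ρ x : ℂ)) u) (vf D N ε k u)).re ≤
      -(1 / 2) * wsq W.ρ1 (bandD k 1 u) + D.rate M * wsq W.ρ u := by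
  have hw : ∀ j, bandD k j u =ᵐ[volume] wave k j u := fun j => bandD_ae_eq_wave k j u
  have hw0 : u =ᵐ[volume] wave k 0 u := by
    have := hw 0
    rwa [hu] at this
  set p : ℕ → ℝ → ℝ := fun j x => (wave k j u x).re with hp
  set q : ℕ → ℝ → ℝ := fun j x => (wave k j u x).im with hq
  have hZ : wsq W.ρ1 (bandD k 1 u) = ∫ x, W.ρ1 x * (p 1 x ^ 2 + q 1 x ^ 2) := wsq_eq W.memLp_top1 (hw 1)
  have hQ : wsq W.ρ1 u = ∫ x, W.ρ1 x * (p 0 x ^ 2 + q 0 x ^ 2) := wsq_eq W.memLp_top1 hw0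
  have hH : wsq W.ρ (bandD k 2 u) = ∫ x, W.ρ x * (p 2 x ^ 2 + q 2 x ^ 2) := wsq_eq W.memLp_top (hw 2)
  have hnorm : ‖u‖ ^ 2 = ∫ x, (p 0 x ^ 2 + q 0 x ^ 2) := by
    rw [norm_sq_eq_integral hw0]
    congr 1
    funext x
    rw [← Complex.normSq_eq_norm_sq, Complex.normSq_apply]
    simp only [hp, hq]; ring
  have hηc : MemLp (fun _ : ℝ => ((η : ℝ) : ℂ)) ⊤ volume := memLp_top_const _
  have hYη : η * ‖u‖ ^ 2 ≤ wsq W.ρ u := by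
    rw [← wsq_const_mul]; exact wsq_mono hηc W.memLp_top hWη u
  have hHη : η * ‖bandD k 2 u‖ ^ 2 ≤ wsq W.ρ (bandD k 2 u) := by
    rw [← wsq_const_mul]; exact wsq_mono hηc W.memLp_top hWη _
  have hQY : wsq W.ρ1 u ≤ wsq W.ρ u := wsq_mono W.memLp_top1 W.memLp_top W.le1 u
  have hQ0 : 0 ≤ wsq W.ρ1 u := by
    rw [hQ]; exact integral_nonneg fun x => mul_nonneg (W.nonneg1 x) (by positivity)
  have hZ0 : 0 ≤ wsq W.ρ1 (bandD k 1 u) := by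
    rw [hZ]; exact integral_nonneg fun x => mul_nonneg (W.nonneg1 x) (by positivity)
  set ρu := mulOp (fun x => (W.ρ x : ℂ)) u with hρu
  have hρu_ae : ρu =ᵐ[volume] fun x => (W.ρ x : ℂ) * wave k 0 u x := by
    filter_upwards [mulOp_coe W.memLp_top u, hw0] with x h1 h2
    rw [hρu, h1, h2]
  -- the first two derivatives of `ρ u`
  set v1 : L2 := mulOp (fun x => (W.ρ1 x : ℂ)) u + mulOp (fun x => (W.ρ x : ℂ)) (bandD k 1 u) with hv1
  set v2 : L2 := mulOp (fun x => (W.ρ2 x : ℂ)) u + (2 : ℂ) • mulOp (fun x => (W.ρ1 x : ℂ)) (bandD k 1 u)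
    + mulOp (fun x => (W.ρ x : ℂ)) (bandD k 2 u) with hv2
  have hv1_ae : v1 =ᵐ[volume] fun x => (W.ρ1 x : ℂ) * wave k 0 u x + (W.ρ x : ℂ) * wave k 1 u x := by
    filter_upwards [mulOp_coe W.memLp_top1 u, hw0, mulOp_coe W.memLp_top (bandD k 1 u), hw 1,
      Lp.coeFn_add (mulOp (fun x => (W.ρ1 x : ℂ)) u) (mulOp (fun x => (W.ρ x : ℂ)) (bandD k 1 u))]
      with x h1 h2 h3 h4 h5
    rw [hv1, h5, Pi.add_apply, h1, h2, h3, h4]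
  have hv2_ae : v2 =ᵐ[volume] fun x => (W.ρ2 x : ℂ) * wave k 0 u x + 2 * ((W.ρ1 x : ℂ) * wave k 1 u x)
      + (W.ρ x : ℂ) * wave k 2 u x := by
    filter_upwards [mulOp_coe W.memLp_top2 u, hw0, mulOp_coe W.memLp_top1 (bandD k 1 u), hw 1,
      mulOp_coe W.memLp_top (bandD k 2 u), hw 2,
      Lp.coeFn_add (mulOp (fun x => (W.ρ2 x : ℂ)) u + (2 : ℂ) • mulOp (fun x => (W.ρ1 x : ℂ)) (bandD k 1 u))
        (mulOp (fun x => (W.ρ x : ℂ)) (bandD k 2 u)),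
      Lp.coeFn_add (mulOp (fun x => (W.ρ2 x : ℂ)) u) ((2 : ℂ) • mulOp (fun x => (W.ρ1 x : ℂ)) (bandD k 1 u)),
      Lp.coeFn_smul (2 : ℂ) (mulOp (fun x => (W.ρ1 x : ℂ)) (bandD k 1 u))]
      with x h1 h2 h3 h4 h5 h6 h7 h8 h9
    rw [hv2, h7, Pi.add_apply, h8, Pi.add_apply, h9, Pi.smul_apply, h1, h2, h3, h4, h5, h6, smul_eq_mul]
  have hdw : ∀ j x, HasDerivAt (wave k j u) (wave k (j + 1) u x) x := fun j x => hasDerivAt_wave k j u x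
  have hdρ : ∀ x, HasDerivAt (fun x => (W.ρ x : ℂ)) (W.ρ1 x : ℂ) x := fun x => (W.hasDeriv x).ofReal_comp
  have hdρ1 : ∀ x, HasDerivAt (fun x => (W.ρ1 x : ℂ)) (W.ρ2 x : ℂ) x := fun x => (W.hasDeriv1 x).ofReal_comp
  have cw : ∀ j, Continuous (wave k j u) := fun j => continuous_wave k j u
  have c0 := Complex.continuous_ofReal.comp W.continuous
  have c1 := Complex.continuous_ofReal.comp W.continuous1
  have c2 := Complex.continuous_ofReal.comp W.continuous2
  have weak1 : IsWeakDeriv ρu v1 := isWeakDeriv_of_hasDerivAt hρu_ae hv1_ae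
    (fun x => (hdρ x).mul (hdw 0 x)) ((c1.mul (cw 0)).add (c0.mul (cw 1)))
  have weak2 : IsWeakDeriv v1 v2 := isWeakDeriv_of_hasDerivAt hv1_ae hv2_ae
    (fun x => (((hdρ1 x).mul (hdw 0 x)).add ((hdρ x).mul (hdw 1 x))).congr_deriv (by ring))
    (((c2.mul (cw 0)).add (continuous_const.mul (c1.mul (cw 1)))).add (c0.mul (cw 2)))
  set nu := ‖u‖ with hnu
  set n2 := ‖bandD k 2 u‖ with hn2
  have hnu0 : 0 ≤ nu := norm_nonneg _
  have hn20 : 0 ≤ n2 := norm_nonneg _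
  have hn1 : ‖bandD k 1 u‖ ≤ nu + n2 := norm_bandD_one_le
  have bv1 : ‖v1‖ ≤ 4 * (nu + n2) := by
    refine (norm_add_le _ _).trans ?_
    have e1 := W.norm_mulOp1_le u
    have e2 := W.norm_mulOp_le (bandD k 1 u)
    linarith
  have bv2 : ‖v2‖ ≤ 6 * (nu + n2) := by
    refine (norm_add_le _ _).trans ((add_le_add_left (norm_add_le _ _) _).trans ?_)
    have e1 := W.norm_mulOp2_le u
    have e2 := W.norm_mulOp1_le (bandD k 1 u)
    have e3 := W.norm_mulOp_le (bandD k 2 u)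
    rw [norm_smul, Complex.norm_ofNat]
    linarith
  set s := (2 * Real.pi * k)⁻¹ with hs
  have hs0 : 0 ≤ s := by positivity
  -- the linear part
  have T1 : (inner ℂ ρu (linOp D ε k u)).re ≤ -(5 / 4 - 4 * ε) * wsq W.ρ1 (bandD k 1 u)
      + (1 / 2 + D.a ^ 2 + |D.b| / 2 + ε) * wsq W.ρ1 u - ε / 2 * wsq W.ρ (bandD k 2 u) := by
    have hlin : linOp D ε k u =ᵐ[volume] fun x => -wave k 3 u x + (Complex.I * D.a) * wave k 2 u x
        - D.b * wave k 1 u x - ε * wave k 4 u x := by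
      have e : linOp D ε k u = -(bandD k 3 u) + (Complex.I * D.a) • bandD k 2 u - (D.b : ℂ) • bandD k 1 u
        - (ε : ℂ) • bandD k 4 u := by
        simp only [linOp, add_apply, sub_apply, smul_apply, neg_apply]
      rw [e]
      filter_upwards [hw 1, hw 2, hw 3, hw 4,
        Lp.coeFn_sub (-(bandD k 3 u) + (Complex.I * D.a) • bandD k 2 u - (D.b : ℂ) • bandD k 1 u)
          ((ε : ℂ) • bandD k 4 u),
        Lp.coeFn_sub (-(bandD k 3 u) + (Complex.I * D.a) • bandD k 2 u) ((D.b : ℂ) • bandD k 1 u),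
        Lp.coeFn_add (-(bandD k 3 u)) ((Complex.I * D.a) • bandD k 2 u), Lp.coeFn_neg (bandD k 3 u),
        Lp.coeFn_smul (Complex.I * D.a) (bandD k 2 u), Lp.coeFn_smul (D.b : ℂ) (bandD k 1 u),
        Lp.coeFn_smul (ε : ℂ) (bandD k 4 u)] with x h1 h2 h3 h4 h5 h6 h7 h8 h9 h10 h11
      rw [h5, Pi.sub_apply, h6, Pi.sub_apply, h7, Pi.add_apply, h8, h9, h10, h11]
      simp only [Pi.neg_apply, Pi.smul_apply, smul_eq_mul, h1, h2, h3, h4]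
    rw [re_inner_eq_integral hρu_ae hlin, hZ, hQ, hH]
    refine le_trans (le_of_eq ?_) (linear_energy W (hasDerivAt_wave_re k u) (hasDerivAt_wave_im k u)
      (memLp_wave_re k u) (memLp_wave_im k u) D.a D.b hε)
    congr 1
    funext x
    simp
    ring
  -- the zero order terms: the projector moves to `ρ u`, which is almost band-limited
  have T2 : (inner ℂ ρu (bandD k 0 (sourceOp D N u))).re ≤
      D.δ * wsq W.ρ u + s * (4 * (|D.lam| * N + D.δ)) * (nu * (nu + n2)) := by
    have e1 : inner ℂ ρu (bandD k 0 (sourceOp D N u)) =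
        inner ℂ ρu (sourceOp D N u) - inner ℂ (ρu - bandD k 0 ρu) (sourceOp D N u) := by
      rw [← inner_bandD_zero, inner_sub_left]; ring
    have e2 : (inner ℂ ρu (sourceOp D N u)).re ≤ D.δ * wsq W.ρ u := by
      have f1 : ((Complex.I * D.lam) * inner ℂ ρu (truncOp N u)).re = 0 := by
        have him : (inner ℂ ρu (truncOp N u)).im = 0 := by
          rw [inner_eq_integral_of_ae (mulOp_coe W.memLp_top u) (truncOp_coe N u)]
          have : ∀ x, starRingEnd ℂ ((W.ρ x : ℂ) * u x) * trunc N (u x) =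
              ((W.ρ x * (min ‖u x‖ N * ‖u x‖ ^ 2) : ℝ) : ℂ) := by
            intro x
            simp only [trunc]
            rw [map_mul, Complex.conj_ofReal, mul_assoc, mul_left_comm (starRingEnd ℂ _),
              mul_comm (starRingEnd ℂ _), Complex.mul_conj, Complex.normSq_eq_norm_sq]
            push_cast; ring
          simp only [this]
          rw [integral_complex_ofReal, Complex.ofReal_im]
        simp [him]
      have f2 : -(inner ℂ ρu (mulOp (fun x => (D.d x : ℂ)) u)).re ≤ D.δ * wsq W.ρ u := by
        rw [re_inner_eq_integral (mulOp_coe W.memLp_top u) (mulOp_coe D.memLp_d u),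
          wsq_eq W.memLp_top (Filter.EventuallyEq.refl _ _), ← integral_neg, ← integral_const_mul]
        have hsq : Integrable (fun x => (u x).re ^ 2 + (u x).im ^ 2) volume :=
          (Lp.memLp u).re.integrable_sq.add (Lp.memLp u).im.integrable_sq
        have hi := hsq.bdd_mul W.continuous.aestronglyMeasurable (Eventually.of_forall W.abs_le)
        have m1 := (memLp_congr_ae (mulOp_coe W.memLp_top u)).1 (Lp.memLp _)
        have m2 := (memLp_congr_ae (mulOp_coe D.memLp_d u)).1 (Lp.memLp _)
        have hi2 := ((m1.re.integrable_mul m2.re).add (m1.im.integrable_mul m2.im)).neg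
        refine integral_mono_ae hi2 (hi.const_mul _) ?_
        filter_upwards [D.abs_d_le] with x hx
        rw [Complex.norm_real, Real.norm_eq_abs] at hx
        have hd := (abs_le.1 hx).1
        have h0 := W.pos x
        simp only [Complex.re_ofReal_mul, Complex.im_ofReal_mul]
        have h3 : 0 ≤ W.ρ x * ((u x).re ^ 2 + (u x).im ^ 2) := by positivity
        nlinarith [mul_nonneg h3 (by linarith : 0 ≤ D.δ + D.d x)]
      simp only [sourceOp, inner_sub_right, inner_smul_right, Complex.sub_re, f1]
      linarith
    have e3 : ‖sourceOp D N u‖ ≤ (|D.lam| * N + D.δ) * nu := by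
      refine (norm_sub_le _ _).trans ?_
      rw [norm_smul, norm_mul, Complex.norm_I, one_mul, Complex.norm_real, Real.norm_eq_abs, add_mul]
      have := norm_truncOp_le N u
      refine add_le_add ?_ (norm_mulOp_le D.δ_nonneg D.abs_d_le u)
      rw [mul_assoc]
      gcongr
    have e4 : |(inner ℂ (ρu - bandD k 0 ρu) (sourceOp D N u)).re| ≤
        s * (4 * (|D.lam| * N + D.δ)) * (nu * (nu + n2)) := by
      refine (abs_re_inner_le _ _).trans ?_
      have h0 : 0 ≤ |D.lam| * N + D.δ := add_nonneg (by positivity) D.δ_nonneg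
      calc _ ≤ (s * (4 * (nu + n2))) * ((|D.lam| * N + D.δ) * nu) := by
            refine mul_le_mul ((weak1.norm_sub_bandD_le hk).trans ?_) e3 (norm_nonneg _) (by positivity)
            gcongr
        _ = _ := by ring
    rw [e1, Complex.sub_re]
    have := (abs_le.1 e4).1
    linarith
  -- the derivative nonlinearity: after integration by parts the projector moves to `(ρ u)_x`
  have T3 : -(D.β * (inner ℂ ρu (bandD k 1 (truncOp N u))).re) ≤
      (1 / 2 + D.β ^ 2 * M ^ 2) * wsq W.ρ1 u + 1 / 4 * wsq W.ρ1 (bandD k 1 u)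
      + s * (6 * |D.β| * N) * (nu * (nu + n2)) := by
    have e1 : inner ℂ ρu (bandD k 1 (truncOp N u)) =
        - inner ℂ v1 (truncOp N u) + inner ℂ (v1 - bandD k 0 v1) (truncOp N u) := by
      have := inner_bandD k 1 ρu (truncOp N u)
      rw [weak1.bandD_one, pow_one, neg_one_mul] at this
      rw [inner_sub_left, this]; ring
    have e2 : |(inner ℂ v1 (truncOp N u)).re| ≤
        ∫ x, W.ρ1 x * (min (Real.sqrt (p 0 x ^ 2 + q 0 x ^ 2)) N * (p 0 x ^ 2 + q 0 x ^ 2)) := by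
      rw [re_inner_trunc N hw0 hv1_ae]
      refine le_trans (le_of_eq ?_) (nonlinear_energy W.hasDeriv W.continuous1 W.abs_le W.abs1_le W.nonneg1
        (hasDerivAt_wave_re k u 0) (hasDerivAt_wave_im k u 0)
        (memLp_wave_re k u 0) (memLp_wave_im k u 0) (memLp_wave_re k u 1) (memLp_wave_im k u 1) N)
      congr 2
      funext x
      simp
    have e3 := cubic_bound W (hasDerivAt_wave_re k u 0) (hasDerivAt_wave_im k u 0)
        (memLp_wave_re k u 0) (memLp_wave_im k u 0) (memLp_wave_re k u 1) (memLp_wave_im k u 1) N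
        (abs_nonneg D.β) hM (by rw [← hnorm]; gcongr)
    rw [sq_abs] at e3
    have e4 : |(inner ℂ (v1 - bandD k 0 v1) (truncOp N u)).re| ≤ s * (6 * N) * (nu * (nu + n2)) := by
      refine (abs_re_inner_le _ _).trans ?_
      calc _ ≤ (s * (6 * (nu + n2))) * (N * nu) := by
            refine mul_le_mul ((weak2.norm_sub_bandD_le hk).trans ?_) (norm_truncOp_le N u)
              (norm_nonneg _) (by positivity)
            gcongr
        _ = _ := by ring
    rw [hQ, hZ]
    have e5 : -(D.β * (inner ℂ ρu (bandD k 1 (truncOp N u))).re) ≤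
        |D.β| * |(inner ℂ v1 (truncOp N u)).re| +
          |D.β| * |(inner ℂ (v1 - bandD k 0 v1) (truncOp N u)).re| := by
      rw [e1, Complex.add_re, Complex.neg_re, ← mul_add]
      refine (neg_le_abs _).trans ?_
      rw [abs_mul]
      refine mul_le_mul_of_nonneg_left ((abs_add_le _ _).trans ?_) (abs_nonneg _)
      rw [abs_neg]
    have e6 : |D.β| * |(inner ℂ v1 (truncOp N u)).re| ≤ _ :=
      (mul_le_mul_of_nonneg_left e2 (abs_nonneg _)).trans e3
    have e7 := mul_le_mul_of_nonneg_left e4 (abs_nonneg D.β)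
    calc _ ≤ _ := e5
      _ ≤ _ := add_le_add e6 e7
      _ = _ := by simp only [hp, hq]; ring
  have e : (inner ℂ ρu (vf D N ε k u)).re = (inner ℂ ρu (linOp D ε k u)).re
      + (inner ℂ ρu (bandD k 0 (sourceOp D N u))).re
      + -(D.β * (inner ℂ ρu (bandD k 1 (truncOp N u))).re) := by
    simp only [vf, inner_add_right, inner_sub_right, inner_smul_right, Complex.add_re, Complex.sub_re,
      Complex.re_ofReal_mul]
    ring
  rw [e]
  -- the projection errors are absorbed by the dissipation, through `ρ ≥ η` and the size of `k`
  have herr : s * (4 * (|D.lam| * N + D.δ)) * (nu * (nu + n2)) + s * (6 * |D.β| * N) * (nu * (nu + n2)) ≤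
      1 / 2 * wsq W.ρ u + ε / 2 * wsq W.ρ (bandD k 2 u) := by
    have h1 : nu * (nu + n2) ≤ 2 * nu ^ 2 + n2 ^ 2 := by nlinarith [sq_nonneg (nu - n2)]
    have h2 : 0 ≤ nu * (nu + n2) := by positivity
    calc _ = (s * (4 * (|D.lam| * N + D.δ) + 6 * |D.β| * N)) * (nu * (nu + n2)) := by ring
      _ ≤ (ε * η / 4) * (2 * nu ^ 2 + n2 ^ 2) := by
          refine mul_le_mul hkη h1 h2 (by positivity)
      _ = ε / 2 * (η * nu ^ 2) + ε / 4 * (η * n2 ^ 2) := by ring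
      _ ≤ _ := by
          have g1 : ε / 2 * (η * nu ^ 2) ≤ 1 / 2 * wsq W.ρ u :=
            mul_le_mul (by linarith) hYη (by positivity) (by norm_num)
          have g2 : ε / 4 * (η * n2 ^ 2) ≤ ε / 2 * wsq W.ρ (bandD k 2 u) :=
            mul_le_mul (by linarith) hHη (by positivity) (by linarith)
          linarith
  have hc1 : -(5 / 4 - 4 * ε) * wsq W.ρ1 (bandD k 1 u) ≤ -1 * wsq W.ρ1 (bandD k 1 u) :=
    mul_le_mul_of_nonneg_right (by linarith) hZ0
  have hc2 : (1 / 2 + D.a ^ 2 + |D.b| / 2 + ε + (1 / 2 + D.β ^ 2 * M ^ 2)) * wsq W.ρ1 u ≤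
      (3 / 2 + D.a ^ 2 + |D.b| + D.β ^ 2 * M ^ 2) * wsq W.ρ u := by
    refine mul_le_mul ?_ hQY hQ0 (by positivity)
    have := abs_nonneg D.b
    linarith
  unfold Coeffs.rate
  linarith

end Energy

/-! ### Uniform bounds and the approximating sequence -/

/-- Gronwall's inequality in the form that also keeps the dissipated quantity `Z`. -/
lemma gronwall_dissipation {Y Y' Z Λ Λ' : ℝ → ℝ} {t : ℝ} (ht : 0 ≤ t)
    (hY : ContinuousOn Y (Icc 0 t)) (hY' : ∀ s ∈ Ioo 0 t, HasDerivAt Y (Y' s) s)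
    (hZ : ContinuousOn Z (Icc 0 t)) (hΛ : ∀ s, HasDerivAt Λ (Λ' s) s) (hΛ0 : Λ 0 = 0)
    (h : ∀ s ∈ Ioo 0 t, Y' s ≤ Λ' s * Y s - Z s) :
    Real.exp (-Λ t) * Y t + ∫ s in (0 : ℝ)..t, Real.exp (-Λ s) * Z s ≤ Y 0 := by
  have cΛ : Continuous Λ := continuous_iff_continuousAt.2 fun s => (hΛ s).continuousAt
  have key := intervalIntegral.sub_le_integral_of_hasDeriv_right_of_le
    (g := fun s => Real.exp (-Λ s) * Y s)
    (g' := fun s => Real.exp (-Λ s) * (-Λ' s) * Y s + Real.exp (-Λ s) * Y' s)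
    (φ := fun s => -(Real.exp (-Λ s) * Z s)) ht
    ((Real.continuous_exp.comp cΛ.neg).continuousOn.mul hY)
    (fun s hs => (((hΛ s).neg.exp).mul (hY' s hs)).hasDerivWithinAt)
    (((Real.continuous_exp.comp cΛ.neg).continuousOn.mul hZ).neg.integrableOn_Icc)
    (fun s hs => by
      have := mul_le_mul_of_nonneg_left (h s hs) (Real.exp_nonneg (-Λ s))
      linarith)
  rw [intervalIntegral.integral_neg, hΛ0] at key
  simp only [neg_zero, Real.exp_zero, one_mul] at key
  linarith

/-- The step profile `x ↦ σ(x - x₀)`, `σ` the logistic function. -/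
noncomputable def step (x₀ x : ℝ) : ℝ := Real.sigmoid (x - x₀)

/-- The derivative of `step x₀`: a bump concentrated near `x₀`, with exponential tails. -/
noncomputable def bump (x₀ x : ℝ) : ℝ := step x₀ x * (1 - step x₀ x)

lemma step_pos (x₀ x : ℝ) : 0 < step x₀ x := Real.sigmoid_pos _
lemma step_lt_one (x₀ x : ℝ) : step x₀ x < 1 := Real.sigmoid_lt_one _
lemma hasDerivAt_step (x₀ x : ℝ) : HasDerivAt (step x₀) (bump x₀ x) x := by
  have := (Real.hasDerivAt_sigmoid (x - x₀)).comp x ((hasDerivAt_id x).sub_const x₀)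
  exact this.congr_deriv (mul_one _)
lemma bump_pos (x₀ x : ℝ) : 0 < bump x₀ x := mul_pos (step_pos _ _) (by linarith [step_lt_one x₀ x])
lemma bump_le_step (x₀ x : ℝ) : bump x₀ x ≤ step x₀ x := by
  unfold bump; nlinarith [step_pos x₀ x, step_lt_one x₀ x]
lemma bump_le_quarter (x₀ x : ℝ) : bump x₀ x ≤ 1 / 4 := by
  unfold bump; nlinarith [sq_nonneg (step x₀ x - 1 / 2)]
lemma continuous_step (x₀ : ℝ) : Continuous (step x₀) :=
  continuous_iff_continuousAt.2 fun x => (hasDerivAt_step x₀ x).continuousAt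
lemma continuous_bump (x₀ : ℝ) : Continuous (bump x₀) :=
  (continuous_step x₀).mul (continuous_const.sub (continuous_step x₀))

lemma hasDerivAt_bump (x₀ x : ℝ) : HasDerivAt (bump x₀) (bump x₀ x * (1 - 2 * step x₀ x)) x :=
  ((hasDerivAt_step x₀ x).mul ((hasDerivAt_step x₀ x).const_sub 1)).congr_deriv (by ring)

/-- The weight `η + σ(x - x₀)`. -/
noncomputable def stepWeight (η x₀ : ℝ) (hη : 0 < η) (hη1 : η ≤ 1) : Weight where
  ρ := fun x => η + step x₀ x
  ρ1 := bump x₀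
  ρ2 := fun x => bump x₀ x * (1 - 2 * step x₀ x)
  ρ3 := fun x => bump x₀ x * (1 - 6 * bump x₀ x)
  hasDeriv := fun x => (hasDerivAt_step x₀ x).const_add η
  hasDeriv1 := hasDerivAt_bump x₀
  hasDeriv2 := fun x => ((hasDerivAt_bump x₀ x).mul
    (((hasDerivAt_step x₀ x).const_mul 2).const_sub 1)).congr_deriv (by unfold bump; ring)
  continuous3 := (continuous_bump x₀).mul (continuous_const.sub (continuous_const.mul (continuous_bump x₀)))
  pos := fun x => add_pos hη (step_pos x₀ x)
  le_two := fun x => by linarith [step_lt_one x₀ x]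
  nonneg1 := fun x => (bump_pos x₀ x).le
  le1 := fun x => by linarith [bump_le_step x₀ x]
  le2 := fun x => by
    rw [abs_mul, abs_of_pos (bump_pos x₀ x)]
    refine mul_le_of_le_one_right (bump_pos x₀ x).le (abs_le.2 ⟨?_, ?_⟩) <;>
      linarith [step_lt_one x₀ x, step_pos x₀ x]
  le3 := fun x => by
    rw [abs_mul, abs_of_pos (bump_pos x₀ x)]
    refine mul_le_of_le_one_right (bump_pos x₀ x).le (abs_le.2 ⟨?_, ?_⟩) <;>
      linarith [bump_le_quarter x₀ x, bump_pos x₀ x]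

lemma memLp_top_step (x₀ : ℝ) : MemLp (fun x => (step x₀ x : ℂ)) ⊤ volume :=
  memLp_top_ofReal (C := 1) (continuous_step x₀) fun x => by
    rw [abs_of_pos (step_pos _ _)]; exact (step_lt_one _ _).le

lemma memLp_top_bump (x₀ : ℝ) : MemLp (fun x => (bump x₀ x : ℂ)) ⊤ volume :=
  memLp_top_ofReal (C := 1 / 4) (continuous_bump x₀) fun x => by
    rw [abs_of_pos (bump_pos _ _)]; exact bump_le_quarter _ _

lemma wsq_const_add {c : ℝ → ℝ} (hc : MemLp (fun x => (c x : ℂ)) ⊤ volume) (η : ℝ) (v : L2) :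
    wsq (fun x => η + c x) v = η * ‖v‖ ^ 2 + wsq c v := by
  have h : MemLp (fun _ : ℝ => ((η : ℝ) : ℂ)) ⊤ volume := memLp_top_const _
  have h' : MemLp (fun x : ℝ => ((η + c x : ℝ) : ℂ)) ⊤ volume := by
    simp only [Complex.ofReal_add]
    exact h.add hc
  rw [← wsq_const_mul, wsq, wsq, wsq, ← Complex.add_re, ← inner_add_left]
  congr 2
  ext1
  filter_upwards [mulOp_coe h v, mulOp_coe hc v, mulOp_coe h' v,
    Lp.coeFn_add (mulOp (fun _ : ℝ => ((η : ℝ) : ℂ)) v) (mulOp (fun x => (c x : ℂ)) v)] with x h1 h2 h3 h4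
  rw [h4, Pi.add_apply, h1, h2, h3]
  push_cast; ring

lemma norm_nonneg_wsq {c : ℝ → ℝ} (hc : MemLp (fun x => (c x : ℂ)) ⊤ volume) (h : ∀ x, 0 ≤ c x) (v : L2) :
    0 ≤ wsq c v := by
  rw [wsq_eq hc (Filter.EventuallyEq.refl _ _)]
  exact integral_nonneg fun x => mul_nonneg (h x) (by positivity)

/-- Bound for the `L_2` norm at time `t` of a solution with initial `L_2` norm `m`, made positive. -/
noncomputable def Coeffs.size (D : Coeffs) (m t : ℝ) : ℝ := Real.exp (D.δ * t) * (m + 1)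

/-- The exponent in the weighted estimates at time `t`. -/
noncomputable def Coeffs.growth (D : Coeffs) (m t : ℝ) : ℝ := 2 * t * D.rate (D.size m t)

/-- The derivative of `Coeffs.growth` in `t`. -/
noncomputable def Coeffs.growthDeriv (D : Coeffs) (m t : ℝ) : ℝ :=
  2 * D.rate (D.size m t) + 2 * t * (D.β ^ 2 * (2 * (D.size m t) * (D.δ * D.size m t)))

lemma Coeffs.hasDerivAt_size (D : Coeffs) (m t : ℝ) : HasDerivAt (D.size m) (D.δ * D.size m t) t := by
  have := (((hasDerivAt_id t).const_mul D.δ).exp).mul_const (m + 1)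
  refine this.congr_deriv ?_
  simp only [Coeffs.size, id]; ring

lemma Coeffs.hasDerivAt_growth (D : Coeffs) (m t : ℝ) :
    HasDerivAt (D.growth m) (D.growthDeriv m t) t := by
  have h1 := ((D.hasDerivAt_size m t).pow 2).const_mul (D.β ^ 2)
  have h2 := (((h1.const_add (D.a ^ 2 + |D.b|)).add_const D.δ).add_const 2)
  have h3 := ((hasDerivAt_id t).const_mul 2).mul h2
  refine h3.congr_deriv ?_
  simp only [Coeffs.growthDeriv, Coeffs.rate, id]
  push_cast
  ring_nf
  simp
  ring

lemma Coeffs.size_pos (D : Coeffs) {m : ℝ} (hm : 0 ≤ m) (t : ℝ) : 0 < D.size m t := by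
  unfold Coeffs.size; positivity

lemma Coeffs.continuous_growth (D : Coeffs) (m : ℝ) : Continuous (D.growth m) :=
  continuous_iff_continuousAt.2 fun t => (D.hasDerivAt_growth m t).continuousAt

lemma Coeffs.size_mono (D : Coeffs) {m : ℝ} (hm : 0 ≤ m) {s t : ℝ} (h : s ≤ t) : D.size m s ≤ D.size m t := by
  unfold Coeffs.size
  have := D.δ_nonneg
  gcongr

lemma Coeffs.two_rate_le (D : Coeffs) (m : ℝ) {t : ℝ} (ht : 0 ≤ t) :
    2 * D.rate (D.size m t) ≤ D.growthDeriv m t := by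
  unfold Coeffs.growthDeriv
  have := D.δ_nonneg
  have : 0 ≤ 2 * t * (D.β ^ 2 * (2 * (D.size m t) * (D.δ * D.size m t))) := by
    have h : 2 * t * (D.β ^ 2 * (2 * (D.size m t) * (D.δ * D.size m t))) =
      4 * t * D.β ^ 2 * D.δ * (D.size m t) ^ 2 := by ring
    rw [h]; positivity
  linarith

section Bounds

variable {D : Coeffs} {N : ℝ≥0} {ε k : ℝ} {u : ℝ → L2} {u₀ : L2}

/-- The mass estimate integrated in time, including the artificial dissipation. -/
lemma energy_bound (h0 : u 0 = bandD k 0 u₀) (hc : Continuous u)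
    (hd : ∀ t, 0 < t → HasDerivAt u (vf D N ε k (u t)) t) (hb : ∀ t, bandD k 0 (u t) = u t)
    {t : ℝ} (ht : 0 ≤ t) :
    Real.exp (-(2 * D.δ * t)) * ‖u t‖ ^ 2 + ∫ s in (0 : ℝ)..t,
      Real.exp (-(2 * D.δ * s)) * (2 * ε * ‖bandD k 2 (u s)‖ ^ 2) ≤ ‖u₀‖ ^ 2 := by
  have key := gronwall_dissipation (Y := fun s => ‖u s‖ ^ 2)
    (Y' := fun s => 2 * (inner ℂ (u s) (vf D N ε k (u s))).re)
    (Z := fun s => 2 * ε * ‖bandD k 2 (u s)‖ ^ 2) (Λ := fun s => 2 * D.δ * s) (Λ' := fun _ => 2 * D.δ) ht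
    (by fun_prop) (fun s hs => by
      let _ : InnerProductSpace ℝ L2 := InnerProductSpace.rclikeToReal ℂ L2
      have h := (hd s hs.1).norm_sq
      exact h.congr_deriv rfl) (by fun_prop)
    (fun s => by simpa using (hasDerivAt_id s).const_mul (2 * D.δ)) (by simp)
    (fun s hs => by
      have := re_inner_vf_le D N (ε := ε) (hb s)
      linarith)
  refine key.trans ?_
  simp only [h0]
  have := norm_bandD_zero_le k u₀
  gcongr

lemma norm_le_size (hε : 0 ≤ ε) (h0 : u 0 = bandD k 0 u₀) (hc : Continuous u)
    (hd : ∀ t, 0 < t → HasDerivAt u (vf D N ε k (u t)) t) (hb : ∀ t, bandD k 0 (u t) = u t)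
    {t : ℝ} (ht : 0 ≤ t) : ‖u t‖ ≤ D.size ‖u₀‖ t := by
  have h := energy_bound h0 hc hd hb ht
  have hi : 0 ≤ ∫ s in (0 : ℝ)..t, Real.exp (-(2 * D.δ * s)) * (2 * ε * ‖bandD k 2 (u s)‖ ^ 2) :=
    intervalIntegral.integral_nonneg ht fun s _ => by positivity
  have h1 : Real.exp (-(2 * D.δ * t)) * ‖u t‖ ^ 2 ≤ ‖u₀‖ ^ 2 := by linarith
  have h2 : (Real.exp (-(D.δ * t)) * ‖u t‖) ^ 2 ≤ ‖u₀‖ ^ 2 := by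
    rw [mul_pow, ← Real.exp_nat_mul]
    convert h1 using 3
    push_cast; ring
  have h3 := le_of_sq_le_sq h2 (norm_nonneg _)
  have h4 : ‖u t‖ = Real.exp (D.δ * t) * (Real.exp (-(D.δ * t)) * ‖u t‖) := by
    rw [← mul_assoc, ← Real.exp_add]; simp
  rw [h4, Coeffs.size]
  gcongr
  linarith

lemma dissipation_bound (hε : 0 ≤ ε) (h0 : u 0 = bandD k 0 u₀) (hc : Continuous u)
    (hd : ∀ t, 0 < t → HasDerivAt u (vf D N ε k (u t)) t) (hb : ∀ t, bandD k 0 (u t) = u t)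
    {t : ℝ} (ht : 0 ≤ t) :
    ε * ∫ s in (0 : ℝ)..t, ‖bandD k 2 (u s)‖ ^ 2 ≤ D.size ‖u₀‖ t ^ 2 := by
  have h := energy_bound h0 hc hd hb ht
  have h1 : Real.exp (-(2 * D.δ * t)) * (ε * ∫ s in (0 : ℝ)..t, ‖bandD k 2 (u s)‖ ^ 2) ≤ ‖u₀‖ ^ 2 := by
    refine le_trans ?_ ((le_add_of_nonneg_left (by positivity)).trans h)
    rw [← intervalIntegral.integral_const_mul, ← intervalIntegral.integral_const_mul]
    refine intervalIntegral.integral_mono_on ht (by apply Continuous.intervalIntegrable; fun_prop)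
      (by apply Continuous.intervalIntegrable; fun_prop) fun s hs => ?_
    have e1 : Real.exp (-(2 * D.δ * t)) ≤ Real.exp (-(2 * D.δ * s)) := by
      have := D.δ_nonneg
      have := hs.2
      gcongr
    refine mul_le_mul e1 ?_ (by positivity) (by positivity)
    nlinarith [mul_nonneg hε (sq_nonneg ‖bandD k 2 (u s)‖)]
  have h2 : ε * ∫ s in (0 : ℝ)..t, ‖bandD k 2 (u s)‖ ^ 2 = Real.exp (2 * D.δ * t) *
      (Real.exp (-(2 * D.δ * t)) * (ε * ∫ s in (0 : ℝ)..t, ‖bandD k 2 (u s)‖ ^ 2)) := by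
    rw [← mul_assoc, ← Real.exp_add]; simp
  rw [h2, Coeffs.size, mul_pow, ← Real.exp_nat_mul]
  have e : ((2 : ℕ) : ℝ) * (D.δ * t) = 2 * D.δ * t := by push_cast; ring
  rw [e]
  refine mul_le_mul_of_nonneg_left (h1.trans ?_) (Real.exp_nonneg _)
  have := norm_nonneg u₀
  nlinarith

/-- The smoothing estimate integrated in time, for a step at `x₀`. The constants do not depend on `x₀` nor
on the regularization; the small lower bound `η` of the weight only enters through the last term. -/
lemma weighted_bound (hε : 0 ≤ ε) (hε1 : ε ≤ 1 / 16) (hk : 0 < k) {η : ℝ} (hη : 0 < η) (hη1 : η ≤ 1)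
    (hkη : (2 * Real.pi * k)⁻¹ * (4 * (|D.lam| * N + D.δ) + 6 * |D.β| * N) ≤ ε * η / 4)
    (h0 : u 0 = bandD k 0 u₀) (hc : Continuous u)
    (hd : ∀ t, 0 < t → HasDerivAt u (vf D N ε k (u t)) t) (hb : ∀ t, bandD k 0 (u t) = u t)
    (x₀ : ℝ) {t : ℝ} (ht : 0 ≤ t) :
    Real.exp (-D.growth ‖u₀‖ t) * wsq (step x₀) (u t) + ∫ s in (0 : ℝ)..t,
      Real.exp (-D.growth ‖u₀‖ s) * wsq (bump x₀) (bandD k 1 (u s)) ≤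
        wsq (step x₀) (u 0) + η * ‖u₀‖ ^ 2 := by
  set W := stepWeight η x₀ hη hη1 with hW
  have cw : ∀ {c : ℝ → ℝ} {f : ℝ → L2}, Continuous f → ContinuousOn (fun s => wsq c (f s)) (Icc 0 t) :=
    fun hf => ((continuous_wsq _).comp hf).continuousOn
  have key := gronwall_dissipation (Y := fun s => wsq W.ρ (u s))
    (Y' := fun s => 2 * (inner ℂ (mulOp (fun x => (W.ρ x : ℂ)) (u s)) (vf D N ε k (u s))).re)
    (Z := fun s => wsq (bump x₀) (bandD k 1 (u s))) (Λ := D.growth ‖u₀‖) (Λ' := D.growthDeriv ‖u₀‖) ht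
    (cw hc) (fun s hs => hasDerivAt_wsq W.memLp_top (hd s hs.1)) (cw (by fun_prop))
    (D.hasDerivAt_growth _) (by simp [Coeffs.growth])
    (fun s hs => by
      have h1 := re_inner_weight_vf_le D N W hη (fun x => le_add_of_nonneg_right (step_pos x₀ x).le)
        hε hε1 hk hkη (hb s) (D.size_pos (norm_nonneg u₀) s) (norm_le_size hε h0 hc hd hb hs.1.le)
      have h2 := mul_le_mul_of_nonneg_right (D.two_rate_le ‖u₀‖ hs.1.le)
        (norm_nonneg_wsq W.memLp_top (fun x => (W.pos x).le) (u s))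
      have h3 : wsq W.ρ1 (bandD k 1 (u s)) = wsq (bump x₀) (bandD k 1 (u s)) := rfl
      rw [h3] at h1
      linarith)
  have e1 : wsq W.ρ (u 0) ≤ wsq (step x₀) (u 0) + η * ‖u₀‖ ^ 2 := by
    have : wsq W.ρ (u 0) = _ := wsq_const_add (memLp_top_step x₀) η (u 0)
    rw [this, h0]
    have := norm_bandD_zero_le k u₀
    have : η * ‖bandD k 0 u₀‖ ^ 2 ≤ η * ‖u₀‖ ^ 2 := by gcongr
    linarith
  have e2 : wsq (step x₀) (u t) ≤ wsq W.ρ (u t) :=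
    wsq_mono (memLp_top_step x₀) W.memLp_top (fun x => le_add_of_nonneg_left hη.le) _
  have := mul_le_mul_of_nonneg_left e2 (Real.exp_nonneg (-D.growth ‖u₀‖ t))
  linarith

end Bounds

/-- A sequence of solutions of the regularized problems (truncated nonlinearity, fourth order
dissipation, frequencies cut off), with the uniform bounds they satisfy. The times are extended
to `t < 0` by constants. -/
structure Approximation (D : Coeffs) (u₀ : L2) where
  /-- the truncation level of the nonlinearity -/
  N : ℕ → ℕ
  /-- the dissipation coefficient -/
  ε : ℕ → ℝ
  /-- the frequency cut-off -/
  k : ℕ → ℝ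
  /-- the solutions -/
  u : ℕ → ℝ → L2
  /-- the lower bound of the weights -/
  η : ℕ → ℝ
  ε_pos : ∀ n, 0 < ε n
  k_pos : ∀ n, 0 < k n
  tendsto_N : Tendsto N atTop atTop
  η_le : ∀ n, η n ≤ 1
  tendsto_η : Tendsto η atTop (𝓝 0)
  tendsto_ε : Tendsto ε atTop (𝓝 0)
  tendsto_k : Tendsto k atTop atTop
  tendsto_div : Tendsto (fun n => (N n : ℝ) / k n) atTop (𝓝 0)
  init : ∀ n, u n 0 = bandD (k n) 0 u₀
  continuous : ∀ n, Continuous (u n)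
  hasDerivAt : ∀ n t, 0 < t → HasDerivAt (u n) (vf D (N n) (ε n) (k n) (u n t)) t
  band : ∀ n t, bandD (k n) 0 (u n t) = u n t
  norm_le : ∀ n t, 0 ≤ t → ‖u n t‖ ≤ D.size ‖u₀‖ t
  dissipation : ∀ n t, 0 ≤ t → ε n * ∫ s in (0 : ℝ)..t, ‖bandD (k n) 2 (u n s)‖ ^ 2 ≤ D.size ‖u₀‖ t ^ 2
  weighted : ∀ n x₀ t, 0 ≤ t → Real.exp (-D.growth ‖u₀‖ t) * wsq (step x₀) (u n t) + ∫ s in (0 : ℝ)..t,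
      Real.exp (-D.growth ‖u₀‖ s) * wsq (bump x₀) (bandD (k n) 1 (u n s)) ≤
        wsq (step x₀) (u n 0) + η n * ‖u₀‖ ^ 2

/-- The regularizations `N = n`, `ε = 1 / (n + 16)`, `η = 1 / (n + 1)` and a frequency cut-off of order
`n³`, so that the projection errors stay below the dissipation. -/
theorem exists_approximation (D : Coeffs) (u₀ : L2) : Nonempty (Approximation D u₀) := by
  set A : ℝ := 4 * (|D.lam| + D.δ) + 6 * |D.β| + 1 with hA
  have hδ := D.δ_nonneg
  have hA0 : 1 ≤ A := by
    have : 0 ≤ 4 * (|D.lam| + D.δ) + 6 * |D.β| := by positivity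
    linarith
  set ε : ℕ → ℝ := fun n => 1 / ((n : ℝ) + 16) with hεdef
  -- the frequency cut-off beats the truncation level divided by the dissipation
  set k : ℕ → ℝ := fun n => A * ((n : ℝ) + 16) ^ 3 with hkdef
  have hε0 : ∀ n, 0 < ε n := fun n => by positivity
  have hε1 : ∀ n, ε n ≤ 1 / 16 := fun n => by
    simp only [hεdef]; gcongr; simp
  have hk0 : ∀ n, 0 < k n := fun n => by positivity
  have hkη : ∀ n : ℕ, (2 * Real.pi * k n)⁻¹ * (4 * (|D.lam| * ((n : ℝ≥0) : ℝ) + D.δ) + 6 * |D.β| * ((n : ℝ≥0) : ℝ)) ≤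
      ε n * (1 / ((n : ℝ) + 1)) / 4 := by
    intro n
    have hn : (0 : ℝ) ≤ n := Nat.cast_nonneg n
    have h1 : 4 * (|D.lam| * ((n : ℝ≥0) : ℝ) + D.δ) + 6 * |D.β| * ((n : ℝ≥0) : ℝ) ≤ A * ((n : ℝ) + 16) := by
      have e : ((n : ℝ≥0) : ℝ) = n := by simp
      rw [e, hA]
      have := abs_nonneg D.lam
      have := abs_nonneg D.β
      nlinarith [mul_nonneg hδ hn]
    rw [inv_mul_le_iff₀ (by have := hk0 n; positivity)]
    refine h1.trans ?_
    have hpi : 2 ≤ Real.pi := Real.two_le_pi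
    have e : 2 * Real.pi * k n * (ε n * (1 / ((n : ℝ) + 1)) / 4) =
        (Real.pi / 2) * (A * ((n : ℝ) + 16)) * (((n : ℝ) + 16) / ((n : ℝ) + 1)) := by
      simp only [hεdef, hkdef]; field_simp; ring
    rw [e, mul_assoc]
    have h2 : 1 ≤ ((n : ℝ) + 16) / ((n : ℝ) + 1) := by
      rw [le_div_iff₀ (by positivity)]; linarith
    have h3 : 1 ≤ Real.pi / 2 := by linarith
    have h4 : 0 < A * ((n : ℝ) + 16) := by positivity
    calc A * ((n : ℝ) + 16) ≤ A * ((n : ℝ) + 16) * (((n : ℝ) + 16) / ((n : ℝ) + 1)) :=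
          le_mul_of_one_le_right h4.le h2
      _ ≤ _ := le_mul_of_one_le_left (by positivity) h3
  choose v hv0 hvd hvb using fun n : ℕ => exists_band_solution D n (ε n) (k n) u₀
  set u : ℕ → ℝ → L2 := fun n t => v n (max t 0) with hu
  have hinit : ∀ n, u n 0 = bandD (k n) 0 u₀ := fun n => by simp [hu, hv0]
  have hcont : ∀ n, Continuous (u n) := fun n => by
    refine ContinuousOn.comp_continuous (s := Ici 0) (fun t ht => (hvd n t ht).continuousAt.continuousWithinAt)
      (by fun_prop) fun t => le_max_right t 0
  have hderiv : ∀ n t, 0 < t → HasDerivAt (u n) (vf D n (ε n) (k n) (u n t)) t := fun n t ht => by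
    have e : u n =ᶠ[𝓝 t] v n := by
      filter_upwards [lt_mem_nhds ht] with s hs
      simp only [hu, max_eq_left hs.le]
    have e2 : u n t = v n t := e.self_of_nhds
    rw [e2]
    exact (hvd n t ht.le).congr_of_eventuallyEq e
  have hband : ∀ n t, bandD (k n) 0 (u n t) = u n t := fun n t => hvb n _ (le_max_right t 0)
  have hlin : Tendsto (fun n : ℕ => (n : ℝ) + 16) atTop atTop :=
    tendsto_atTop_add_const_right _ _ tendsto_natCast_atTop_atTop
  have tε : Tendsto ε atTop (𝓝 0) := by
    simp only [hεdef, one_div]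
    exact hlin.inv_tendsto_atTop
  have kge : ∀ n : ℕ, ((n : ℝ) + 16) * ((n : ℝ) + 16) ≤ k n := fun n => by
    have hn : (0 : ℝ) ≤ n := Nat.cast_nonneg n
    have h1 : ((n : ℝ) + 16) * ((n : ℝ) + 16) ≤ ((n : ℝ) + 16) ^ 3 := by
      nlinarith [sq_nonneg ((n : ℝ) + 16)]
    exact h1.trans (le_mul_of_one_le_left (by positivity) hA0)
  refine ⟨⟨id, ε, k, u, fun n => 1 / ((n : ℝ) + 1), hε0, hk0, tendsto_id,
    fun n => by rw [div_le_one (by positivity)]; linarith [Nat.cast_nonneg (α := ℝ) n],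
    tendsto_one_div_add_atTop_nhds_zero_nat, tε, ?_, ?_, hinit, hcont, hderiv, hband,
    fun n t ht => norm_le_size (hε0 n).le (hinit n) (hcont n) (hderiv n) (hband n) ht,
    fun n t ht => dissipation_bound (hε0 n).le (hinit n) (hcont n) (hderiv n) (hband n) ht,
    fun n x₀ t ht => weighted_bound (hε0 n).le (hε1 n) (hk0 n) (by positivity)
      (by rw [div_le_one (by positivity)]; linarith [Nat.cast_nonneg (α := ℝ) n])
      (hkη n) (hinit n) (hcont n) (hderiv n) (hband n) x₀ ht⟩⟩
  · refine tendsto_atTop_mono (fun n => ?_) hlin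
    have hn : (0 : ℝ) ≤ n := Nat.cast_nonneg n
    exact le_trans (by nlinarith) (kge n)
  · refine squeeze_zero (fun n => by have := hk0 n; positivity) (fun n => ?_) tε
    have hn : (0 : ℝ) ≤ n := Nat.cast_nonneg n
    simp only [hεdef, id]
    rw [div_le_div_iff₀ (hk0 n) (by positivity)]
    have := kge n
    nlinarith

/-! ### Weak convergence at every time -/

instance : Fact ((2 : ℝ≥0∞) ≠ ⊤) := ⟨ENNReal.ofNat_ne_top⟩

section WeakConvergence

variable {H : Type*} [NormedAddCommGroup H] [InnerProductSpace ℂ H]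

/-- Weak convergence of a sequence in a Hilbert space. -/
def WeakTendsto (v : ℕ → H) (w : H) : Prop :=
  ∀ ψ, Tendsto (fun n => inner ℂ ψ (v n)) atTop (𝓝 (inner ℂ ψ w))

/-- A sequence that is uniformly approximated by Cauchy sequences is Cauchy. -/
lemma cauchySeq_of_approx {f : ℕ → ℂ}
    (h : ∀ r : ℝ, 0 < r → ∃ g : ℕ → ℂ, CauchySeq g ∧ ∀ᶠ n in atTop, dist (f n) (g n) ≤ r) : CauchySeq f := by
  refine Metric.cauchySeq_iff.2 fun r hr => ?_
  obtain ⟨g, hg, hfg⟩ := h (r / 4) (by positivity)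
  obtain ⟨n₀, h₀⟩ := Metric.cauchySeq_iff.1 hg (r / 4) (by positivity)
  obtain ⟨n₁, h₁⟩ := eventually_atTop.1 hfg
  refine ⟨max n₀ n₁, fun m hm n hn => ?_⟩
  have e1 := h₁ m ((le_max_right _ _).trans hm)
  have e2 := h₁ n ((le_max_right _ _).trans hn)
  have e3 := h₀ m ((le_max_left _ _).trans hm) n ((le_max_left _ _).trans hn)
  have t1 := dist_triangle4 (f m) (g m) (g n) (f n)
  rw [dist_comm (g n)] at t1
  linarith

lemma WeakTendsto.comp {v : ℕ → H} {w : H} (h : WeakTendsto v w) {φ : ℕ → ℕ} (hφ : StrictMono φ) :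
    WeakTendsto (v ∘ φ) w := fun ψ => (h ψ).comp hφ.tendsto_atTop

lemma WeakTendsto.clm [CompleteSpace H] {v : ℕ → H} {w : H} (h : WeakTendsto v w) (A : H →L[ℂ] H) :
    WeakTendsto (fun n => A (v n)) (A w) := fun ψ => by
  simp only [← ContinuousLinearMap.adjoint_inner_left]
  exact h _

lemma WeakTendsto.sub {v v' : ℕ → H} {w w' : H} (h : WeakTendsto v w) (h' : WeakTendsto v' w') :
    WeakTendsto (fun n => v n - v' n) (w - w') := fun ψ => by
  simp only [inner_sub_right]
  exact (h ψ).sub (h' ψ)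

lemma weakTendsto_of_tendsto {v : ℕ → H} {w : H} (h : Tendsto v atTop (𝓝 w)) : WeakTendsto v w :=
  fun _ => tendsto_const_nhds.inner h

/-- Weak lower semicontinuity of the norm. -/
lemma WeakTendsto.eventually_lt {v : ℕ → H} {w : H} (h : WeakTendsto v w) {r : ℝ} (hr : r < ‖w‖) :
    ∀ᶠ n in atTop, r < ‖v n‖ := by
  by_cases hr0 : r < 0
  · exact Eventually.of_forall fun n => hr0.trans_le (norm_nonneg _)
  push Not at hr0
  have hw : 0 < ‖w‖ := hr0.trans_lt hr
  have h1 := (h w).norm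
  rw [inner_self_eq_norm_sq_to_K, norm_pow, RCLike.norm_ofReal, abs_norm] at h1
  have h2 := h1.eventually (lt_mem_nhds (show r * ‖w‖ < ‖w‖ ^ 2 by nlinarith))
  filter_upwards [h2] with n hn
  have h3 := norm_inner_le_norm (𝕜 := ℂ) w (v n)
  by_contra! hc
  nlinarith

lemma WeakTendsto.norm_le {v : ℕ → H} {w : H} (h : WeakTendsto v w) {C : ℝ} (hC : ∀ᶠ n in atTop, ‖v n‖ ≤ C) :
    ‖w‖ ≤ C := by
  by_contra! hc
  obtain ⟨n, h1, h2⟩ := ((h.eventually_lt hc).and hC).exists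
  linarith

variable [CompleteSpace H]

/-- Weak sequential completeness, by the Banach–Steinhaus theorem and the Riesz representation. -/
lemma exists_weakTendsto {v : ℕ → H} (h : ∀ ψ, CauchySeq fun n => inner ℂ ψ (v n)) :
    ∃ w, WeakTendsto v w := by
  choose f hf using fun ψ => cauchySeq_tendsto_of_complete (h ψ)
  have h1 : Tendsto (fun n ψ => innerSL ℂ (v n) ψ) atTop (𝓝 fun ψ => starRingEnd ℂ (f ψ)) :=
    tendsto_pi_nhds.2 fun ψ => by
      have := (Complex.continuous_conj.tendsto _).comp (hf ψ)
      refine this.congr fun n => ?_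
      simp [inner_conj_symm]
  set L := continuousLinearMapOfTendsto (fun n => innerSL ℂ (v n)) h1 with hL
  refine ⟨(InnerProductSpace.toDual ℂ H).symm L, fun ψ => ?_⟩
  have e : inner ℂ ψ ((InnerProductSpace.toDual ℂ H).symm L) = f ψ := by
    rw [← inner_conj_symm, InnerProductSpace.toDual_symm_apply]
    have : L ψ = starRingEnd ℂ (f ψ) := rfl
    rw [this, Complex.conj_conj]
  rw [e]
  exact hf ψ

/-- Countably many bounded sequences in a separable Hilbert space have a common subsequence along
which they all converge weakly. -/
lemma exists_weak_subseq [TopologicalSpace.SeparableSpace H] {ι : Type*} [Countable ι] (v : ι → ℕ → H)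
    (C : ι → ℝ) (hC : ∀ i n, ‖v i n‖ ≤ C i) :
    ∃ φ : ℕ → ℕ, StrictMono φ ∧ ∀ i, ∃ w, WeakTendsto (v i ∘ φ) w := by
  set e := TopologicalSpace.denseSeq H with he
  have hcomp : IsCompact (Set.univ.pi fun p : ι × ℕ => Metric.closedBall (0 : ℂ) (‖e p.2‖ * C p.1)) :=
    isCompact_univ_pi fun p => isCompact_closedBall _ _
  obtain ⟨a, -, φ, hφ, ha⟩ := hcomp.tendsto_subseq
    (x := fun n => fun p : ι × ℕ => inner ℂ (e p.2) (v p.1 n)) fun n => by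
      rw [Set.mem_univ_pi]
      intro p
      rw [mem_closedBall_zero_iff]
      exact (norm_inner_le_norm _ _).trans (by gcongr; exact hC _ _)
  refine ⟨φ, hφ, fun i => exists_weakTendsto fun ψ => cauchySeq_of_approx fun r hr => ?_⟩
  have hC1 : 0 ≤ C i := (norm_nonneg _).trans (hC i 0)
  obtain ⟨j, hj⟩ := (TopologicalSpace.denseRange_denseSeq H).exists_dist_lt ψ
    (show 0 < r / (C i + 1) by positivity)
  refine ⟨fun n => inner ℂ (e j) (v i (φ n)), ((tendsto_pi_nhds.1 ha) (i, j)).cauchySeq,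
    Eventually.of_forall fun n => ?_⟩
  rw [dist_eq_norm, Function.comp, ← inner_sub_left]
  rw [dist_eq_norm] at hj
  calc _ ≤ ‖ψ - e j‖ * ‖v i (φ n)‖ := norm_inner_le_norm _ _
    _ ≤ (r / (C i + 1)) * C i := by gcongr; exact hC _ _
    _ ≤ r := by
      rw [div_mul_eq_mul_div, div_le_iff₀ (by positivity)]
      nlinarith

end WeakConvergence

section Equicontinuity

lemma IsWeakDeriv.bandD_self (K : ℝ) (j : ℕ) (ψ : L2) : IsWeakDeriv (bandD K j ψ) (bandD K (j + 1) ψ) :=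
  isWeakDeriv_of_hasDerivAt (bandD_ae_eq_wave K j ψ) (bandD_ae_eq_wave K (j + 1) ψ)
    (fun x => hasDerivAt_wave K j ψ x) (continuous_wave K (j + 1) ψ)

lemma bandD_bandD_zero (k K : ℝ) (j i : ℕ) (ψ : L2) :
    bandD k j (bandD K i ψ) = bandD k 0 (bandD K (i + j) ψ) := by
  induction j generalizing i with
  | zero => rfl
  | succ j ih => rw [(IsWeakDeriv.bandD_self K i ψ).bandD_succ, ih, add_right_comm, add_assoc]

/-- Derivatives move to the band-limited test function. -/
lemma norm_inner_bandD_le (k K : ℝ) (j : ℕ) (ψ v : L2) :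
    ‖inner ℂ (bandD K 0 ψ) (bandD k j v)‖ ≤ ‖bandD K j ψ‖ * ‖v‖ := by
  have h : inner ℂ (bandD K 0 ψ) (bandD k j v) = (-1) ^ j * inner ℂ (bandD k j (bandD K 0 ψ)) v := by
    rw [inner_bandD k j (bandD K 0 ψ) v, ← mul_assoc, ← mul_pow]; simp
  rw [h, norm_mul, norm_pow, norm_neg, norm_one, one_pow, one_mul, bandD_bandD_zero, zero_add]
  refine (norm_inner_le_norm _ _).trans ?_
  have := norm_bandD_zero_le k (bandD K j ψ)
  gcongr

lemma norm_inner_truncOp_le (N : ℝ≥0) {ψ : L2} {B : ℝ} (hB : ∀ᵐ x, ‖ψ x‖ ≤ B) (u : L2) :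
    ‖inner ℂ ψ (truncOp N u)‖ ≤ B * ‖u‖ ^ 2 := by
  have hB0 : 0 ≤ B := by
    obtain ⟨x, hx⟩ := hB.exists
    exact (norm_nonneg _).trans hx
  rw [inner_eq_integral_of_ae (Filter.EventuallyEq.refl _ _) (truncOp_coe N u),
    norm_sq_eq_integral (Filter.EventuallyEq.refl _ _), ← integral_const_mul]
  refine norm_integral_le_of_norm_le ((Lp.memLp u).norm.integrable_sq.const_mul B) ?_
  filter_upwards [hB] with x hx
  rw [norm_mul, RCLike.norm_conj, norm_trunc]
  have : min ‖u x‖ N * ‖u x‖ ≤ ‖u x‖ ^ 2 := by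
    rw [sq]; exact mul_le_mul_of_nonneg_right (min_le_left _ _) (norm_nonneg _)
  exact mul_le_mul hx this (by positivity) hB0

/-- Against a band-limited function, the right-hand side of the regularized equation is bounded
uniformly in the regularization. -/
lemma norm_inner_vf_le (D : Coeffs) (K : ℝ) (ψ : L2) {M : ℝ} :
    ∃ L : ℝ, ∀ (N : ℝ≥0) (ε k : ℝ) (u : L2), 0 ≤ ε → ε ≤ 1 → K ≤ k → ‖u‖ ≤ M →
      ‖inner ℂ (bandD K 0 ψ) (vf D N ε k u)‖ ≤ L := by
  refine ⟨(‖bandD K 3 ψ‖ + |D.a| * ‖bandD K 2 ψ‖ + |D.b| * ‖bandD K 1 ψ‖ + ‖bandD K 4 ψ‖) * M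
    + (|D.lam| * (symbNorm K 0 * ‖ψ‖ * M ^ 2) + ‖bandD K 0 ψ‖ * (D.δ * M))
    + |D.β| * (symbNorm K 1 * ‖ψ‖ * M ^ 2), fun N ε k u hε hε1 hk hu => ?_⟩
  have hM : 0 ≤ M := (norm_nonneg _).trans hu
  have hsb : ∀ j, ∀ᵐ x, ‖bandD K j ψ x‖ ≤ symbNorm K j * ‖ψ‖ := fun j => by
    filter_upwards [bandD_ae_eq_wave K j ψ] with x hx
    rw [hx]; exact norm_wave_le K j ψ x
  have hs0 : ∀ j, 0 ≤ symbNorm K j * ‖ψ‖ := fun j => by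
    obtain ⟨x, hx⟩ := (hsb j).exists
    exact (norm_nonneg _).trans hx
  have hl : ‖inner ℂ (bandD K 0 ψ) (linOp D ε k u)‖ ≤
      (‖bandD K 3 ψ‖ + |D.a| * ‖bandD K 2 ψ‖ + |D.b| * ‖bandD K 1 ψ‖ + ‖bandD K 4 ψ‖) * M := by
    have e : linOp D ε k u = -(bandD k 3 u) + (Complex.I * D.a) • bandD k 2 u - (D.b : ℂ) • bandD k 1 u
        - (ε : ℂ) • bandD k 4 u := by
      simp only [linOp, add_apply, sub_apply, smul_apply, neg_apply]
    rw [e, inner_sub_right, inner_sub_right, inner_add_right, inner_neg_right, inner_smul_right,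
      inner_smul_right, inner_smul_right]
    have h3 := norm_inner_bandD_le k K 3 ψ u
    have h2 := norm_inner_bandD_le k K 2 ψ u
    have h1 := norm_inner_bandD_le k K 1 ψ u
    have h4 := norm_inner_bandD_le k K 4 ψ u
    refine (norm_sub_le _ _).trans ((add_le_add_left ((norm_sub_le _ _).trans
      (add_le_add_left (norm_add_le _ _) _)) _).trans ?_)
    rw [norm_neg, norm_mul, norm_mul, norm_mul, norm_mul, Complex.norm_I, one_mul, Complex.norm_real,
      Complex.norm_real, Complex.norm_real, Real.norm_eq_abs, Real.norm_eq_abs, Real.norm_eq_abs,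
      abs_of_nonneg hε, add_mul, add_mul, add_mul, mul_assoc, mul_assoc]
    have k4 : ε * ‖inner ℂ (bandD K 0 ψ) (bandD k 4 u)‖ ≤ ‖bandD K 4 ψ‖ * M := by
      calc _ ≤ 1 * (‖bandD K 4 ψ‖ * ‖u‖) := mul_le_mul hε1 h4 (norm_nonneg _) zero_le_one
        _ ≤ _ := by rw [one_mul]; gcongr
    gcongr
    · exact h3.trans (by gcongr)
    · exact h2.trans (by gcongr)
    · exact h1.trans (by gcongr)
  have ht0 : ‖inner ℂ (bandD K 0 ψ) (truncOp N u)‖ ≤ symbNorm K 0 * ‖ψ‖ * M ^ 2 :=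
    (norm_inner_truncOp_le N (hsb 0) u).trans (by have := hs0 0; gcongr)
  have ht1 : ‖inner ℂ (bandD K 1 ψ) (truncOp N u)‖ ≤ symbNorm K 1 * ‖ψ‖ * M ^ 2 :=
    (norm_inner_truncOp_le N (hsb 1) u).trans (by have := hs0 1; gcongr)
  have hs : ‖inner ℂ (bandD K 0 ψ) (bandD k 0 (sourceOp D N u))‖ ≤
      |D.lam| * (symbNorm K 0 * ‖ψ‖ * M ^ 2) + ‖bandD K 0 ψ‖ * (D.δ * M) := by
    rw [← inner_bandD_zero, bandD_zero_bandD hk, sourceOp, inner_sub_right, inner_smul_right]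
    refine (norm_sub_le _ _).trans ?_
    rw [norm_mul, norm_mul, Complex.norm_I, one_mul, Complex.norm_real, Real.norm_eq_abs]
    refine add_le_add (by gcongr) ((norm_inner_le_norm _ _).trans ?_)
    refine mul_le_mul_of_nonneg_left ((norm_mulOp_le D.δ_nonneg D.abs_d_le u).trans ?_) (norm_nonneg _)
    exact mul_le_mul_of_nonneg_left hu D.δ_nonneg
  have hβ : ‖(D.β : ℂ) * inner ℂ (bandD K 0 ψ) (bandD k 1 (truncOp N u))‖ ≤
      |D.β| * (symbNorm K 1 * ‖ψ‖ * M ^ 2) := by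
    have h : inner ℂ (bandD K 0 ψ) (bandD k 1 (truncOp N u)) = - inner ℂ (bandD K 1 ψ) (truncOp N u) := by
      have := inner_bandD k 1 (bandD K 0 ψ) (truncOp N u)
      rw [bandD_bandD_zero, zero_add, bandD_zero_bandD hk, pow_one, neg_one_mul] at this
      rw [this, neg_neg]
    rw [h, norm_mul, norm_neg, Complex.norm_real, Real.norm_eq_abs]
    gcongr
  rw [vf, inner_sub_right, inner_add_right, inner_smul_right]
  exact (norm_sub_le _ _).trans (add_le_add ((norm_add_le _ _).trans (add_le_add hl hs)) hβ)

end Equicontinuity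

namespace Approximation

variable {D : Coeffs} {u₀ : L2}

/-- A subsequence of an approximating sequence. -/
def subseq (A : Approximation D u₀) (φ : ℕ → ℕ) (hφ : StrictMono φ) : Approximation D u₀ where
  N := A.N ∘ φ
  ε := A.ε ∘ φ
  k := A.k ∘ φ
  u := A.u ∘ φ
  η := A.η ∘ φ
  ε_pos := fun _ => A.ε_pos _
  k_pos := fun _ => A.k_pos _
  tendsto_N := A.tendsto_N.comp hφ.tendsto_atTop
  η_le := fun _ => A.η_le _
  tendsto_η := A.tendsto_η.comp hφ.tendsto_atTop
  tendsto_ε := A.tendsto_ε.comp hφ.tendsto_atTop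
  tendsto_k := A.tendsto_k.comp hφ.tendsto_atTop
  tendsto_div := A.tendsto_div.comp hφ.tendsto_atTop
  init := fun _ => A.init _
  continuous := fun _ => A.continuous _
  hasDerivAt := fun _ => A.hasDerivAt _
  band := fun _ => A.band _
  norm_le := fun _ => A.norm_le _
  dissipation := fun _ => A.dissipation _
  weighted := fun _ => A.weighted _

lemma norm_le' (A : Approximation D u₀) {n : ℕ} {s T : ℝ} (hs : 0 ≤ s) (hsT : s ≤ T) :
    ‖A.u n s‖ ≤ D.size ‖u₀‖ T := (A.norm_le n s hs).trans (D.size_mono (norm_nonneg _) hsT)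

/-- The approximations are equicontinuous in time when tested against band-limited functions. -/
lemma exists_lipschitz (A : Approximation D u₀) (K : ℝ) (ψ : L2) (T : ℝ) :
    ∃ L : ℝ, 0 ≤ L ∧ ∀ᶠ n in atTop, ∀ s t, 0 ≤ s → s ≤ t → t ≤ T →
      ‖inner ℂ (bandD K 0 ψ) (A.u n t) - inner ℂ (bandD K 0 ψ) (A.u n s)‖ ≤ L * (t - s) := by
  obtain ⟨L, hL⟩ := norm_inner_vf_le D K ψ (M := D.size ‖u₀‖ T)
  refine ⟨max L 0, le_max_right _ _, ?_⟩
  filter_upwards [A.tendsto_ε.eventually (gt_mem_nhds one_pos), A.tendsto_k.eventually_ge_atTop K] with n h1 h2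
  have hc : Continuous fun r => inner ℂ (bandD K 0 ψ) (A.u n r) := continuous_const.inner (A.continuous n)
  have pos : ∀ s t, 0 < s → s ≤ t → t ≤ T →
      ‖inner ℂ (bandD K 0 ψ) (A.u n t) - inner ℂ (bandD K 0 ψ) (A.u n s)‖ ≤ max L 0 * (t - s) := by
    intro s t hs hst htT
    refine norm_image_sub_le_of_norm_deriv_right_le_segment (a := s) (b := t)
      (f := fun r => inner ℂ (bandD K 0 ψ) (A.u n r))
      (f' := fun r => inner ℂ (bandD K 0 ψ) (vf D (A.N n) (A.ε n) (A.k n) (A.u n r)))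
      hc.continuousOn (fun r hr => ?_) (fun r hr => ?_) t (right_mem_Icc.2 hst)
    · have h := ((innerSL ℂ (bandD K 0 ψ)).restrictScalars ℝ).hasFDerivAt.comp_hasDerivAt r
        (A.hasDerivAt n r (hs.trans_le hr.1))
      exact h.hasDerivWithinAt
    · exact (hL _ _ _ _ (A.ε_pos n).le h1.le h2 (A.norm_le' (hs.le.trans hr.1) (hr.2.le.trans htT))).trans
        (le_max_left _ _)
  intro s t hs hst htT
  rcases hst.eq_or_lt with rfl | hst
  · simp
  refine le_of_tendsto_of_tendsto (b := 𝓝[>] s)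
    ((continuous_const.sub hc).norm.continuousWithinAt)
    ((continuous_const.mul (continuous_const.sub continuous_id)).continuousWithinAt) ?_
  filter_upwards [Ioo_mem_nhdsGT hst] with r hr
  exact pos r t (hs.trans_lt hr.1) hr.2.le htT

/-- Along a subsequence the approximations converge weakly at every time: at rational times by
compactness, and at the others by equicontinuity against the dense set of band-limited functions. -/
lemma exists_weak_limit (A : Approximation D u₀) :
    ∃ (B : Approximation D u₀) (u : ℝ → L2), ∀ t, 0 ≤ t → WeakTendsto (fun n => B.u n t) (u t) := by
  obtain ⟨φ, hφ, hw⟩ := exists_weak_subseq (ι := {q : ℚ // 0 ≤ q}) (fun q n => A.u n (q : ℚ))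
    (fun q => D.size ‖u₀‖ (q : ℚ)) fun q n => A.norm_le n _ (by exact_mod_cast q.2)
  set B := A.subseq φ hφ with hB
  have hq : ∀ q : ℚ, 0 ≤ q → ∀ ψ, CauchySeq fun n => inner ℂ ψ (B.u n q) := fun q hq ψ => by
    obtain ⟨w, hw⟩ := hw ⟨q, hq⟩
    exact (hw ψ).cauchySeq
  have key : ∀ t : ℝ, 0 ≤ t → ∃ w, WeakTendsto (fun n => B.u n t) w := by
    intro t ht
    have band : ∀ K ψ, CauchySeq fun n => inner ℂ (bandD K 0 ψ) (B.u n t) := by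
      intro K ψ
      obtain ⟨L, hL0, hL⟩ := B.exists_lipschitz K ψ (t + 1)
      refine cauchySeq_of_approx fun r hr => ?_
      obtain ⟨q, hq1, hq2⟩ := exists_rat_btwn (show t < min (t + 1) (t + r / (L + 1)) by
        rw [lt_min_iff]; constructor
        · linarith
        · have : 0 < r / (L + 1) := by positivity
          linarith)
      have hq0 : (0 : ℚ) ≤ q := by exact_mod_cast ht.trans hq1.le
      refine ⟨_, hq q hq0 (bandD K 0 ψ), ?_⟩
      filter_upwards [hL] with n hn
      rw [dist_comm, dist_eq_norm]
      refine (hn t q ht hq1.le (hq2.le.trans (min_le_left _ _))).trans ?_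
      have h1 : (q : ℝ) - t ≤ r / (L + 1) := by linarith [hq2.le.trans (min_le_right _ _)]
      calc L * (q - t) ≤ L * (r / (L + 1)) := by gcongr
        _ ≤ r := by
          rw [mul_div_assoc', div_le_iff₀ (by positivity)]
          nlinarith
    refine exists_weakTendsto fun ψ => cauchySeq_of_approx fun r hr => ?_
    have hM := D.size_pos (norm_nonneg u₀) t
    obtain ⟨K, hK⟩ := ((tendsto_bandD_zero ψ).eventually (Metric.ball_mem_nhds ψ
      (show 0 < r / D.size ‖u₀‖ t by positivity))).exists
    refine ⟨_, band K ψ, Eventually.of_forall fun n => ?_⟩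
    rw [dist_comm, dist_eq_norm] at hK
    rw [dist_eq_norm, ← inner_sub_left]
    calc _ ≤ ‖ψ - bandD K 0 ψ‖ * ‖B.u n t‖ := norm_inner_le_norm _ _
      _ ≤ (r / D.size ‖u₀‖ t) * D.size ‖u₀‖ t := by
        gcongr
        exact B.norm_le n t ht
      _ = r := by field_simp
  choose! u hu using key
  exact ⟨B, u, hu⟩

end Approximation

/-! ### Compactness on bounded sets -/

section Poincare

/-- The Cauchy–Schwarz inequality on an interval, from the variance of `g` being non-negative. -/
lemma sq_integral_le {g : ℝ → ℝ} (hg : Continuous g) {a b : ℝ} (hab : a < b) :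
    (∫ x in a..b, g x) ^ 2 ≤ (b - a) * ∫ x in a..b, g x ^ 2 := by
  have h0 : 0 < b - a := sub_pos.2 hab
  set S := ∫ x in a..b, g x with hS
  have h1 : 0 ≤ ∫ x in a..b, (g x - S / (b - a)) ^ 2 :=
    intervalIntegral.integral_nonneg hab.le fun x _ => sq_nonneg _
  have e : ∀ x, (g x - S / (b - a)) ^ 2 = g x ^ 2 - 2 * (S / (b - a)) * g x + (S / (b - a)) ^ 2 := fun x => by ring
  simp only [e] at h1
  rw [intervalIntegral.integral_add (by apply Continuous.intervalIntegrable; fun_prop)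
      (by apply Continuous.intervalIntegrable; fun_prop),
    intervalIntegral.integral_sub (by apply Continuous.intervalIntegrable; fun_prop)
      (by apply Continuous.intervalIntegrable; fun_prop),
    intervalIntegral.integral_const_mul, intervalIntegral.integral_const, ← hS, smul_eq_mul] at h1
  have e2 : (b - a) * (∫ x in a..b, g x ^ 2 - 0) = 0 + (b - a) * ∫ x in a..b, g x ^ 2 := by simp
  have h2 := mul_nonneg h0.le h1
  have e3 : (b - a) * ((∫ x in a..b, g x ^ 2) - 2 * (S / (b - a)) * S + (b - a) * (S / (b - a)) ^ 2) =
      (b - a) * (∫ x in a..b, g x ^ 2) - S ^ 2 := by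
    field_simp; ring
  linarith

/-- Poincaré's inequality on an interval, with the mean value kept on the right-hand side. -/
lemma poincare_interval {f f' : ℝ → ℂ} (hf : ∀ x, HasDerivAt f (f' x) x) (hf' : Continuous f') {a b : ℝ}
    (hab : a < b) : ∫ x in a..b, ‖f x‖ ^ 2 ≤
      2 / (b - a) * ‖∫ x in a..b, f x‖ ^ 2 + 2 * (b - a) ^ 2 * ∫ x in a..b, ‖f' x‖ ^ 2 := by
  have h0 : 0 < b - a := sub_pos.2 hab
  have hfc : Continuous f := continuous_iff_continuousAt.2 fun x => (hf x).continuousAt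
  set S := ∫ x in a..b, ‖f' x‖ with hS
  have hS0 : 0 ≤ S := intervalIntegral.integral_nonneg hab.le fun x _ => norm_nonneg _
  have osc : ∀ y ∈ Icc a b, ∀ z ∈ Icc a b, ‖f y - f z‖ ≤ S := by
    intro y hy z hz
    rw [← intervalIntegral.integral_eq_sub_of_hasDerivAt (fun x _ => hf x) (hf'.intervalIntegrable z y)]
    refine intervalIntegral.norm_integral_le_abs_integral_norm.trans ?_
    rw [intervalIntegral.abs_intervalIntegral_eq]
    rw [abs_of_nonneg (integral_nonneg fun x => norm_nonneg _), hS, intervalIntegral.integral_of_le hab.le]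
    refine setIntegral_mono_set ((hf'.norm.intervalIntegrable a b).1) (Eventually.of_forall fun x => norm_nonneg _)
      (LE.le.eventuallyLE ?_)
    rw [uIoc]
    exact Ioc_subset_Ioc (le_min hz.1 hy.1) (max_le hz.2 hy.2)
  set c := ∫ x in a..b, f x with hc
  have hmean : ∀ y ∈ Icc a b, ‖(b - a) • f y - c‖ ≤ (b - a) * S := by
    intro y hy
    rw [hc, ← intervalIntegral.integral_const, ← intervalIntegral.integral_sub
      (by apply Continuous.intervalIntegrable; fun_prop) (by apply Continuous.intervalIntegrable; fun_prop)]
    have := intervalIntegral.norm_integral_le_of_norm_le_const (a := a) (b := b) (f := fun x => f y - f x) (C := S)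
      fun x hx => osc y hy x (by rw [uIoc_of_le hab.le] at hx; exact ⟨hx.1.le, hx.2⟩)
    rwa [abs_of_pos h0, mul_comm] at this
  have hpt : ∀ y ∈ Icc a b, ‖f y‖ ^ 2 ≤ 2 * (‖c‖ / (b - a)) ^ 2 + 2 * S ^ 2 := by
    intro y hy
    have h1 : (b - a) * ‖f y‖ ≤ ‖c‖ + (b - a) * S := by
      have h2 := norm_sub_norm_le ((b - a) • f y) c
      rw [norm_smul, Real.norm_eq_abs, abs_of_pos h0] at h2
      linarith [hmean y hy]
    have h3 : ‖f y‖ ≤ ‖c‖ / (b - a) + S := by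
      rw [← sub_le_iff_le_add, le_div_iff₀ h0]; linarith
    have h4 : 0 ≤ ‖c‖ / (b - a) := by positivity
    nlinarith [norm_nonneg (f y), sq_nonneg (‖c‖ / (b - a) - S)]
  have h1 : ∫ x in a..b, ‖f x‖ ^ 2 ≤ ∫ x in a..b, (2 * (‖c‖ / (b - a)) ^ 2 + 2 * S ^ 2) :=
    intervalIntegral.integral_mono_on hab.le (by apply Continuous.intervalIntegrable; fun_prop)
      intervalIntegrable_const hpt
  rw [intervalIntegral.integral_const, smul_eq_mul] at h1
  have h2 := mul_le_mul_of_nonneg_left (sq_integral_le hf'.norm hab) h0.le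
  have e : (b - a) * (2 * (‖c‖ / (b - a)) ^ 2 + 2 * S ^ 2) = 2 / (b - a) * ‖c‖ ^ 2 + 2 * ((b - a) * S ^ 2) := by
    field_simp
  rw [e] at h1
  rw [← hS] at h2
  calc _ ≤ _ := h1
    _ ≤ 2 / (b - a) * ‖c‖ ^ 2 + 2 * ((b - a) * ((b - a) * ∫ x in a..b, ‖f' x‖ ^ 2)) := by gcongr
    _ = _ := by ring

/-- Poincaré's inequality on each of `p` cells of length `h` which divide `(-R, R)`. -/
lemma poincare_cells {f f' : ℝ → ℂ} (hf : ∀ x, HasDerivAt f (f' x) x) (hf' : Continuous f') (R h : ℝ) (hh : 0 < h)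
    (p : ℕ) (hp : -R + p * h = R) :
    ∫ x in (-R)..R, ‖f x‖ ^ 2 ≤
      ∑ i ∈ Finset.range p, 2 / h * ‖∫ x in (-R + i * h)..(-R + (i + 1 : ℕ) * h), f x‖ ^ 2
        + 2 * h ^ 2 * ∫ x in (-R)..R, ‖f' x‖ ^ 2 := by
  have hfc : Continuous f := continuous_iff_continuousAt.2 fun x => (hf x).continuousAt
  have s1 := intervalIntegral.sum_integral_adjacent_intervals (μ := volume) (f := fun x => ‖f x‖ ^ 2)
    (a := fun i : ℕ => -R + i * h) (n := p) fun i _ => by apply Continuous.intervalIntegrable; fun_prop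
  have s2 := intervalIntegral.sum_integral_adjacent_intervals (μ := volume) (f := fun x => ‖f' x‖ ^ 2)
    (a := fun i : ℕ => -R + i * h) (n := p) fun i _ => by apply Continuous.intervalIntegrable; fun_prop
  simp only [hp, Nat.cast_zero, zero_mul, add_zero] at s1 s2
  rw [← s1, ← s2, Finset.mul_sum, ← Finset.sum_add_distrib]
  refine Finset.sum_le_sum fun i _ => ?_
  have := poincare_interval hf hf' (a := -R + i * h) (b := -R + (i + 1 : ℕ) * h) (by push_cast; nlinarith)
  have e : -R + (i + 1 : ℕ) * h - (-R + i * h) = h := by push_cast; ring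
  rwa [e] at this

end Poincare

section Cut

/-- Restriction of an `L_2` function to `(-R, R]`. -/
noncomputable def cut (R : ℝ) : L2 →L[ℂ] L2 := mulOp ((Ioc (-R) R).indicator 1)

lemma memLp_top_cut (R : ℝ) : MemLp ((Ioc (-R) R).indicator (1 : ℝ → ℂ)) ⊤ volume :=
  (memLp_top_const (1 : ℂ)).indicator measurableSet_Ioc

lemma cut_coe (R : ℝ) (v : L2) : cut R v =ᵐ[volume] (Ioc (-R) R).indicator v := by
  filter_upwards [mulOp_coe (memLp_top_cut R) v] with x hx
  rw [cut, hx]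
  by_cases h : x ∈ Ioc (-R) R <;> simp [h]

lemma norm_cut_sq {R : ℝ} {v : L2} {V : ℝ → ℂ} (h : v =ᵐ[volume] V) :
    ‖cut R v‖ ^ 2 = ∫ x in Ioc (-R) R, ‖V x‖ ^ 2 := by
  have h1 : cut R v =ᵐ[volume] (Ioc (-R) R).indicator V := by
    filter_upwards [cut_coe R v, h] with x h1 h2
    rw [h1]; by_cases hx : x ∈ Ioc (-R) R <;> simp [hx, h2]
  rw [norm_sq_eq_integral h1, ← integral_indicator measurableSet_Ioc]
  congr 1
  funext x
  by_cases hx : x ∈ Ioc (-R) R <;> simp [hx]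

lemma norm_cut_sq' {R : ℝ} (hR : 0 ≤ R) {v : L2} {V : ℝ → ℂ} (h : v =ᵐ[volume] V) :
    ‖cut R v‖ ^ 2 = ∫ x in (-R)..R, ‖V x‖ ^ 2 := by
  rw [norm_cut_sq h, intervalIntegral.integral_of_le (by linarith)]

lemma norm_cut_mono {R R' : ℝ} (h : R ≤ R') (v : L2) : ‖cut R v‖ ≤ ‖cut R' v‖ := by
  refine le_of_sq_le_sq ?_ (norm_nonneg _)
  rw [norm_cut_sq (Filter.EventuallyEq.refl _ _), norm_cut_sq (Filter.EventuallyEq.refl _ _)]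
  exact setIntegral_mono_set (Lp.memLp v).norm.integrable_sq.integrableOn
    (Eventually.of_forall fun x => sq_nonneg _)
    (LE.le.eventuallyLE (Ioc_subset_Ioc (by linarith) h))

lemma exists_cut_le_wsq_bump (R : ℝ) : ∃ c : ℝ, 0 < c ∧ ∀ v : L2, c * ‖cut R v‖ ^ 2 ≤ wsq (bump 0) v := by
  obtain ⟨c, hc, hcb⟩ : ∃ c : ℝ, 0 < c ∧ ∀ x ∈ Icc (-R) R, c ≤ bump 0 x := by
    rcases (Icc (-R) R).eq_empty_or_nonempty with h | h
    · exact ⟨1, one_pos, by simp [h]⟩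
    · obtain ⟨x, -, hx⟩ := isCompact_Icc.exists_isMinOn h (continuous_bump 0).continuousOn
      exact ⟨bump 0 x, bump_pos 0 x, hx⟩
  refine ⟨c, hc, fun v => ?_⟩
  have hsq : Integrable (fun x => ‖v x‖ ^ 2) volume := (Lp.memLp v).norm.integrable_sq
  have e : ∀ x, ‖v x‖ ^ 2 = (v x).re ^ 2 + (v x).im ^ 2 := fun x => by
    rw [← Complex.normSq_eq_norm_sq, Complex.normSq_apply]; ring
  rw [norm_cut_sq (Filter.EventuallyEq.refl _ _), wsq_eq (memLp_top_bump 0) (Filter.EventuallyEq.refl _ _),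
    ← integral_const_mul]
  simp only [← e]
  have hi : Integrable (fun x => bump 0 x * ‖v x‖ ^ 2) volume :=
    hsq.bdd_mul (c := 1 / 4) (continuous_bump 0).aestronglyMeasurable (Eventually.of_forall fun x => by
      rw [Real.norm_eq_abs, abs_of_pos (bump_pos _ _)]; exact bump_le_quarter _ _)
  refine (setIntegral_mono_on (hsq.const_mul c).integrableOn hi.integrableOn measurableSet_Ioc fun x hx => ?_).trans
    (setIntegral_le_integral hi (Eventually.of_forall fun x => mul_nonneg (bump_pos _ _).le (by positivity)))
  exact mul_le_mul_of_nonneg_right (hcb x ⟨hx.1.le, hx.2⟩) (by positivity)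

end Cut

namespace Approximation

variable {D : Coeffs} {u₀ : L2}

lemma wsq_step_le (x₀ : ℝ) (v : L2) : wsq (step x₀) v ≤ ‖v‖ ^ 2 := by
  have h : MemLp (fun _ : ℝ => ((1 : ℝ) : ℂ)) ⊤ volume := memLp_top_const _
  have := wsq_mono (memLp_top_step x₀) h (fun x => (step_lt_one x₀ x).le) v
  rwa [wsq_const_mul, one_mul] at this

/-- The space derivatives are bounded in `L_2` on bounded sets, uniformly in the regularization. -/
lemma exists_local_bound (A : Approximation D u₀) {T : ℝ} (hT : 0 ≤ T) (R : ℝ) :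
    ∃ C, 0 ≤ C ∧ ∀ n, ∫ s in (0 : ℝ)..T, ‖cut R (bandD (A.k n) 1 (A.u n s))‖ ^ 2 ≤ C := by
  obtain ⟨c, hc, hcb⟩ := exists_cut_le_wsq_bump R
  have hcont : Continuous fun s => Real.exp (-D.growth ‖u₀‖ s) :=
    Real.continuous_exp.comp (D.continuous_growth _).neg
  obtain ⟨s₀, -, hs₀⟩ := (isCompact_Icc (a := (0 : ℝ)) (b := T)).exists_isMinOn (nonempty_Icc.2 hT)
    hcont.continuousOn
  set g := Real.exp (-D.growth ‖u₀‖ s₀) with hg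
  have hg0 : 0 < g := Real.exp_pos _
  refine ⟨2 * ‖u₀‖ ^ 2 / (g * c), by positivity, fun n => ?_⟩
  have hW := A.weighted n 0 T hT
  have h1 : 0 ≤ Real.exp (-D.growth ‖u₀‖ T) * wsq (step 0) (A.u n T) :=
    mul_nonneg (Real.exp_nonneg _) (norm_nonneg_wsq (memLp_top_step 0) (fun x => (step_pos 0 x).le) _)
  have h2 : wsq (step 0) (A.u n 0) ≤ ‖u₀‖ ^ 2 := by
    refine (wsq_step_le 0 _).trans ?_
    rw [A.init]
    have := norm_bandD_zero_le (A.k n) u₀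
    gcongr
  have h3 : A.η n * ‖u₀‖ ^ 2 ≤ 1 * ‖u₀‖ ^ 2 := by gcongr; exact A.η_le n
  have hcn := A.continuous n
  have cw : Continuous fun s => wsq (bump 0) (bandD (A.k n) 1 (A.u n s)) :=
    (continuous_wsq _).comp (by fun_prop)
  rw [le_div_iff₀ (by positivity), mul_comm, ← intervalIntegral.integral_const_mul]
  refine le_trans (intervalIntegral.integral_mono_on hT (by apply Continuous.intervalIntegrable; fun_prop)
    ((hcont.mul cw).intervalIntegrable _ _) fun s hs => ?_) (by linarith :
      ∫ s in (0 : ℝ)..T, Real.exp (-D.growth ‖u₀‖ s) * wsq (bump 0) (bandD (A.k n) 1 (A.u n s)) ≤ _)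
  rw [mul_assoc]
  exact mul_le_mul (hs₀ hs) (hcb _) (by positivity) (Real.exp_nonneg _)

section Limit

variable (A : Approximation D u₀) {u : ℝ → L2} (hu : ∀ t, 0 ≤ t → WeakTendsto (fun n => A.u n t) (u t))

include hu

lemma norm_limit_le {t : ℝ} (ht : 0 ≤ t) : ‖u t‖ ≤ D.size ‖u₀‖ t :=
  (hu t ht).norm_le (Eventually.of_forall fun n => A.norm_le n t ht)

lemma norm_limit_le' {s T : ℝ} (hs : 0 ≤ s) (hsT : s ≤ T) : ‖u s‖ ≤ D.size ‖u₀‖ T :=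
  (A.norm_limit_le hu hs).trans (D.size_mono (norm_nonneg _) hsT)

/-- The limit is weakly continuous. -/
lemma continuousOn_inner_limit (T : ℝ) (ψ : L2) : ContinuousOn (fun t => inner ℂ ψ (u t)) (Icc 0 T) := by
  refine continuousOn_of_uniform_approx_of_continuousOn fun U hU => ?_
  obtain ⟨r, hr, hrU⟩ := Metric.mem_uniformity_dist.1 hU
  have hM := D.size_pos (norm_nonneg u₀) T
  obtain ⟨K, hK⟩ := ((tendsto_bandD_zero ψ).eventually (Metric.ball_mem_nhds ψ
      (show 0 < r / D.size ‖u₀‖ T by positivity))).exists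
  rw [dist_comm, dist_eq_norm] at hK
  refine ⟨fun t => inner ℂ (bandD K 0 ψ) (u t), ?_, fun t ht => hrU ?_⟩
  · obtain ⟨L, hL0, hL⟩ := A.exists_lipschitz K ψ T
    have hlip : ∀ s t, 0 ≤ s → s ≤ t → t ≤ T →
        ‖inner ℂ (bandD K 0 ψ) (u t) - inner ℂ (bandD K 0 ψ) (u s)‖ ≤ L * (t - s) := by
      intro s t hs hst htT
      refine le_of_tendsto (((hu t (hs.trans hst) (bandD K 0 ψ)).sub (hu s hs (bandD K 0 ψ))).norm) ?_
      filter_upwards [hL] with n hn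
      exact hn s t hs hst htT
    refine (LipschitzOnWith.of_dist_le_mul (K := L.toNNReal) fun s hs t ht => ?_).continuousOn
    rw [Real.coe_toNNReal L hL0, dist_eq_norm, Real.dist_eq]
    rcases le_total s t with h | h
    · rw [norm_sub_rev, abs_sub_comm, abs_of_nonneg (by linarith)]
      exact hlip s t hs.1 h ht.2
    · rw [abs_of_nonneg (by linarith)]
      exact hlip t s ht.1 h hs.2
  · rw [dist_eq_norm, ← inner_sub_left]
    calc _ ≤ ‖ψ - bandD K 0 ψ‖ * ‖u t‖ := norm_inner_le_norm _ _
      _ ≤ ‖ψ - bandD K 0 ψ‖ * D.size ‖u₀‖ T := by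
        gcongr
        exact A.norm_limit_le' hu ht.1 ht.2
      _ < (r / D.size ‖u₀‖ T) * D.size ‖u₀‖ T := by gcongr
      _ = r := by field_simp

/-- Weak convergence at every time gives strong convergence of the moments in `L_2(0,T)`. -/
lemma tendsto_integral_inner_sq {T : ℝ} (hT : 0 ≤ T) (ψ : L2) :
    Tendsto (fun n => ∫ t in (0 : ℝ)..T, ‖inner ℂ ψ (A.u n t - u t)‖ ^ 2) atTop (𝓝 0) := by
  suffices h : Tendsto (fun n => ∫ t in (0 : ℝ)..T, ‖inner ℂ ψ (A.u n t - u t)‖ ^ 2) atTop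
      (𝓝 (∫ t in (0 : ℝ)..T, (0 : ℝ))) by simpa using h
  have hI : uIoc 0 T ⊆ Icc 0 T := by rw [uIoc_of_le hT]; exact Ioc_subset_Icc_self
  refine intervalIntegral.tendsto_integral_filter_of_dominated_convergence (μ := volume)
    (fun _ => (‖ψ‖ * (D.size ‖u₀‖ T + D.size ‖u₀‖ T)) ^ 2) ?_ ?_ (continuous_const.intervalIntegrable _ _) ?_
  · refine Eventually.of_forall fun n => ?_
    simp only [inner_sub_right]
    have h1 : ContinuousOn (fun t => ‖inner ℂ ψ (A.u n t) - inner ℂ ψ (u t)‖ ^ 2) (Icc 0 T) :=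
      ((continuous_const.inner (A.continuous n)).continuousOn.sub (A.continuousOn_inner_limit hu T ψ)).norm.pow 2
    exact (h1.mono hI).aestronglyMeasurable measurableSet_uIoc
  · refine Eventually.of_forall fun n => Eventually.of_forall fun t ht => ?_
    have ht' := hI ht
    rw [Real.norm_eq_abs, abs_of_nonneg (sq_nonneg _)]
    have h1 := norm_inner_le_norm (𝕜 := ℂ) ψ (A.u n t - u t)
    have h2 := norm_sub_le (A.u n t) (u t)
    have h3 := A.norm_le' (n := n) ht'.1 ht'.2
    have h4 := A.norm_limit_le' hu ht'.1 ht'.2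
    have h5 : ‖A.u n t - u t‖ ≤ D.size ‖u₀‖ T + D.size ‖u₀‖ T := by linarith
    gcongr
    exact h1.trans (by gcongr)
  · refine Eventually.of_forall fun t ht => ?_
    have ht' := hI ht
    have := ((hu t ht'.1).sub (weakTendsto_of_tendsto (tendsto_const_nhds (x := u t)))) ψ
    rw [sub_self, inner_zero_right] at this
    simpa [inner_sub_right] using this.norm.pow 2

/-- The approximations form a Cauchy sequence in `L_2((0,T) × (-R,R))`: the oscillation on small
cells is controlled by the bound for `u_x`, the mean values on the cells by weak convergence. -/
lemma eventually_integral_cut_sub_le {T : ℝ} (hT : 0 ≤ T) {R : ℝ} (hR : 0 < R) {r : ℝ} (hr : 0 < r) :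
    ∃ n₀, ∀ n m, n₀ ≤ n → n₀ ≤ m → ∫ t in (0 : ℝ)..T, ‖cut R (A.u n t - A.u m t)‖ ^ 2 ≤ r := by
  obtain ⟨C, hC0, hC⟩ := A.exists_local_bound hT R
  -- number and length of the cells
  obtain ⟨p, hp0, hp⟩ : ∃ p : ℕ, 0 < p ∧ 8 * (2 * R / p) ^ 2 * C ≤ r / 2 := by
    have h1 : Tendsto (fun p : ℕ => 8 * (2 * R / p) ^ 2 * C) atTop (𝓝 0) := by
      have h2 : Tendsto (fun p : ℕ => 2 * R / (p : ℝ)) atTop (𝓝 0) := tendsto_const_div_atTop_nhds_zero_nat _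
      simpa using ((h2.pow 2).const_mul 8).mul_const C
    obtain ⟨p, hp, hp0⟩ := ((h1.eventually (gt_mem_nhds (show 0 < r / 2 by positivity))).and
      (eventually_gt_atTop 0)).exists
    exact ⟨p, hp0, hp.le⟩
  set h := 2 * R / p with hh
  have hpR : (0 : ℝ) < p := by exact_mod_cast hp0
  have hh0 : 0 < h := by positivity
  have hph : -R + p * h = R := by rw [hh]; field_simp; ring
  set e : ℕ → L2 := fun i => indicatorConstLp 2 (μ := volume) (s := Ioc (-R + i * h) (-R + (i + 1 : ℕ) * h))
    measurableSet_Ioc (by simp) (1 : ℂ) with he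
  have hint : ∀ (i : ℕ) (v : L2) (V : ℝ → ℂ), v =ᵐ[volume] V →
      ∫ x in (-R + i * h)..(-R + (i + 1 : ℕ) * h), V x = inner ℂ (e i) v := by
    intro i v V hv
    rw [he, L2.inner_indicatorConstLp_one, intervalIntegral.integral_of_le (by push_cast; nlinarith)]
    exact integral_congr_ae (ae_restrict_of_ae hv.symm)
  have pw : ∀ n m t, ‖cut R (A.u n t - A.u m t)‖ ^ 2 ≤
      ∑ i ∈ Finset.range p, 4 / h * (‖inner ℂ (e i) (A.u n t - u t)‖ ^ 2 + ‖inner ℂ (e i) (A.u m t - u t)‖ ^ 2)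
        + 4 * h ^ 2 * (‖cut R (bandD (A.k n) 1 (A.u n t))‖ ^ 2 + ‖cut R (bandD (A.k m) 1 (A.u m t))‖ ^ 2) := by
    intro n m t
    have hw : ∀ n, A.u n t =ᵐ[volume] wave (A.k n) 0 (A.u n t) := fun n => by
      have := bandD_ae_eq_wave (A.k n) 0 (A.u n t)
      rwa [A.band] at this
    have hd : (A.u n t - A.u m t : L2) =ᵐ[volume]
        fun x => wave (A.k n) 0 (A.u n t) x - wave (A.k m) 0 (A.u m t) x := by
      filter_upwards [Lp.coeFn_sub (A.u n t) (A.u m t), hw n, hw m] with x h1 h2 h3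
      rw [h1, Pi.sub_apply, h2, h3]
    have hP := poincare_cells
      (fun x => (hasDerivAt_wave (A.k n) 0 (A.u n t) x).sub (hasDerivAt_wave (A.k m) 0 (A.u m t) x))
      ((continuous_wave _ _ _).sub (continuous_wave _ _ _)) R h hh0 p hph
    rw [norm_cut_sq' hR.le hd]
    refine hP.trans (add_le_add (Finset.sum_le_sum fun i _ => ?_) ?_)
    · have h1 := hint i _ _ hd
      simp only [Pi.sub_apply]
      rw [h1]
      have h2 : inner ℂ (e i) (A.u n t - A.u m t) =
          inner ℂ (e i) (A.u n t - u t) - inner ℂ (e i) (A.u m t - u t) := by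
        rw [← inner_sub_right]; congr 1; abel
      rw [h2]
      have h3 := norm_sub_le (inner ℂ (e i) (A.u n t - u t)) (inner ℂ (e i) (A.u m t - u t))
      set x := ‖inner ℂ (e i) (A.u n t - u t)‖
      set y := ‖inner ℂ (e i) (A.u m t - u t)‖
      have h4 : ‖inner ℂ (e i) (A.u n t - u t) - inner ℂ (e i) (A.u m t - u t)‖ ^ 2 ≤ 2 * (x ^ 2 + y ^ 2) := by
        have : ‖inner ℂ (e i) (A.u n t - u t) - inner ℂ (e i) (A.u m t - u t)‖ ^ 2 ≤ (x + y) ^ 2 := by gcongr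
        nlinarith [sq_nonneg (x - y)]
      calc _ ≤ 2 / h * (2 * (x ^ 2 + y ^ 2)) := by gcongr
        _ = _ := by ring
    · rw [norm_cut_sq' hR.le (bandD_ae_eq_wave (A.k n) 1 (A.u n t)),
        norm_cut_sq' hR.le (bandD_ae_eq_wave (A.k m) 1 (A.u m t)),
        ← intervalIntegral.integral_add
          (by apply Continuous.intervalIntegrable; have := continuous_wave (A.k n) 1 (A.u n t); fun_prop)
          (by apply Continuous.intervalIntegrable; have := continuous_wave (A.k m) 1 (A.u m t); fun_prop)]
      have : 4 * h ^ 2 = 2 * h ^ 2 * 2 := by ring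
      rw [this, mul_assoc (2 * h ^ 2), ← intervalIntegral.integral_const_mul 2]
      refine mul_le_mul_of_nonneg_left (intervalIntegral.integral_mono_on (by linarith)
        (by apply Continuous.intervalIntegrable
            have := continuous_wave (A.k n) 1 (A.u n t)
            have := continuous_wave (A.k m) 1 (A.u m t)
            fun_prop)
        (by apply Continuous.intervalIntegrable
            have := continuous_wave (A.k n) 1 (A.u n t)
            have := continuous_wave (A.k m) 1 (A.u m t)
            fun_prop) fun x _ => ?_) (by positivity)
      have h3 := norm_sub_le (wave (A.k n) (0 + 1) (A.u n t) x) (wave (A.k m) (0 + 1) (A.u m t) x)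
      simp only [zero_add] at h3 ⊢
      set a := ‖wave (A.k n) 1 (A.u n t) x‖
      set b := ‖wave (A.k m) 1 (A.u m t) x‖
      have : ‖wave (A.k n) 1 (A.u n t) x - wave (A.k m) 1 (A.u m t) x‖ ^ 2 ≤ (a + b) ^ 2 := by gcongr
      nlinarith [sq_nonneg (a - b)]
  have hsum : Tendsto (fun n => ∑ i ∈ Finset.range p,
      4 / h * ∫ t in (0 : ℝ)..T, ‖inner ℂ (e i) (A.u n t - u t)‖ ^ 2) atTop (𝓝 0) := by
    have := tendsto_finsetSum (Finset.range p) fun i _ =>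
      (A.tendsto_integral_inner_sq hu hT (e i)).const_mul (4 / h)
    simpa using this
  obtain ⟨n₀, hn₀⟩ := eventually_atTop.1 (hsum.eventually (gt_mem_nhds (show 0 < r / 4 by positivity)))
  refine ⟨n₀, fun n m hn hm => ?_⟩
  have hcn := A.continuous n
  have hcm := A.continuous m
  have ii : ∀ (n i : ℕ), IntervalIntegrable (fun t => ‖inner ℂ (e i) (A.u n t - u t)‖ ^ 2) volume 0 T := by
    intro n i
    refine ContinuousOn.intervalIntegrable ?_
    rw [uIcc_of_le hT]
    simp only [inner_sub_right]
    exact ((continuous_const.inner (A.continuous n)).continuousOn.sub (A.continuousOn_inner_limit hu T _)).norm.pow 2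
  have ic : ∀ n, IntervalIntegrable (fun t => ‖cut R (bandD (A.k n) 1 (A.u n t))‖ ^ 2) volume 0 T := fun n => by
    have := A.continuous n
    apply Continuous.intervalIntegrable; fun_prop
  have is : IntervalIntegrable (fun t => ∑ i ∈ Finset.range p,
      4 / h * (‖inner ℂ (e i) (A.u n t - u t)‖ ^ 2 + ‖inner ℂ (e i) (A.u m t - u t)‖ ^ 2)) volume 0 T :=
    ⟨integrable_finsetSum _ fun i _ => (((ii n i).add (ii m i)).const_mul _).1,
      integrable_finsetSum _ fun i _ => (((ii n i).add (ii m i)).const_mul _).2⟩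
  have h1 := intervalIntegral.integral_mono_on hT (by apply Continuous.intervalIntegrable; fun_prop)
    (is.add (((ic n).add (ic m)).const_mul (4 * h ^ 2))) fun t _ => pw n m t
  refine h1.trans ?_
  rw [intervalIntegral.integral_add is (((ic n).add (ic m)).const_mul (4 * h ^ 2)),
    intervalIntegral.integral_finsetSum fun i _ => ((ii n i).add (ii m i)).const_mul _,
    intervalIntegral.integral_const_mul, intervalIntegral.integral_add (ic n) (ic m)]
  have e1 : ∑ i ∈ Finset.range p, ∫ t in (0 : ℝ)..T,
      4 / h * (‖inner ℂ (e i) (A.u n t - u t)‖ ^ 2 + ‖inner ℂ (e i) (A.u m t - u t)‖ ^ 2) =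
      (∑ i ∈ Finset.range p, 4 / h * ∫ t in (0 : ℝ)..T, ‖inner ℂ (e i) (A.u n t - u t)‖ ^ 2) +
      ∑ i ∈ Finset.range p, 4 / h * ∫ t in (0 : ℝ)..T, ‖inner ℂ (e i) (A.u m t - u t)‖ ^ 2 := by
    rw [← Finset.sum_add_distrib]
    refine Finset.sum_congr rfl fun i _ => ?_
    rw [intervalIntegral.integral_const_mul, intervalIntegral.integral_add (ii n i) (ii m i), mul_add]
  rw [e1]
  have h2 := hn₀ n hn
  have h3 := hn₀ m hm
  have h4 : 4 * h ^ 2 * ((∫ t in (0 : ℝ)..T, ‖cut R (bandD (A.k n) 1 (A.u n t))‖ ^ 2) +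
      ∫ t in (0 : ℝ)..T, ‖cut R (bandD (A.k m) 1 (A.u m t))‖ ^ 2) ≤ 4 * h ^ 2 * (C + C) :=
    mul_le_mul_of_nonneg_left (add_le_add (hC n) (hC m)) (by positivity)
  linarith

end Limit

end Approximation

/-! ### Strong convergence at almost every time -/

namespace Approximation

variable {D : Coeffs} {u₀ : L2}

/-- An upper bound of `‖u_n(t) - u(t)‖²` in `L_2(-R,R)` which is measurable in `t`. -/
noncomputable def gap (A : Approximation D u₀) (R : ℝ) (n : ℕ) (t : ℝ) : ℝ≥0∞ :=
  liminf (fun m => ENNReal.ofReal (‖cut R (A.u n t - A.u m t)‖ ^ 2)) atTop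

lemma continuous_norm_cut_sub (A : Approximation D u₀) (R : ℝ) (n m : ℕ) :
    Continuous fun t => ‖cut R (A.u n t - A.u m t)‖ ^ 2 := by
  have := A.continuous n
  have := A.continuous m
  fun_prop

lemma measurable_gap (A : Approximation D u₀) (R : ℝ) (n : ℕ) : Measurable (A.gap R n) :=
  Measurable.liminf fun m => ENNReal.measurable_ofReal.comp (A.continuous_norm_cut_sub R n m).measurable

lemma gap_mono (A : Approximation D u₀) {R R' : ℝ} (h : R ≤ R') (n : ℕ) (t : ℝ) : A.gap R n t ≤ A.gap R' n t := by
  refine liminf_le_liminf (Eventually.of_forall fun m => ENNReal.ofReal_le_ofReal ?_)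
  have := norm_cut_mono h (A.u n t - A.u m t)
  gcongr

/-- By weak lower semicontinuity of the norm. -/
lemma norm_cut_le_gap (A : Approximation D u₀) {u : L2} {t : ℝ} (hu : WeakTendsto (fun n => A.u n t) u) (R : ℝ)
    (n : ℕ) : ENNReal.ofReal (‖cut R (A.u n t - u)‖ ^ 2) ≤ A.gap R n t := by
  have hw : WeakTendsto (fun m => cut R (A.u n t - A.u m t)) (cut R (A.u n t - u)) :=
    ((weakTendsto_of_tendsto tendsto_const_nhds).sub hu).clm (cut R)
  refine (le_liminf_iff).2 fun y hy => ?_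
  have hy1 : y ≠ ⊤ := (hy.trans_le le_top).ne
  have hy2 : Real.sqrt y.toReal < ‖cut R (A.u n t - u)‖ := by
    rw [Real.sqrt_lt' (by
      by_contra! hc
      have : ‖cut R (A.u n t - u)‖ = 0 := le_antisymm hc (norm_nonneg _)
      rw [this] at hy
      simp at hy)]
    exact (ENNReal.lt_ofReal_iff_toReal_lt hy1).1 hy
  filter_upwards [hw.eventually_lt hy2] with m hm
  rw [ENNReal.lt_ofReal_iff_toReal_lt hy1]
  exact (Real.sqrt_lt' ((Real.sqrt_nonneg _).trans_lt hm)).1 hm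

lemma eventually_lintegral_gap_le (A : Approximation D u₀) {u : ℝ → L2}
    (hu : ∀ t, 0 ≤ t → WeakTendsto (fun n => A.u n t) (u t)) {T : ℝ} (hT : 0 ≤ T) {R : ℝ} (hR : 0 < R)
    {r : ℝ} (hr : 0 < r) :
    ∀ᶠ n in atTop, ∫⁻ t in Ioc 0 T, A.gap R n t ≤ ENNReal.ofReal r := by
  obtain ⟨n₀, hn₀⟩ := A.eventually_integral_cut_sub_le hu hT hR hr
  filter_upwards [eventually_ge_atTop n₀] with n hn
  refine (lintegral_liminf_le fun m =>
    ENNReal.measurable_ofReal.comp (A.continuous_norm_cut_sub R n m).measurable).trans ?_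
  refine liminf_le_of_frequently_le' (Eventually.frequently ?_)
  filter_upwards [eventually_ge_atTop n₀] with m hm
  have h := hn₀ n m hn hm
  rw [intervalIntegral.integral_of_le hT] at h
  simp only [Function.comp]
  rw [← ofReal_integral_eq_lintegral_ofReal
    ((A.continuous_norm_cut_sub R n m).integrableOn_Ioc) (Eventually.of_forall fun t => sq_nonneg _)]
  exact ENNReal.ofReal_le_ofReal h

/-- Along a subsequence the approximations converge weakly at every time, and strongly in
`L_2(-R,R)` for every `R` at almost every time. -/
theorem exists_strong_limit (A : Approximation D u₀) :
    ∃ (B : Approximation D u₀) (u : ℝ → L2), (∀ t, 0 ≤ t → WeakTendsto (fun n => B.u n t) (u t)) ∧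
      ∀ᵐ t : ℝ, 0 < t → ∀ R : ℝ, Tendsto (fun n => ‖cut R (B.u n t - u t)‖) atTop (𝓝 0) := by
  obtain ⟨A, u, hu⟩ := A.exists_weak_limit
  obtain ⟨φ, hφ, hP⟩ := extraction_forall_of_eventually (P := fun j n =>
    ∫⁻ t in Ioc 0 ((j : ℝ) + 1), A.gap ((j : ℝ) + 1) n t ≤ ENNReal.ofReal ((1 / 2) ^ j)) fun j =>
      A.eventually_lintegral_gap_le hu (by positivity) (by positivity) (by positivity)
  refine ⟨A.subseq φ hφ, u, fun t ht => (hu t ht).comp hφ, ?_⟩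
  -- the gaps are summable along the subsequence, hence tend to zero at almost every time
  have key : ∀ J : ℕ, ∀ᵐ t : ℝ, t ∈ Ioc (0 : ℝ) J →
      Tendsto (fun n => ‖cut J (A.u (φ n) t - u t)‖) atTop (𝓝 0) := by
    intro J
    have hsum : ∫⁻ t in Ioc (0 : ℝ) J, ∑' j, A.gap J (φ (j + J)) t ≠ ⊤ := by
      rw [lintegral_tsum fun j => (A.measurable_gap J _).aemeasurable]
      refine ne_top_of_le_ne_top (b := ∑' j : ℕ, ENNReal.ofReal ((1 / 2) ^ j)) ?_ (ENNReal.tsum_le_tsum fun j => ?_)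
      · rw [← ENNReal.ofReal_tsum_of_nonneg (fun j => by positivity) summable_geometric_two]
        exact ENNReal.ofReal_ne_top
      · have hJ : (J : ℝ) ≤ ((j + J : ℕ) : ℝ) + 1 := by push_cast; linarith [Nat.cast_nonneg (α := ℝ) j]
        calc ∫⁻ t in Ioc (0 : ℝ) J, A.gap J (φ (j + J)) t
            ≤ ∫⁻ t in Ioc (0 : ℝ) J, A.gap (((j + J : ℕ) : ℝ) + 1) (φ (j + J)) t :=
              lintegral_mono fun t => A.gap_mono hJ _ _
          _ ≤ ∫⁻ t in Ioc (0 : ℝ) (((j + J : ℕ) : ℝ) + 1), A.gap (((j + J : ℕ) : ℝ) + 1) (φ (j + J)) t :=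
              lintegral_mono_set (Ioc_subset_Ioc_right hJ)
          _ ≤ _ := hP (j + J)
          _ ≤ _ := ENNReal.ofReal_le_ofReal (pow_le_pow_of_le_one (by norm_num) (by norm_num) (Nat.le_add_right j J))
    have hae := ae_lt_top (Measurable.tsum fun j => A.measurable_gap J (φ (j + J))) hsum
    rw [ae_restrict_iff' measurableSet_Ioc] at hae
    filter_upwards [hae] with t ht htJ
    have h1 := ENNReal.tendsto_atTop_zero_of_tsum_ne_top (ht htJ).ne
    have h2 : Tendsto (fun j => ENNReal.ofReal (‖cut J (A.u (φ (j + J)) t - u t)‖ ^ 2)) atTop (𝓝 0) :=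
      tendsto_of_tendsto_of_tendsto_of_le_of_le tendsto_const_nhds h1 (fun _ => zero_le)
        fun j => A.norm_cut_le_gap (hu t htJ.1.le) J _
    have h3 := (ENNReal.tendsto_toReal ENNReal.zero_ne_top).comp h2
    have h4 := h3.sqrt
    simp only [Function.comp, ENNReal.toReal_ofReal (sq_nonneg _), Real.sqrt_sq (norm_nonneg _),
      ENNReal.toReal_zero, Real.sqrt_zero] at h4
    exact (tendsto_add_atTop_iff_nat (f := fun n => ‖cut J (A.u (φ n) t - u t)‖) J).1 h4
  filter_upwards [ae_all_iff.2 key] with t ht ht0 R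
  obtain ⟨J, hJ⟩ := exists_nat_ge (max R t)
  exact squeeze_zero (fun _ => norm_nonneg _)
    (fun n => norm_cut_mono ((le_max_left _ _).trans hJ) _) (ht J ⟨ht0, (le_max_right _ _).trans hJ⟩)

end Approximation

/-! ### A jointly measurable representative -/

lemma continuous_wave_uncurry (k : ℝ) (j : ℕ) {v : ℝ → L2} (hv : Continuous v) :
    Continuous fun z : ℝ × ℝ => wave k j (v z.1) z.2 := by
  refine continuous_iff_continuousAt.2 fun z₀ => ?_
  have h1 : Tendsto (fun z : ℝ × ℝ => wave k j (v z.1 - v z₀.1) z.2) (𝓝 z₀) (𝓝 0) := by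
    refine squeeze_zero_norm (fun z => norm_wave_le k j _ _) ?_
    have h2 : Continuous fun z : ℝ × ℝ => symbNorm k j * ‖v z.1 - v z₀.1‖ := by fun_prop
    have h3 := h2.tendsto z₀
    simpa using h3
  have h2 : Tendsto (fun z : ℝ × ℝ => wave k j (v z₀.1) z.2) (𝓝 z₀) (𝓝 (wave k j (v z₀.1) z₀.2)) :=
    ((continuous_wave k j (v z₀.1)).comp continuous_snd).tendsto z₀
  have h3 := h1.add h2
  rw [zero_add] at h3
  refine h3.congr fun z => ?_
  rw [wave_sub]; ring

lemma continuous_integral_shift {F : ℝ × ℝ → ℂ} (hF : Continuous F) (h : ℝ) :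
    Continuous fun z : ℝ × ℝ => ∫ y in (0 : ℝ)..h, F (z.1, z.2 + y) := by
  refine intervalIntegral.continuous_parametric_intervalIntegral_of_continuous'
    (f := fun (z : ℝ × ℝ) y => F (z.1, z.2 + y)) ?_ _ _
  exact hF.comp (by fun_prop : Continuous fun p : (ℝ × ℝ) × ℝ => (p.1.1, p.1.2 + p.2))

lemma locallyIntegrable_L2 (v : L2) : LocallyIntegrable v volume :=
  (Lp.memLp v).locallyIntegrable (by norm_num)

/-- A representative of a curve in `L_2` that is measurable in both variables: the limit of the mean
values over shrinking intervals. The curve is extended to negative times by a constant. -/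
noncomputable def rep (u : ℝ → L2) (t x : ℝ) : ℂ :=
  limUnder atTop fun m : ℕ => (1 / ((m : ℝ) + 1))⁻¹ • ∫ y in x..(x + 1 / ((m : ℝ) + 1)), u (max t 0) y

lemma rep_ae_eq (u : ℝ → L2) (t : ℝ) : rep u t =ᵐ[volume] u (max t 0) := by
  filter_upwards [LocallyIntegrable.ae_hasDerivAt_integral (locallyIntegrable_L2 (u (max t 0)))] with x hx
  have h1 := hasDerivAt_iff_tendsto_slope_zero.1 (hx x)
  have h2 : Tendsto (fun m : ℕ => 1 / ((m : ℝ) + 1)) atTop (𝓝[≠] 0) :=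
    tendsto_nhdsWithin_iff.2 ⟨tendsto_one_div_add_atTop_nhds_zero_nat, Eventually.of_forall fun m => by
      simp only [mem_compl_iff, mem_singleton_iff]; positivity⟩
  refine Tendsto.limUnder_eq ?_
  simpa [Function.comp_def] using h1.comp h2

lemma rep_ae_eq_of_nonneg (u : ℝ → L2) {t : ℝ} (ht : 0 ≤ t) : rep u t =ᵐ[volume] u t := by
  have := rep_ae_eq u t
  rwa [max_eq_left ht] at this

lemma WeakTendsto.tendsto_interval {v : ℕ → L2} {w : L2} (h : WeakTendsto v w) {V : ℕ → ℝ → ℂ}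
    (hV : ∀ n, v n =ᵐ[volume] V n) {a b : ℝ} (hab : a ≤ b) :
    Tendsto (fun n => ∫ y in a..b, V n y) atTop (𝓝 (∫ y in a..b, w y)) := by
  set e : L2 := indicatorConstLp 2 (μ := volume) (s := Ioc a b) measurableSet_Ioc (by simp) (1 : ℂ) with he
  have hint : ∀ (v : L2) (V : ℝ → ℂ), v =ᵐ[volume] V → inner ℂ e v = ∫ x in a..b, V x := by
    intro v V hv
    rw [he, L2.inner_indicatorConstLp_one, intervalIntegral.integral_of_le hab]
    exact integral_congr_ae (ae_restrict_of_ae hv)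
  have := h e
  rw [hint w w (Filter.EventuallyEq.refl _ _)] at this
  exact this.congr fun n => hint _ _ (hV n)

namespace Approximation

variable {D : Coeffs} {u₀ : L2} (A : Approximation D u₀)

lemma ae_eq_wave (n : ℕ) (t : ℝ) : A.u n t =ᵐ[volume] wave (A.k n) 0 (A.u n t) := by
  have := bandD_ae_eq_wave (A.k n) 0 (A.u n t)
  rwa [A.band] at this

section Limit

variable {u : ℝ → L2} (hu : ∀ t, 0 ≤ t → WeakTendsto (fun n => A.u n t) (u t))

include hu

/-- The mean values over an interval are limits of the mean values of the approximations, which are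
jointly continuous. -/
lemma stronglyMeasurable_rep : StronglyMeasurable fun z : ℝ × ℝ => rep u z.1 z.2 := by
  refine StronglyMeasurable.limUnder fun m => StronglyMeasurable.fun_const_smul ?_ _
  set h : ℝ := 1 / ((m : ℝ) + 1) with hh
  have h0 : 0 < h := by positivity
  have hc : ∀ n, Continuous fun z : ℝ × ℝ => ∫ y in (0 : ℝ)..h, wave (A.k n) 0 (A.u n (max z.1 0)) (z.2 + y) := by
    intro n
    have c1 : Continuous fun t => A.u n (max t 0) := (A.continuous n).comp (by fun_prop)
    exact continuous_integral_shift (continuous_wave_uncurry (A.k n) 0 c1) h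
  have lim : Tendsto (fun n (z : ℝ × ℝ) => ∫ y in (0 : ℝ)..h, wave (A.k n) 0 (A.u n (max z.1 0)) (z.2 + y)) atTop
      (𝓝 fun z : ℝ × ℝ => ∫ y in z.2..(z.2 + h), u (max z.1 0) y) := by
    refine tendsto_pi_nhds.2 fun z => ?_
    have := (hu (max z.1 0) (le_max_right _ _)).tendsto_interval
      (V := fun n => wave (A.k n) 0 (A.u n (max z.1 0))) (fun n => A.ae_eq_wave n _)
      (show z.2 ≤ z.2 + h by linarith)
    refine this.congr fun n => ?_
    have e := intervalIntegral.integral_comp_add_left (a := 0) (b := h)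
      (fun y => wave (A.k n) 0 (A.u n (max z.1 0)) y) z.2
    rw [add_zero] at e
    exact e.symm
  exact stronglyMeasurable_of_tendsto (u := atTop) (f := fun n (z : ℝ × ℝ) =>
    ∫ y in (0 : ℝ)..h, wave (A.k n) 0 (A.u n (max z.1 0)) (z.2 + y)) (fun n => (hc n).stronglyMeasurable) lim

lemma eLpNorm_rep_le {t T : ℝ} (ht : 0 ≤ t) (htT : t ≤ T) :
    eLpNorm (rep u t) 2 volume ≤ ENNReal.ofReal (D.size ‖u₀‖ T) := by
  rw [eLpNorm_congr_ae (rep_ae_eq_of_nonneg u ht), ← Lp.enorm_def, ← ofReal_norm]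
  exact ENNReal.ofReal_le_ofReal (A.norm_limit_le' hu ht htT)

lemma memLinftyL2_rep (T : ℝ) : MemLinftyL2 T (rep u) := by
  refine ⟨(A.stronglyMeasurable_rep hu).aestronglyMeasurable, (D.size ‖u₀‖ T).toNNReal, ?_⟩
  filter_upwards [ae_restrict_mem measurableSet_Ioo] with t ht
  exact A.eLpNorm_rep_le hu ht.1.le ht.2.le

lemma memLp_rep_strip (T : ℝ) :
    MemLp ((strip T).indicator fun z : ℝ × ℝ => rep u z.1 z.2) 2 volume := by
  have hs : MeasurableSet (strip T) := measurableSet_Ioo.prod MeasurableSet.univ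
  rw [memLp_indicator_iff_restrict hs]
  refine ⟨(A.stronglyMeasurable_rep hu).aestronglyMeasurable, ?_⟩
  rw [eLpNorm_lt_top_iff_lintegral_rpow_enorm_lt_top (by norm_num) (by norm_num)]
  simp only [ENNReal.toReal_ofNat]
  have e : (volume : Measure (ℝ × ℝ)).restrict (strip T) =
      (volume.restrict (Ioo 0 T)).prod (volume : Measure ℝ) := by
    rw [strip, Measure.volume_eq_prod, ← Measure.prod_restrict, Measure.restrict_univ]
  have hm : AEMeasurable (fun z : ℝ × ℝ => ‖rep u z.1 z.2‖ₑ ^ (2 : ℝ))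
      ((volume.restrict (Ioo 0 T)).prod (volume : Measure ℝ)) :=
    ((A.stronglyMeasurable_rep hu).measurable.enorm.pow_const _).aemeasurable
  rw [e, lintegral_prod _ hm]
  refine lt_of_le_of_lt (setLIntegral_mono_ae' (g := fun _ => ENNReal.ofReal (D.size ‖u₀‖ T) ^ (2 : ℝ))
    measurableSet_Ioo (Eventually.of_forall fun t ht => ?_)) ?_
  · have h := A.eLpNorm_rep_le hu ht.1.le ht.2.le
    rw [eLpNorm_eq_lintegral_rpow_enorm_toReal (by norm_num) (by norm_num)] at h
    simp only [ENNReal.toReal_ofNat] at h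
    have h2 := ENNReal.rpow_le_rpow h (show (0 : ℝ) ≤ 2 by norm_num)
    rwa [← ENNReal.rpow_mul, one_div_mul_cancel (by norm_num), ENNReal.rpow_one] at h2
  · rw [lintegral_const, Measure.restrict_apply_univ, Real.volume_Ioo]
    exact ENNReal.mul_lt_top (by simp) ENNReal.ofReal_lt_top

end Limit

end Approximation

/-! ### Weighted gradients -/

lemma sigmoid_add_le (y a : ℝ) : Real.sigmoid (y + a) ≤ Real.exp |a| * Real.sigmoid y := by
  simp only [Real.sigmoid_def]
  rw [← div_eq_mul_inv, le_div_iff₀ (by positivity), inv_mul_le_iff₀ (by positivity)]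
  have h1 : Real.exp (-y) ≤ Real.exp |a| * Real.exp (-(y + a)) := by
    rw [← Real.exp_add]
    exact Real.exp_le_exp.2 (by linarith [le_abs_self a])
  have h2 : 1 ≤ Real.exp |a| := Real.one_le_exp (abs_nonneg a)
  nlinarith

lemma bump_eq (x₀ x : ℝ) : bump x₀ x = Real.sigmoid (x - x₀) * Real.sigmoid (-(x - x₀)) := by
  rw [bump, step, Real.sigmoid_neg]

/-- Bumps centred at different points are comparable. -/
lemma bump_le_mul_bump (x₀ x : ℝ) : bump x₀ x ≤ Real.exp (2 * |x₀|) * bump 0 x := by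
  rw [bump_eq, bump_eq]
  have h1 := sigmoid_add_le (x - 0) (-x₀)
  have h2 := sigmoid_add_le (-(x - 0)) x₀
  rw [abs_neg] at h1
  have e1 : x - 0 + -x₀ = x - x₀ := by ring
  have e2 : -(x - 0) + x₀ = -(x - x₀) := by ring
  rw [e1] at h1
  rw [e2] at h2
  calc _ ≤ (Real.exp |x₀| * Real.sigmoid (x - 0)) * (Real.exp |x₀| * Real.sigmoid (-(x - 0))) :=
        mul_le_mul h1 h2 (Real.sigmoid_nonneg _) (mul_nonneg (Real.exp_nonneg _) (Real.sigmoid_nonneg _))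
    _ = _ := by rw [two_mul, Real.exp_add]; ring

/-- The square root of the density `e^{-Λ(t)} σ'(x - x₀)` with respect to which `u_x` is square integrable. -/
noncomputable def dens (D : Coeffs) (m x₀ : ℝ) (z : ℝ × ℝ) : ℝ :=
  Real.exp (-D.growth m z.1 / 2) * Real.sqrt (bump x₀ z.2)

lemma dens_pos (D : Coeffs) (m x₀ : ℝ) (z : ℝ × ℝ) : 0 < dens D m x₀ z :=
  mul_pos (Real.exp_pos _) (Real.sqrt_pos.2 (bump_pos _ _))

lemma continuous_dens (D : Coeffs) (m x₀ : ℝ) : Continuous (dens D m x₀) := by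
  have := D.continuous_growth m
  have := continuous_bump x₀
  unfold dens
  fun_prop

lemma dens_sq (D : Coeffs) (m x₀ : ℝ) (z : ℝ × ℝ) :
    dens D m x₀ z ^ 2 = Real.exp (-D.growth m z.1) * bump x₀ z.2 := by
  rw [dens, mul_pow, Real.sq_sqrt (bump_pos _ _).le, ← Real.exp_nat_mul]
  congr 2
  push_cast; ring

lemma dens_le (D : Coeffs) (m x₀ : ℝ) (z : ℝ × ℝ) : dens D m x₀ z ≤ Real.exp |x₀| * dens D m 0 z := by
  refine le_of_sq_le_sq ?_ (mul_nonneg (Real.exp_nonneg _) (dens_pos _ _ _ _).le)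
  rw [mul_pow, dens_sq, dens_sq, ← Real.exp_nat_mul]
  have := mul_le_mul_of_nonneg_left (bump_le_mul_bump x₀ z.2) (Real.exp_nonneg (-D.growth m z.1))
  push_cast
  linarith

lemma lintegral_wsq {c : ℝ → ℝ} (hc : MemLp (fun x => (c x : ℂ)) ⊤ volume) (hc0 : ∀ x, 0 ≤ c x)
    {v : L2} {V : ℝ → ℂ} (hV : v =ᵐ[volume] V) :
    ∫⁻ x, ENNReal.ofReal (c x) * ‖V x‖ₑ ^ 2 = ENNReal.ofReal (wsq c v) := by
  have e : ∀ x, (V x).re ^ 2 + (V x).im ^ 2 = ‖V x‖ ^ 2 := fun x => by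
    rw [← Complex.normSq_eq_norm_sq, Complex.normSq_apply]; ring
  have hsq : Integrable (fun x => ‖V x‖ ^ 2) volume := ((memLp_congr_ae hV).1 (Lp.memLp v)).norm.integrable_sq
  have hi : Integrable (fun x => c x * ‖V x‖ ^ 2) volume := by
    have := hc.re
    exact hsq.bdd_mul (c := (eLpNorm (fun x => (c x : ℂ)) ⊤ volume).toReal) this.1 (by
      filter_upwards [ae_le_eLpNormEssSup (f := fun x => (c x : ℂ)) (μ := volume)] with x hx
      have h2 := hc.2.ne
      rw [eLpNorm_exponent_top] at h2 ⊢
      have h3 := ENNReal.toReal_mono h2 hx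
      simpa using h3)
  rw [wsq_eq hc hV]
  simp only [e]
  rw [ofReal_integral_eq_lintegral_ofReal hi (Eventually.of_forall fun x => mul_nonneg (hc0 x) (sq_nonneg _))]
  refine lintegral_congr fun x => ?_
  rw [ENNReal.ofReal_mul (hc0 x), ← ofReal_norm, ENNReal.ofReal_pow (norm_nonneg _)]

lemma enorm_sq_mul (r : ℝ) (z : ℂ) : ‖(r : ℂ) * z‖ₑ ^ 2 = ENNReal.ofReal (r ^ 2) * ‖z‖ₑ ^ 2 := by
  rw [enorm_mul, mul_pow]
  congr 1
  rw [← ofReal_norm, ← ENNReal.ofReal_pow (norm_nonneg _), Complex.norm_real, Real.norm_eq_abs, sq_abs]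

lemma eLpNorm_two_sq {X : Type*} [MeasurableSpace X] {μ : Measure X} (f : X → ℂ) :
    eLpNorm f 2 μ ^ 2 = ∫⁻ z, ‖f z‖ₑ ^ 2 ∂μ := by
  rw [eLpNorm_eq_lintegral_rpow_enorm_toReal (by norm_num) (by norm_num)]
  simp only [ENNReal.toReal_ofNat]
  rw [← ENNReal.rpow_natCast, ← ENNReal.rpow_mul]
  norm_num

lemma memLp_two_of_lintegral {X : Type*} [MeasurableSpace X] {μ : Measure X} {f : X → ℂ}
    (hf : AEStronglyMeasurable f μ) (h : ∫⁻ z, ‖f z‖ₑ ^ 2 ∂μ ≠ ⊤) : MemLp f 2 μ := by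
  refine ⟨hf, ?_⟩
  rw [← eLpNorm_two_sq] at h
  exact lt_top_iff_ne_top.2 fun h' => h (by rw [h']; simp)

/-- Weak lower semicontinuity of the norm with a varying bound. -/
lemma norm_sq_le_of_weakTendsto {H : Type*} [NormedAddCommGroup H] [InnerProductSpace ℂ H] {v : ℕ → H} {w : H}
    (h : WeakTendsto v w) {c : ℕ → ℝ} {C : ℝ} (hc : Tendsto c atTop (𝓝 C)) (hv : ∀ n, ‖v n‖ ^ 2 ≤ c n) :
    ‖w‖ ^ 2 ≤ C := by
  have hC : 0 ≤ C := ge_of_tendsto' hc fun n => (sq_nonneg _).trans (hv n)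
  by_contra! hlt
  obtain ⟨r, hr1, hr2⟩ := exists_between hlt
  have hr0 : 0 ≤ r := hC.trans hr1.le
  have h1 : Real.sqrt r < ‖w‖ := (Real.sqrt_lt' (by
    by_contra! hw
    have : ‖w‖ = 0 := le_antisymm hw (norm_nonneg _)
    rw [this] at hr2
    norm_num at hr2
    linarith)).2 hr2
  obtain ⟨n, h2, h3⟩ := ((h.eventually_lt h1).and (hc.eventually (gt_mem_nhds hr1))).exists
  have h4 := hv n
  have h5 : r < ‖v n‖ ^ 2 := (Real.sqrt_lt' ((Real.sqrt_nonneg _).trans_lt h2)).1 h2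
  linarith

namespace Approximation

variable {D : Coeffs} {u₀ : L2} (A : Approximation D u₀)

/-- The space derivative of the approximation, for positive times, times the square root of the weight
`e^{-Λ(t)} σ'(x - x₀)`. -/
noncomputable def wgrad (x₀ : ℝ) (n : ℕ) : ℝ × ℝ → ℂ :=
  {z : ℝ × ℝ | 0 < z.1}.indicator fun z => (dens D ‖u₀‖ x₀ z : ℂ) * wave (A.k n) 1 (A.u n z.1) z.2

lemma measurableSet_pos_time : MeasurableSet {z : ℝ × ℝ | 0 < z.1} :=
  measurableSet_lt measurable_const measurable_fst

lemma measurable_wgrad (x₀ : ℝ) (n : ℕ) : Measurable (A.wgrad x₀ n) := by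
  refine Measurable.indicator ?_ measurableSet_pos_time
  exact ((Complex.continuous_ofReal.comp (continuous_dens D _ x₀)).mul
    (continuous_wave_uncurry (A.k n) 1 (A.continuous n))).measurable

lemma lintegral_wgrad_le (x₀ : ℝ) (n : ℕ) :
    ∫⁻ z, ‖A.wgrad x₀ n z‖ₑ ^ 2 ≤ ENNReal.ofReal (wsq (step x₀) (A.u n 0) + A.η n * ‖u₀‖ ^ 2) := by
  have hm : Measurable fun z => ‖A.wgrad x₀ n z‖ₑ ^ 2 := (A.measurable_wgrad x₀ n).enorm.pow_const _
  rw [Measure.volume_eq_prod, lintegral_prod _ hm.aemeasurable]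
  set Z : ℝ → ℝ := fun t => Real.exp (-D.growth ‖u₀‖ t) * wsq (bump x₀) (bandD (A.k n) 1 (A.u n t)) with hZ
  have hZ0 : ∀ t, 0 ≤ Z t := fun t => mul_nonneg (Real.exp_nonneg _)
    (norm_nonneg_wsq (memLp_top_bump x₀) (fun x => (bump_pos x₀ x).le) _)
  have hZc : Continuous Z := by
    have h1 := D.continuous_growth ‖u₀‖
    have h2 := A.continuous n
    exact (Real.continuous_exp.comp h1.neg).mul ((continuous_wsq _).comp (by fun_prop))
  have hin : ∀ t, ∫⁻ x, ‖A.wgrad x₀ n (t, x)‖ₑ ^ 2 = (Ioi (0 : ℝ)).indicator (fun t => ENNReal.ofReal (Z t)) t := by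
    intro t
    by_cases ht : 0 < t
    · rw [indicator_of_mem (mem_Ioi.2 ht)]
      have e : ∀ x, ‖A.wgrad x₀ n (t, x)‖ₑ ^ 2 = ENNReal.ofReal (Real.exp (-D.growth ‖u₀‖ t)) *
          (ENNReal.ofReal (bump x₀ x) * ‖wave (A.k n) 1 (A.u n t) x‖ₑ ^ 2) := by
        intro x
        rw [wgrad, indicator_of_mem (by exact ht), enorm_sq_mul, dens_sq, ENNReal.ofReal_mul (Real.exp_nonneg _), mul_assoc]
      simp only [e]
      rw [lintegral_const_mul' _ _ ENNReal.ofReal_ne_top,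
        lintegral_wsq (memLp_top_bump x₀) (fun x => (bump_pos x₀ x).le) (bandD_ae_eq_wave (A.k n) 1 (A.u n t)),
        ← ENNReal.ofReal_mul (Real.exp_nonneg _)]
    · rw [indicator_of_notMem (by exact ht)]
      have e : ∀ x, ‖A.wgrad x₀ n (t, x)‖ₑ ^ 2 = 0 := by
        intro x
        rw [wgrad, indicator_of_notMem (by exact ht)]; simp
      simp only [e, lintegral_zero]
  simp only [hin]
  rw [lintegral_indicator measurableSet_Ioi]
  have hU : Ioi (0 : ℝ) = ⋃ j : ℕ, Ioc (0 : ℝ) j := by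
    ext t
    simp only [mem_Ioi, mem_iUnion, mem_Ioc]
    refine ⟨fun h => ?_, fun ⟨j, h, _⟩ => h⟩
    obtain ⟨j, hj⟩ := exists_nat_ge t
    exact ⟨j, h, hj⟩
  have hmono : Monotone fun j : ℕ => Ioc (0 : ℝ) j := fun i j hij => Ioc_subset_Ioc_right (by exact_mod_cast hij)
  rw [hU, setLIntegral_iUnion_of_directed _ (directed_of_isDirected_le hmono)]
  refine iSup_le fun j => ?_
  rw [← ofReal_integral_eq_lintegral_ofReal hZc.integrableOn_Ioc (Eventually.of_forall hZ0),
    ← intervalIntegral.integral_of_le (Nat.cast_nonneg j)]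
  refine ENNReal.ofReal_le_ofReal ?_
  have h1 := A.weighted n x₀ j (Nat.cast_nonneg j)
  have h2 : 0 ≤ Real.exp (-D.growth ‖u₀‖ j) * wsq (step x₀) (A.u n j) :=
    mul_nonneg (Real.exp_nonneg _) (norm_nonneg_wsq (memLp_top_step x₀) (fun x => (step_pos x₀ x).le) _)
  linarith

lemma memLp_wgrad (x₀ : ℝ) (n : ℕ) : MemLp (A.wgrad x₀ n) 2 volume :=
  memLp_two_of_lintegral (A.measurable_wgrad x₀ n).aestronglyMeasurable
    (ne_top_of_le_ne_top ENNReal.ofReal_ne_top (A.lintegral_wgrad_le x₀ n))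

lemma norm_wgrad_sq_le (x₀ : ℝ) (n : ℕ) :
    ‖(A.memLp_wgrad x₀ n).toLp‖ ^ 2 ≤ wsq (step x₀) (A.u n 0) + A.η n * ‖u₀‖ ^ 2 := by
  have h0 : 0 ≤ wsq (step x₀) (A.u n 0) + A.η n * ‖u₀‖ ^ 2 := by
    have h1 := A.weighted n x₀ 0 le_rfl
    have h2 : 0 ≤ Real.exp (-D.growth ‖u₀‖ 0) * wsq (step x₀) (A.u n 0) :=
      mul_nonneg (Real.exp_nonneg _) (norm_nonneg_wsq (memLp_top_step x₀) (fun x => (step_pos x₀ x).le) _)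
    rw [intervalIntegral.integral_same] at h1
    linarith
  rw [Lp.norm_toLp, ← ENNReal.toReal_pow, eLpNorm_two_sq]
  exact ENNReal.toReal_le_of_le_ofReal h0 (A.lintegral_wgrad_le x₀ n)

lemma tendsto_initial (x₀ : ℝ) :
    Tendsto (fun n => wsq (step x₀) (A.u n 0) + A.η n * ‖u₀‖ ^ 2) atTop (𝓝 (wsq (step x₀) u₀)) := by
  have h1 : Tendsto (fun n => A.u n 0) atTop (𝓝 u₀) := by
    simp only [A.init]
    exact (tendsto_bandD_zero u₀).comp A.tendsto_k
  simpa using (((continuous_wsq (step x₀)).tendsto u₀).comp h1).add (A.tendsto_η.mul_const (‖u₀‖ ^ 2))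

end Approximation

/-! ### The weak space derivative -/

section TestFunction

variable {θ : ℝ × ℝ → ℂ} (hθ : ContDiff ℝ ∞ θ) (hc : HasCompactSupport θ)

include hθ

lemma hasDerivAt_slice (z : ℝ × ℝ) : HasDerivAt (fun y => θ (z.1, y)) (fderiv ℝ θ z (0, 1)) z.2 := by
  have h1 : HasFDerivAt θ (fderiv ℝ θ z) z := (hθ.differentiable (by simp) z).hasFDerivAt
  have h2 : HasDerivAt (fun y : ℝ => (z.1, y)) ((0 : ℝ), (1 : ℝ)) z.2 :=
    (hasDerivAt_const z.2 z.1).prodMk (hasDerivAt_id z.2)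
  exact h1.comp_hasDerivAt z.2 h2

lemma deriv_slice (z : ℝ × ℝ) : deriv (fun y => θ (z.1, y)) z.2 = fderiv ℝ θ z (0, 1) :=
  (hasDerivAt_slice hθ z).deriv

lemma contDiff_slice (t : ℝ) : ContDiff ℝ ∞ fun y => θ (t, y) := hθ.comp (by fun_prop)

lemma continuous_fderiv_snd : Continuous fun z => fderiv ℝ θ z ((0 : ℝ), (1 : ℝ)) :=
  (hθ.continuous_fderiv (by simp)).clm_apply continuous_const

omit hθ in
include hc in
lemma hasCompactSupport_slice (t : ℝ) : HasCompactSupport fun y => θ (t, y) := by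
  refine HasCompactSupport.intro (K := Prod.snd '' tsupport θ) (hc.isCompact.image continuous_snd) fun y hy => ?_
  by_contra h
  exact hy ⟨(t, y), subset_tsupport _ h, rfl⟩

end TestFunction

namespace Approximation

variable {D : Coeffs} {u₀ : L2} (A : Approximation D u₀)

/-- Integration by parts for the approximations. -/
lemma integral_wave_mul_fderiv (n : ℕ) {θ : ℝ × ℝ → ℂ} (hθ : ContDiff ℝ ∞ θ) (hc : HasCompactSupport θ) :
    ∫ z : ℝ × ℝ, wave (A.k n) 0 (A.u n z.1) z.2 * fderiv ℝ θ z (0, 1) =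
      - ∫ z : ℝ × ℝ, wave (A.k n) 1 (A.u n z.1) z.2 * θ z := by
  have hc' : HasCompactSupport fun z => fderiv ℝ θ z ((0 : ℝ), (1 : ℝ)) := hc.fderiv_apply ℝ _
  have i1 : Integrable (fun z : ℝ × ℝ => wave (A.k n) 0 (A.u n z.1) z.2 * fderiv ℝ θ z (0, 1)) volume :=
    ((continuous_wave_uncurry _ _ (A.continuous n)).mul (continuous_fderiv_snd hθ)).integrable_of_hasCompactSupport
      hc'.mul_left
  have i2 : Integrable (fun z : ℝ × ℝ => wave (A.k n) 1 (A.u n z.1) z.2 * θ z) volume :=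
    ((continuous_wave_uncurry _ _ (A.continuous n)).mul hθ.continuous).integrable_of_hasCompactSupport hc.mul_left
  rw [Measure.volume_eq_prod] at i1 i2 ⊢
  rw [integral_prod _ i1, integral_prod _ i2, ← integral_neg]
  congr 1
  funext t
  have h := IsWeakDeriv.bandD_self (A.k n) 0 (A.u n t) _ (contDiff_slice hθ t) (hasCompactSupport_slice hc t)
  rw [integral_congr_ae (g := fun y => wave (A.k n) 0 (A.u n t) y * deriv (fun y => θ (t, y)) y) (by
      filter_upwards [bandD_ae_eq_wave (A.k n) 0 (A.u n t)] with y hy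
      rw [hy]),
    integral_congr_ae (f := fun y => bandD (A.k n) (0 + 1) (A.u n t) y * θ (t, y))
      (g := fun y => wave (A.k n) 1 (A.u n t) y * θ (t, y)) (by
      filter_upwards [bandD_ae_eq_wave (A.k n) 1 (A.u n t)] with y hy
      simp only [zero_add]
      rw [hy])] at h
  rw [← h]
  congr 1
  funext y
  rw [deriv_slice hθ (t, y)]

section Limit

variable {u : ℝ → L2} (hu : ∀ t, 0 ≤ t → WeakTendsto (fun n => A.u n t) (u t))

include hu

lemma tendsto_integral_wave_mul {T : ℝ} {η : ℝ × ℝ → ℂ} (hη : Continuous η) (hc : HasCompactSupport η)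
    (hs : ∀ z, z ∉ strip T → η z = 0) :
    Tendsto (fun n => ∫ z : ℝ × ℝ, wave (A.k n) 0 (A.u n z.1) z.2 * η z) atTop
      (𝓝 (∫ z : ℝ × ℝ, rep u z.1 z.2 * η z)) := by
  have hηL : MemLp η 2 (volume : Measure (ℝ × ℝ)) := hη.memLp_of_hasCompactSupport hc
  have hslice : ∀ t, MemLp (fun y => η (t, y)) 2 (volume : Measure ℝ) := fun t =>
    Continuous.memLp_of_hasCompactSupport (by fun_prop) (hasCompactSupport_slice hc t)
  have i1 : ∀ n, Integrable (fun z : ℝ × ℝ => wave (A.k n) 0 (A.u n z.1) z.2 * η z) (volume.prod volume) := fun n =>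
    ((continuous_wave_uncurry _ _ (A.continuous n)).mul hη).integrable_of_hasCompactSupport hc.mul_left
  have e0 : (fun z : ℝ × ℝ => rep u z.1 z.2 * η z) =
      fun z => (strip T).indicator (fun z : ℝ × ℝ => rep u z.1 z.2) z * η z := by
    funext z
    by_cases hz : z ∈ strip T
    · rw [indicator_of_mem hz]
    · rw [hs z hz, mul_zero, mul_zero]
  have i2 : Integrable (fun z : ℝ × ℝ => rep u z.1 z.2 * η z) (volume.prod volume) := by
    rw [e0]
    exact (A.memLp_rep_strip hu T).integrable_mul hηL
  have i3 : Integrable (fun t => ∫ y, ‖η (t, y)‖ ^ 2) volume := by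
    have := hηL.norm.integrable_sq
    rw [Measure.volume_eq_prod] at this
    exact this.integral_prod_left
  simp only [Measure.volume_eq_prod]
  rw [integral_prod _ i2]
  simp only [integral_prod _ (i1 _)]
  set Ψ : ℝ → L2 := fun t => (hslice t).star.toLp with hΨ
  have hΨc : ∀ t, Ψ t =ᵐ[volume] fun y => starRingEnd ℂ (η (t, y)) := fun t => (hslice t).star.coeFn_toLp
  have hin : ∀ t (v : L2) (V : ℝ → ℂ), v =ᵐ[volume] V → ∫ y, V y * η (t, y) = inner ℂ (Ψ t) v := by
    intro t v V hV
    rw [inner_eq_integral_of_ae (hΨc t) hV]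
    congr 1; funext y; rw [Complex.conj_conj, mul_comm]
  have hzero : ∀ t, t ∉ Ioo 0 T → ∀ y, η (t, y) = 0 := fun t ht y => hs _ fun h => ht h.1
  have hΨn : ∀ t, ‖Ψ t‖ ^ 2 = ∫ y, ‖η (t, y)‖ ^ 2 := fun t => by
    rw [norm_sq_eq_integral (hΨc t)]
    congr 1; funext y; rw [RCLike.norm_conj]
  refine tendsto_integral_of_dominated_convergence
    (fun t => (∫ y, ‖η (t, y)‖ ^ 2) + (Ioo 0 T).indicator (fun _ => D.size ‖u₀‖ T ^ 2) t)
    (fun n => (i1 n).integral_prod_left.aestronglyMeasurable)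
    (i3.add ((integrable_indicator_iff measurableSet_Ioo).2 (integrableOn_const (by simp)))) (fun n => ?_) ?_
  · refine Eventually.of_forall fun t => ?_
    by_cases ht : t ∈ Ioo 0 T
    · rw [hin t _ _ (A.ae_eq_wave n t), ← hΨn, indicator_of_mem ht]
      have h1 := norm_inner_le_norm (𝕜 := ℂ) (Ψ t) (A.u n t)
      have h2 := A.norm_le' (n := n) ht.1.le ht.2.le
      have h3 : ‖A.u n t‖ ^ 2 ≤ D.size ‖u₀‖ T ^ 2 := by gcongr
      nlinarith [sq_nonneg (‖Ψ t‖ - ‖A.u n t‖), sq_nonneg ‖Ψ t‖, sq_nonneg ‖A.u n t‖]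
    · simp only [hzero t ht, mul_zero, integral_zero, norm_zero, indicator_of_notMem ht]
      simp
  · refine Eventually.of_forall fun t => ?_
    by_cases ht : t ∈ Ioo 0 T
    · rw [hin t _ _ (rep_ae_eq_of_nonneg u ht.1.le).symm]
      exact ((hu t ht.1.le) (Ψ t)).congr fun n => (hin t _ _ (A.ae_eq_wave n t)).symm
    · simp only [hzero t ht, mul_zero]
      exact tendsto_const_nhds

lemma locallyIntegrableOn_rep (T : ℝ) :
    LocallyIntegrableOn (fun z : ℝ × ℝ => rep u z.1 z.2) (strip T) volume := by
  have hs : MeasurableSet (strip T) := measurableSet_Ioo.prod MeasurableSet.univ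
  have h := (memLp_indicator_iff_restrict hs).1 (A.memLp_rep_strip hu T)
  exact locallyIntegrableOn_of_locallyIntegrable_restrict (h.locallyIntegrable (by norm_num))

/-- The weak space derivative of the limit, obtained from the weak limit of the weighted gradients. -/
lemma isWeakXDeriv_of_weakTendsto {G : Lp ℂ 2 (volume : Measure (ℝ × ℝ))}
    (hG : WeakTendsto (fun n => (A.memLp_wgrad 0 n).toLp) G) (T : ℝ) :
    IsWeakXDeriv T (rep u) fun t x => ((dens D ‖u₀‖ 0 (t, x))⁻¹ : ℝ) * G (t, x) := by
  have hd : Continuous fun z => (((dens D ‖u₀‖ 0 z)⁻¹ : ℝ) : ℂ) :=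
    Complex.continuous_ofReal.comp ((continuous_dens D ‖u₀‖ 0).inv₀ fun z => (dens_pos _ _ _ z).ne')
  refine ⟨A.locallyIntegrableOn_rep hu T, ?_, fun θ hθ hc hs => ?_⟩
  · exact (((Lp.memLp G).locallyIntegrable (by norm_num)).continuous_mul hd).locallyIntegrableOn _
  have hs0 : ∀ z, z ∉ strip T → θ z = 0 := fun z hz => image_eq_zero_of_notMem_tsupport fun h => hz (hs h)
  have hs1 : ∀ z, z ∉ strip T → fderiv ℝ θ z (0, 1) = 0 := fun z hz => by
    have : fderiv ℝ θ z = 0 := image_eq_zero_of_notMem_tsupport fun h => hz (hs (tsupport_fderiv_subset ℝ h))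
    rw [this]; rfl
  have hdens : Continuous fun z => (((dens D ‖u₀‖ 0 z)⁻¹ : ℝ) : ℂ) * θ z := hd.mul hθ.continuous
  have hψ : MemLp (fun z => (((dens D ‖u₀‖ 0 z)⁻¹ : ℝ) : ℂ) * θ z) 2 (volume : Measure (ℝ × ℝ)) :=
    hdens.memLp_of_hasCompactSupport hc.mul_left
  have l1 := A.tendsto_integral_wave_mul hu (continuous_fderiv_snd hθ) (hc.fderiv_apply ℝ _) hs1
  have l2 := hG hψ.star.toLp
  have e1 : ∀ n, inner ℂ hψ.star.toLp (A.memLp_wgrad 0 n).toLp =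
      ∫ z : ℝ × ℝ, wave (A.k n) 1 (A.u n z.1) z.2 * θ z := by
    intro n
    rw [inner_eq_integral_of_ae hψ.star.coeFn_toLp (A.memLp_wgrad 0 n).coeFn_toLp]
    congr 1
    funext z
    by_cases hz : z ∈ strip T
    · have hz0 : z ∈ {z : ℝ × ℝ | 0 < z.1} := hz.1.1
      have hne : ((dens D ‖u₀‖ 0 z : ℝ) : ℂ) ≠ 0 := Complex.ofReal_ne_zero.2 (dens_pos _ _ _ z).ne'
      rw [wgrad, indicator_of_mem hz0]
      simp only [Pi.star_apply, RCLike.star_def, Complex.conj_conj, Complex.ofReal_inv]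
      field_simp
    · rw [hs0 z hz]
      simp [hs0 z hz]
  have e2 : inner ℂ hψ.star.toLp G = ∫ z : ℝ × ℝ, ((dens D ‖u₀‖ 0 z)⁻¹ : ℝ) * G z * θ z := by
    rw [inner_eq_integral_of_ae hψ.star.coeFn_toLp (Filter.EventuallyEq.refl _ _)]
    congr 1
    funext z
    simp only [Pi.star_apply, RCLike.star_def, Complex.conj_conj]
    ring
  simp only [e1] at l2
  rw [e2] at l2
  have l3 := l2.neg
  simp only [← A.integral_wave_mul_fderiv _ hθ hc] at l3
  have key := tendsto_nhds_unique l1 l3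
  simp only [deriv_slice hθ]
  rw [setIntegral_eq_integral_of_forall_compl_eq_zero fun z hz => by rw [hs1 z hz, mul_zero],
    setIntegral_eq_integral_of_forall_compl_eq_zero fun z hz => by rw [hs0 z hz, mul_zero]]
  exact key

omit hu in
lemma norm_wgrad_le (n : ℕ) : ‖(A.memLp_wgrad 0 n).toLp‖ ≤ 2 * ‖u₀‖ := by
  refine le_of_sq_le_sq ((A.norm_wgrad_sq_le 0 n).trans ?_) (by positivity)
  have h1 := wsq_step_le 0 (A.u n 0)
  have h2 := norm_bandD_zero_le (A.k n) u₀
  rw [← A.init] at h2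
  have h3 : ‖A.u n 0‖ ^ 2 ≤ ‖u₀‖ ^ 2 := by gcongr
  have h4 : A.η n * ‖u₀‖ ^ 2 ≤ 1 * ‖u₀‖ ^ 2 := by gcongr; exact A.η_le n
  nlinarith [sq_nonneg ‖u₀‖]

omit hu in
/-- The weighted bounds for the gradient pass to the weak limit, for all positions of the weight. -/
lemma lintegral_dens_le {G : Lp ℂ 2 (volume : Measure (ℝ × ℝ))}
    (hG : WeakTendsto (fun n => (A.memLp_wgrad 0 n).toLp) G) (x₀ : ℝ) :
    ∫⁻ z : ℝ × ℝ, ENNReal.ofReal (Real.exp (-D.growth ‖u₀‖ z.1) * bump x₀ z.2) *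
      ‖((dens D ‖u₀‖ 0 z)⁻¹ : ℝ) * G z‖ₑ ^ 2 ≤ ENNReal.ofReal (wsq (step x₀) u₀) := by
  -- the change of the position of the weight is a bounded multiplication operator
  set m : ℝ × ℝ → ℂ := fun z => ((dens D ‖u₀‖ x₀ z * (dens D ‖u₀‖ 0 z)⁻¹ : ℝ) : ℂ) with hm
  have hmc : Continuous m := Complex.continuous_ofReal.comp ((continuous_dens D ‖u₀‖ x₀).mul
    ((continuous_dens D ‖u₀‖ 0).inv₀ fun z => (dens_pos _ _ _ z).ne'))
  have hmL : MemLp m ⊤ volume := memLp_top_of_forall_norm_le hmc.aestronglyMeasurable (C := Real.exp |x₀|) fun z => by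
    have h0 := dens_pos D ‖u₀‖ 0 z
    have h1 := dens_pos D ‖u₀‖ x₀ z
    rw [hm, Complex.norm_real, Real.norm_eq_abs, abs_of_pos (by positivity), ← div_eq_mul_inv, div_le_iff₀ h0]
    exact dens_le _ _ _ _
  have hmw : ∀ n, mulOp m (A.memLp_wgrad 0 n).toLp = (A.memLp_wgrad x₀ n).toLp := by
    intro n
    ext1
    filter_upwards [mulOp_coe hmL (A.memLp_wgrad 0 n).toLp, (A.memLp_wgrad 0 n).coeFn_toLp,
      (A.memLp_wgrad x₀ n).coeFn_toLp] with z h1 h2 h3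
    rw [h1, h2, h3, wgrad, wgrad]
    by_cases hz : z ∈ {z : ℝ × ℝ | 0 < z.1}
    · rw [indicator_of_mem hz, indicator_of_mem hz]
      have hne : ((dens D ‖u₀‖ 0 z : ℝ) : ℂ) ≠ 0 := Complex.ofReal_ne_zero.2 (dens_pos _ _ _ z).ne'
      simp only [hm, Complex.ofReal_mul, Complex.ofReal_inv]
      field_simp
    · rw [indicator_of_notMem hz, indicator_of_notMem hz, mul_zero]
  have hlim := hG.clm (mulOp m)
  simp only [hmw] at hlim
  have hb := norm_sq_le_of_weakTendsto hlim (A.tendsto_initial x₀) fun n => A.norm_wgrad_sq_le x₀ n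
  have e : ∫⁻ z : ℝ × ℝ, ENNReal.ofReal (Real.exp (-D.growth ‖u₀‖ z.1) * bump x₀ z.2) *
      ‖((dens D ‖u₀‖ 0 z)⁻¹ : ℝ) * G z‖ₑ ^ 2 = ∫⁻ z, ‖mulOp m G z‖ₑ ^ 2 := by
    refine lintegral_congr_ae ?_
    filter_upwards [mulOp_coe hmL G] with z hz
    rw [hz, ← dens_sq, ← enorm_sq_mul]
    congr 2
    simp only [hm, Complex.ofReal_mul]
    ring
  rw [e, ← eLpNorm_two_sq, ← Lp.enorm_def, ← ofReal_norm, ← ENNReal.ofReal_pow (norm_nonneg _)]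
  exact ENNReal.ofReal_le_ofReal hb

/-- The limit has a weak space derivative in `(0,∞) × ℝ`, with the weighted bounds. -/
theorem exists_weakXDeriv : ∃ ux : ℝ → ℝ → ℂ, Measurable (fun z : ℝ × ℝ => ux z.1 z.2) ∧
    (∀ x₀, ∫⁻ z : ℝ × ℝ, ENNReal.ofReal (Real.exp (-D.growth ‖u₀‖ z.1) * bump x₀ z.2) *
      ‖ux z.1 z.2‖ₑ ^ 2 ≤ ENNReal.ofReal (wsq (step x₀) u₀)) ∧ ∀ T, IsWeakXDeriv T (rep u) ux := by
  obtain ⟨φ, hφ, hw⟩ := exists_weak_subseq (ι := Unit) (fun _ n => (A.memLp_wgrad 0 n).toLp) (fun _ => 2 * ‖u₀‖)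
    fun _ n => A.norm_wgrad_le n
  obtain ⟨G, hG⟩ := hw ()
  have hG' : WeakTendsto (fun n => ((A.subseq φ hφ).memLp_wgrad 0 n).toLp) G := hG
  refine ⟨fun t x => ((dens D ‖u₀‖ 0 (t, x))⁻¹ : ℝ) * G (t, x), ?_, fun x₀ =>
    (A.subseq φ hφ).lintegral_dens_le hG' x₀, fun T =>
    (A.subseq φ hφ).isWeakXDeriv_of_weakTendsto (fun t ht => (hu t ht).comp hφ) hG' T⟩
  have hd : Continuous fun z => (((dens D ‖u₀‖ 0 z)⁻¹ : ℝ) : ℂ) :=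
    Complex.continuous_ofReal.comp ((continuous_dens D ‖u₀‖ 0).inv₀ fun z => (dens_pos _ _ _ z).ne')
  exact hd.measurable.mul (Lp.stronglyMeasurable G).measurable

end Limit

end Approximation

/-! ### Superposition of steps and the local smoothing bound -/

lemma Coeffs.rate_nonneg (D : Coeffs) (M : ℝ) : 0 ≤ D.rate M := by
  have := D.δ_nonneg
  unfold Coeffs.rate
  positivity

lemma Coeffs.growth_mono (D : Coeffs) {m : ℝ} (hm : 0 ≤ m) {s t : ℝ} (hs : 0 ≤ s) (h : s ≤ t) :
    D.growth m s ≤ D.growth m t := by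
  have h1 : D.rate (D.size m s) ≤ D.rate (D.size m t) := by
    have := D.size_mono hm h
    have := (D.size_pos hm s).le
    unfold Coeffs.rate
    gcongr
  unfold Coeffs.growth
  have := D.rate_nonneg (D.size m s)
  have := hs.trans h
  gcongr

/-- A lower bound of `bump s x` for `|x - s| ≤ 1`. -/
noncomputable def bumpMin : ℝ := Real.sigmoid (-1) ^ 2

lemma bumpMin_pos : 0 < bumpMin := pow_pos (Real.sigmoid_pos _) _

lemma bumpMin_le {s x : ℝ} (h1 : -1 ≤ x - s) (h2 : x - s ≤ 1) : bumpMin ≤ bump s x := by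
  rw [bump_eq, bumpMin, sq]
  have e1 : Real.sigmoid (-1) ≤ Real.sigmoid (x - s) := Real.sigmoid_le h1
  have e2 : Real.sigmoid (-1) ≤ Real.sigmoid (-(x - s)) := Real.sigmoid_le (by linarith)
  exact mul_le_mul e1 e2 (Real.sigmoid_nonneg _) (Real.sigmoid_nonneg _)

lemma continuous_step_uncurry : Continuous fun p : ℝ × ℝ => step p.1 p.2 := by
  unfold step
  exact continuous_sigmoid.comp (by fun_prop)

lemma continuous_bump_uncurry : Continuous fun p : ℝ × ℝ => bump p.1 p.2 := by
  unfold bump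
  exact continuous_step_uncurry.mul (continuous_const.sub continuous_step_uncurry)

/-- Superposition of step profiles with density `ν`. -/
noncomputable def stepSum (ν : ℝ → ℝ≥0∞) (x : ℝ) : ℝ≥0∞ := ∫⁻ s, ν s * ENNReal.ofReal (step s x)

/-- Superposition of bumps with density `ν`. -/
noncomputable def bumpSum (ν : ℝ → ℝ≥0∞) (x : ℝ) : ℝ≥0∞ := ∫⁻ s, ν s * ENNReal.ofReal (bump s x)

section Superposition

variable {ν : ℝ → ℝ≥0∞} (hν : Measurable ν)

include hν

lemma measurable_step_mul {f : ℝ → ℝ≥0∞} (hf : Measurable f) :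
    Measurable fun p : ℝ × ℝ => ν p.1 * ENNReal.ofReal (step p.1 p.2) * f p.2 :=
  ((hν.comp measurable_fst).mul (ENNReal.measurable_ofReal.comp continuous_step_uncurry.measurable)).mul
    (hf.comp measurable_snd)

lemma lintegral_stepSum_mul {f : ℝ → ℝ≥0∞} (hf : Measurable f) :
    ∫⁻ x, stepSum ν x * f x = ∫⁻ s, ν s * ∫⁻ x, ENNReal.ofReal (step s x) * f x := by
  have e1 : ∀ x, stepSum ν x * f x = ∫⁻ s, ν s * ENNReal.ofReal (step s x) * f x := fun x => by
    have h : Measurable fun s => ν s * ENNReal.ofReal (step s x) :=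
      hν.mul (ENNReal.measurable_ofReal.comp (continuous_step_uncurry.measurable.comp measurable_prodMk_right))
    rw [stepSum, lintegral_mul_const _ h]
  have e2 : ∀ s, ν s * ∫⁻ x, ENNReal.ofReal (step s x) * f x = ∫⁻ x, ν s * ENNReal.ofReal (step s x) * f x :=
    fun s => by
    have h : Measurable fun x => ENNReal.ofReal (step s x) * f x :=
      (ENNReal.measurable_ofReal.comp (continuous_step s).measurable).mul hf
    rw [← lintegral_const_mul _ h]
    simp only [mul_assoc]
  simp only [e1, e2]
  exact (lintegral_lintegral_swap (measurable_step_mul hν hf).aemeasurable).symm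

lemma lintegral_bumpSum_mul {μ : Measure (ℝ × ℝ)} [SFinite μ] {f : ℝ × ℝ → ℝ≥0∞} (hf : Measurable f) :
    ∫⁻ z, bumpSum ν z.2 * f z ∂μ = ∫⁻ s, ν s * ∫⁻ z, ENNReal.ofReal (bump s z.2) * f z ∂μ := by
  have e1 : ∀ z : ℝ × ℝ, bumpSum ν z.2 * f z = ∫⁻ s, ν s * ENNReal.ofReal (bump s z.2) * f z := fun z => by
    have h : Measurable fun s => ν s * ENNReal.ofReal (bump s z.2) :=
      hν.mul (ENNReal.measurable_ofReal.comp (continuous_bump_uncurry.measurable.comp measurable_prodMk_right))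
    rw [bumpSum, lintegral_mul_const _ h]
  have e2 : ∀ s, ν s * ∫⁻ z, ENNReal.ofReal (bump s z.2) * f z ∂μ =
      ∫⁻ z, ν s * ENNReal.ofReal (bump s z.2) * f z ∂μ := fun s => by
    have h : Measurable fun z : ℝ × ℝ => ENNReal.ofReal (bump s z.2) * f z :=
      (ENNReal.measurable_ofReal.comp ((continuous_bump s).measurable.comp measurable_snd)).mul hf
    rw [← lintegral_const_mul _ h]
    simp only [mul_assoc]
  simp only [e1, e2]
  refine (lintegral_lintegral_swap (Measurable.aemeasurable ?_)).symm
  have hb : Measurable fun p : ℝ × (ℝ × ℝ) => bump p.1 p.2.2 :=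
    continuous_bump_uncurry.measurable.comp (measurable_fst.prodMk (measurable_snd.comp measurable_snd))
  exact ((hν.comp measurable_fst).mul (ENNReal.measurable_ofReal.comp hb)).mul (hf.comp measurable_snd)

omit hν in
/-- A superposition of bumps is bounded below by the density on a nearby interval of length one. -/
lemma le_bumpSum {x y : ℝ} {m : ℝ≥0∞} (hy1 : x - 1 ≤ y) (hy2 : y ≤ x) (h : ∀ s ∈ Ioo y (y + 1), m ≤ ν s) :
    m * ENNReal.ofReal bumpMin ≤ bumpSum ν x := by
  have h1 : ∫⁻ _s in Ioo y (y + 1), m * ENNReal.ofReal bumpMin = m * ENNReal.ofReal bumpMin := by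
    rw [lintegral_const, Measure.restrict_apply_univ, Real.volume_Ioo]
    simp
  rw [← h1, bumpSum]
  refine (setLIntegral_mono' measurableSet_Ioo fun s hs => ?_).trans (setLIntegral_le_lintegral _ _)
  refine mul_le_mul' (h s hs) (ENNReal.ofReal_le_ofReal (bumpMin_le ?_ ?_))
  · linarith [hs.2]
  · linarith [hs.1]

end Superposition

lemma wsq_step_eq_norm_sq (x₀ : ℝ) (v : L2) :
    wsq (step x₀) v = ‖mulOp (fun x => (Real.sqrt (step x₀ x) : ℂ)) v‖ ^ 2 := by
  have hm : MemLp (fun x => (Real.sqrt (step x₀ x) : ℂ)) ⊤ volume :=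
    memLp_top_ofReal (C := 1) (continuous_step x₀).sqrt fun x => by
      rw [abs_of_nonneg (Real.sqrt_nonneg _)]
      exact Real.sqrt_le_one.2 (step_lt_one _ _).le
  rw [wsq_eq (memLp_top_step x₀) (Filter.EventuallyEq.refl _ _), norm_sq_eq_integral (mulOp_coe hm v)]
  congr 1
  funext x
  rw [norm_mul, mul_pow, Complex.norm_real, Real.norm_eq_abs, sq_abs, Real.sq_sqrt (step_pos _ _).le,
    ← Complex.normSq_eq_norm_sq, Complex.normSq_apply]
  ring

namespace Approximation

variable {D : Coeffs} {u₀ : L2} (A : Approximation D u₀)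

lemma wsq_step_limit_le {u : L2} {t : ℝ} (ht : 0 ≤ t) (hu : WeakTendsto (fun n => A.u n t) u) (x₀ : ℝ) :
    wsq (step x₀) u ≤ Real.exp (D.growth ‖u₀‖ t) * wsq (step x₀) u₀ := by
  rw [wsq_step_eq_norm_sq x₀ u]
  refine norm_sq_le_of_weakTendsto (hu.clm (mulOp fun x => (Real.sqrt (step x₀ x) : ℂ)))
    ((A.tendsto_initial x₀).const_mul (Real.exp (D.growth ‖u₀‖ t))) fun n => ?_
  rw [← wsq_step_eq_norm_sq]
  have h := A.weighted n x₀ t ht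
  have h0 : 0 ≤ ∫ s in (0 : ℝ)..t, Real.exp (-D.growth ‖u₀‖ s) * wsq (bump x₀) (bandD (A.k n) 1 (A.u n s)) :=
    intervalIntegral.integral_nonneg ht fun s _ => mul_nonneg (Real.exp_nonneg _)
      (norm_nonneg_wsq (memLp_top_bump x₀) (fun x => (bump_pos x₀ x).le) _)
  have h1 : Real.exp (-D.growth ‖u₀‖ t) * wsq (step x₀) (A.u n t) ≤ wsq (step x₀) (A.u n 0) + A.η n * ‖u₀‖ ^ 2 := by
    linarith
  rw [Real.exp_neg, inv_mul_le_iff₀ (Real.exp_pos _)] at h1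
  exact h1

/-- Superposition over `x₀` of the estimates with a single step: any weight that is a superposition of
steps propagates. -/
lemma lintegral_stepSum_limit_le {u : L2} {t : ℝ} (ht : 0 ≤ t) (hu : WeakTendsto (fun n => A.u n t) u)
    {ν : ℝ → ℝ≥0∞} (hν : Measurable ν) :
    ∫⁻ x, stepSum ν x * ‖u x‖ₑ ^ 2 ≤
      ENNReal.ofReal (Real.exp (D.growth ‖u₀‖ t)) * ∫⁻ x, stepSum ν x * ‖u₀ x‖ₑ ^ 2 := by
  have hm : ∀ v : L2, Measurable fun x => ‖v x‖ₑ ^ 2 := fun v =>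
    (Lp.stronglyMeasurable v).measurable.enorm.pow_const _
  rw [lintegral_stepSum_mul hν (hm u), lintegral_stepSum_mul hν (hm u₀), ← lintegral_const_mul' _ _ ENNReal.ofReal_ne_top]
  refine lintegral_mono fun s => ?_
  rw [← mul_assoc, mul_comm (ENNReal.ofReal _) (ν s), mul_assoc]
  refine mul_le_mul' le_rfl ?_
  rw [lintegral_wsq (memLp_top_step s) (fun x => (step_pos s x).le) (Filter.EventuallyEq.refl _ _),
    lintegral_wsq (memLp_top_step s) (fun x => (step_pos s x).le) (Filter.EventuallyEq.refl _ _),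
    ← ENNReal.ofReal_mul (Real.exp_nonneg _)]
  exact ENNReal.ofReal_le_ofReal (A.wsq_step_limit_le ht hu s)

end Approximation

section Gradient

variable {D : Coeffs} {u₀ : L2} {ux : ℝ → ℝ → ℂ}
  (hE : ∀ x₀, ∫⁻ z : ℝ × ℝ, ENNReal.ofReal (Real.exp (-D.growth ‖u₀‖ z.1) * bump x₀ z.2) *
      ‖ux z.1 z.2‖ₑ ^ 2 ≤ ENNReal.ofReal (wsq (step x₀) u₀))

include hE

/-- The weighted bound for `u_x` with the time factor removed. -/
lemma lintegral_strip_bump_le (T x₀ : ℝ) : ∫⁻ z in strip T, ENNReal.ofReal (bump x₀ z.2) * ‖ux z.1 z.2‖ₑ ^ 2 ≤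
    ENNReal.ofReal (Real.exp (D.growth ‖u₀‖ T)) * ENNReal.ofReal (wsq (step x₀) u₀) := by
  have hs : MeasurableSet (strip T) := measurableSet_Ioo.prod MeasurableSet.univ
  refine le_trans ?_ (mul_le_mul' le_rfl (hE x₀))
  rw [← lintegral_const_mul' _ _ ENNReal.ofReal_ne_top]
  refine (setLIntegral_mono' hs fun z hz => ?_).trans (setLIntegral_le_lintegral _ _)
  rw [← mul_assoc]
  refine mul_le_mul' ?_ le_rfl
  rw [← ENNReal.ofReal_mul (Real.exp_nonneg _), ← mul_assoc, ← Real.exp_add]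
  refine ENNReal.ofReal_le_ofReal (le_mul_of_one_le_left (bump_pos _ _).le (Real.one_le_exp ?_))
  have := D.growth_mono (norm_nonneg u₀) hz.1.1.le hz.1.2.le
  linarith

/-- The local smoothing bound: the estimate for a single bump is uniform in its position. -/
lemma sigma_le (T : ℝ) : sigma T ux ≤
    ENNReal.ofReal (Real.exp (D.growth ‖u₀‖ T) * ‖u₀‖ ^ 2 / bumpMin) := by
  refine iSup_le fun x₀ => ?_
  have h1 := lintegral_strip_bump_le hE T x₀
  have h2 : ENNReal.ofReal bumpMin * ∫⁻ z in Ioo 0 T ×ˢ Ioo x₀ (x₀ + 1), ‖ux z.1 z.2‖ₑ ^ 2 ≤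
      ENNReal.ofReal (Real.exp (D.growth ‖u₀‖ T) * ‖u₀‖ ^ 2) := by
    rw [← lintegral_const_mul' _ _ ENNReal.ofReal_ne_top]
    calc ∫⁻ z in Ioo 0 T ×ˢ Ioo x₀ (x₀ + 1), ENNReal.ofReal bumpMin * ‖ux z.1 z.2‖ₑ ^ 2
        ≤ ∫⁻ z in Ioo 0 T ×ˢ Ioo x₀ (x₀ + 1), ENNReal.ofReal (bump x₀ z.2) * ‖ux z.1 z.2‖ₑ ^ 2 := by
          refine setLIntegral_mono' (measurableSet_Ioo.prod measurableSet_Ioo) fun z hz => ?_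
          refine mul_le_mul' (ENNReal.ofReal_le_ofReal (bumpMin_le ?_ ?_)) le_rfl
          · linarith [hz.2.1]
          · linarith [hz.2.2]
      _ ≤ ∫⁻ z in strip T, ENNReal.ofReal (bump x₀ z.2) * ‖ux z.1 z.2‖ₑ ^ 2 :=
          lintegral_mono_set (prod_mono le_rfl (subset_univ _))
      _ ≤ _ := h1
      _ ≤ _ := by
          rw [← ENNReal.ofReal_mul (Real.exp_nonneg _)]
          refine ENNReal.ofReal_le_ofReal ?_
          have := Approximation.wsq_step_le x₀ u₀
          gcongr
  rw [ENNReal.ofReal_div_of_pos bumpMin_pos, ENNReal.le_div_iff_mul_le (Or.inl (by simp [bumpMin_pos]))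
    (Or.inl ENNReal.ofReal_ne_top), mul_comm]
  exact h2

/-- If `∫ ν(s) σ(x - s) ds` is integrable against `|u₀|²`, then `u_x` is square integrable with the
weight `∫ ν(s) σ'(x - s) ds`. -/
lemma lintegral_strip_bumpSum_le (hux : Measurable fun z : ℝ × ℝ => ux z.1 z.2) (T : ℝ) {ν : ℝ → ℝ≥0∞}
    (hν : Measurable ν) : ∫⁻ z in strip T, bumpSum ν z.2 * ‖ux z.1 z.2‖ₑ ^ 2 ≤
      ENNReal.ofReal (Real.exp (D.growth ‖u₀‖ T)) * ∫⁻ x, stepSum ν x * ‖u₀ x‖ₑ ^ 2 := by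
  have hm : Measurable fun x => ‖u₀ x‖ₑ ^ 2 := (Lp.stronglyMeasurable u₀).measurable.enorm.pow_const _
  rw [lintegral_bumpSum_mul hν (hux.enorm.pow_const _), lintegral_stepSum_mul hν hm,
    ← lintegral_const_mul' _ _ ENNReal.ofReal_ne_top]
  refine lintegral_mono fun s => ?_
  rw [← mul_assoc, mul_comm (ENNReal.ofReal _) (ν s), mul_assoc]
  refine mul_le_mul' le_rfl ?_
  rw [lintegral_wsq (memLp_top_step s) (fun x => (step_pos s x).le) (Filter.EventuallyEq.refl _ _)]
  exact lintegral_strip_bump_le hE T s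

end Gradient

/-! ### Polynomial weights and weak continuity -/

lemma one_le_powWeight {α : ℝ} (hα : 0 ≤ α) (x : ℝ) : 1 ≤ powWeight α x :=
  Real.one_le_rpow (by linarith [le_max_right x 0]) hα

lemma powWeight_sq (α x : ℝ) : powWeight α x ^ 2 = (1 + max x 0) ^ (2 * α) := by
  have h : 0 ≤ 1 + max x 0 := by linarith [le_max_right x 0]
  rw [powWeight, ← Real.rpow_natCast, ← Real.rpow_mul h]
  congr 1
  push_cast; ring

lemma powWeight_sq_of_nonneg (α : ℝ) {x : ℝ} (hx : 0 ≤ x) : powWeight α x ^ 2 = (1 + x) ^ (2 * α) := by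
  rw [powWeight_sq, max_eq_left hx]

lemma continuous_powWeight {α : ℝ} (hα : 0 ≤ α) : Continuous (powWeight α) := by
  unfold powWeight
  exact Continuous.rpow_const (by fun_prop) fun x => Or.inr hα

/-- The density whose superposition of steps is comparable with `(1 + x₊)^(2α)`. -/
noncomputable def powDens (α : ℝ) : ℝ → ℝ≥0∞ :=
  (Ioi 0).indicator fun s => ENNReal.ofReal ((1 + s) ^ (2 * α - 1))

lemma measurable_powDens (α : ℝ) : Measurable (powDens α) :=
  Measurable.indicator (by fun_prop) measurableSet_Ioi

lemma lintegral_powDens {α : ℝ} (hα : 0 < α) {y : ℝ} (hy : 0 ≤ y) :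
    ∫⁻ s in Ioc 0 y, ENNReal.ofReal ((1 + s) ^ (2 * α - 1)) =
      ENNReal.ofReal (((1 + y) ^ (2 * α) - 1) / (2 * α)) := by
  have hd : ∀ s ∈ uIcc 0 y, HasDerivAt (fun s => (1 + s) ^ (2 * α) / (2 * α)) ((1 + s) ^ (2 * α - 1)) s := by
    intro s hs
    rw [uIcc_of_le hy] at hs
    have h1 : 1 + s ≠ 0 := by linarith [hs.1]
    have h2 := (((hasDerivAt_id s).const_add 1).rpow_const (p := 2 * α) (Or.inl h1)).div_const (2 * α)
    refine h2.congr_deriv ?_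
    simp only [id]
    field_simp
  have hc : ContinuousOn (fun s : ℝ => (1 + s) ^ (2 * α - 1)) (Icc 0 y) := by
    refine ContinuousOn.rpow_const (by fun_prop) fun s hs => Or.inl ?_
    linarith [hs.1]
  have hi : IntervalIntegrable (fun s : ℝ => (1 + s) ^ (2 * α - 1)) volume 0 y :=
    ContinuousOn.intervalIntegrable (by rwa [uIcc_of_le hy])
  rw [← ofReal_integral_eq_lintegral_ofReal hi.1 ?_, ← intervalIntegral.integral_of_le hy,
    intervalIntegral.integral_eq_sub_of_hasDerivAt hd hi]
  · congr 1
    rw [add_zero, Real.one_rpow]; ring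
  · filter_upwards [ae_restrict_mem measurableSet_Ioc] with s hs
    exact Real.rpow_nonneg (by linarith [hs.1]) _

lemma step_le_exp (s x : ℝ) : step s x ≤ Real.exp (x - s) := by
  rw [step, Real.sigmoid_def, inv_le_comm₀ (by positivity) (Real.exp_pos _), ← Real.exp_neg]
  linarith

lemma half_le_step {s x : ℝ} (h : s ≤ x) : 1 / 2 ≤ step s x := by
  have h1 : Real.sigmoid 0 ≤ Real.sigmoid (x - s) := Real.sigmoid_le (by linarith)
  rw [Real.sigmoid_zero] at h1
  rw [step]; linarith

/-- The density `(1+r)^(2α) e^{-r}` on the half line. -/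
noncomputable def tailDens (α : ℝ) : ℝ → ℝ≥0∞ :=
  (Ioi 0).indicator fun r => ENNReal.ofReal ((1 + r) ^ (2 * α) * Real.exp (-r))

lemma lintegral_tailDens_ne_top {α : ℝ} (hα : 0 ≤ α) : ∫⁻ r, tailDens α r ≠ ⊤ := by
  set F : ℝ → ℝ≥0∞ := (Ioi 0).indicator fun x =>
    ENNReal.ofReal (Real.exp 1 * (Real.exp (-x) * x ^ (2 * α + 1 - 1))) with hF
  have h1 : ∫⁻ r, tailDens α r ≤ ∫⁻ r, F (r + 1) := by
    refine lintegral_mono fun r => ?_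
    by_cases hr : r ∈ Ioi (0 : ℝ)
    · have hr1 : r + 1 ∈ Ioi (0 : ℝ) := by
        simp only [mem_Ioi] at hr ⊢; linarith
      rw [tailDens, indicator_of_mem hr, hF, indicator_of_mem hr1]
      refine ENNReal.ofReal_le_ofReal (le_of_eq ?_)
      rw [← mul_assoc, ← Real.exp_add, mul_comm, add_comm 1 r]
      congr 2 <;> ring
    · rw [tailDens, indicator_of_notMem hr]
      exact zero_le
  refine ne_top_of_le_ne_top ?_ h1
  rw [lintegral_add_right_eq_self F 1, hF, lintegral_indicator measurableSet_Ioi]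
  exact (((Real.GammaIntegral_convergent (show 0 < 2 * α + 1 by positivity)).const_mul (Real.exp 1)).lintegral_lt_top).ne

/-- The contribution of `s ≤ x₊` is at most the integral of the density; that of `s > x₊` is controlled by
the exponential decay of the step to the left of its centre. -/
lemma stepSum_powDens_le {α : ℝ} (hα : 0 < α) :
    ∃ C : ℝ≥0∞, C ≠ ⊤ ∧ ∀ x, stepSum (powDens α) x ≤ C * ENNReal.ofReal (powWeight α x ^ 2) := by
  refine ⟨ENNReal.ofReal (1 / (2 * α)) + ∫⁻ r, tailDens α r,
    ENNReal.add_ne_top.2 ⟨ENNReal.ofReal_ne_top, lintegral_tailDens_ne_top hα.le⟩, fun x => ?_⟩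
  set y := max x 0 with hy
  have hy0 : 0 ≤ y := le_max_right _ _
  have hxy : x ≤ y := le_max_left _ _
  have hpt : ∀ s, powDens α s * ENNReal.ofReal (step s x) ≤
      (Ioc 0 y).indicator (fun s => ENNReal.ofReal ((1 + s) ^ (2 * α - 1))) s
        + ENNReal.ofReal ((1 + y) ^ (2 * α)) * tailDens α (s - y) := by
    intro s
    by_cases hs : s ∈ Ioi (0 : ℝ)
    · rw [powDens, indicator_of_mem hs]
      have hs0 : 0 < s := hs
      rcases le_or_gt s y with h | h
      · have hsy : s ∈ Ioc 0 y := ⟨hs0, h⟩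
        rw [indicator_of_mem hsy]
        refine le_trans ?_ le_self_add
        refine mul_le_of_le_one_right' ?_
        rw [← ENNReal.ofReal_one]
        exact ENNReal.ofReal_le_ofReal (step_lt_one s x).le
      · refine le_trans ?_ le_add_self
        rw [tailDens, indicator_of_mem (by simp only [mem_Ioi]; linarith : s - y ∈ Ioi (0 : ℝ)),
          ← ENNReal.ofReal_mul (by positivity), ← ENNReal.ofReal_mul (by positivity)]
        refine ENNReal.ofReal_le_ofReal ?_
        have h1 : (1 + s) ^ (2 * α - 1) ≤ (1 + y) ^ (2 * α) * (1 + (s - y)) ^ (2 * α) := by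
          rw [← Real.mul_rpow (by linarith) (by linarith)]
          calc (1 + s) ^ (2 * α - 1) ≤ (1 + s) ^ (2 * α) :=
                Real.rpow_le_rpow_of_exponent_le (by linarith) (by linarith)
            _ ≤ _ := Real.rpow_le_rpow (by linarith) (by nlinarith) (by linarith)
        have h2 : step s x ≤ Real.exp (-(s - y)) :=
          (step_le_exp s x).trans (Real.exp_le_exp.2 (by linarith))
        rw [← mul_assoc]
        exact mul_le_mul h1 h2 (step_pos s x).le (by have : 0 < 1 + (s - y) := by linarith
                                                     positivity)
    · rw [powDens, indicator_of_notMem hs, zero_mul]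
      exact zero_le
  have hmt : Measurable fun s => tailDens α (s - y) := by
    have : Measurable (tailDens α) := Measurable.indicator (by fun_prop) measurableSet_Ioi
    exact this.comp (by fun_prop)
  refine (lintegral_mono hpt).trans ?_
  rw [lintegral_add_right _ (hmt.const_mul _), lintegral_indicator measurableSet_Ioc, lintegral_powDens hα hy0,
    lintegral_const_mul _ hmt, lintegral_sub_right_eq_self (tailDens α) y, powWeight_sq, add_mul,
    ← ENNReal.ofReal_mul (by positivity), mul_comm (∫⁻ r, tailDens α r)]
  refine add_le_add (ENNReal.ofReal_le_ofReal ?_) le_rfl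
  rw [one_div_mul_eq_div]
  gcongr
  linarith

/-- For `s ≤ x` the step is at least `1 / 2`, so the superposition controls half of the integral of the
density. -/
lemma powWeight_sq_le {α : ℝ} (hα : 0 < α) (x : ℝ) :
    ENNReal.ofReal (powWeight α x ^ 2) ≤ 1 + ENNReal.ofReal (4 * α) * stepSum (powDens α) x := by
  rcases le_or_gt x 0 with hx | hx
  · rw [powWeight_sq, max_eq_right hx]
    simp
  have h1 : ENNReal.ofReal (((1 + x) ^ (2 * α) - 1) / (4 * α)) ≤ stepSum (powDens α) x := by
    have e : ((1 + x) ^ (2 * α) - 1) / (4 * α) = (1 / 2) * (((1 + x) ^ (2 * α) - 1) / (2 * α)) := by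
      field_simp; ring
    rw [e, ENNReal.ofReal_mul (by norm_num), ← lintegral_powDens hα hx.le,
      ← lintegral_const_mul' _ _ ENNReal.ofReal_ne_top, stepSum]
    refine (setLIntegral_mono' measurableSet_Ioc fun s hs => ?_).trans (setLIntegral_le_lintegral _ _)
    rw [powDens, indicator_of_mem (mem_Ioi.2 hs.1), mul_comm]
    exact mul_le_mul' le_rfl (ENNReal.ofReal_le_ofReal (half_le_step hs.2))
  refine le_trans ?_ (add_le_add le_rfl (mul_le_mul' le_rfl h1))
  rw [← ENNReal.ofReal_mul (by positivity), ← ENNReal.ofReal_one, ← ENNReal.ofReal_add zero_le_one,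
    powWeight_sq_of_nonneg _ hx.le]
  · refine ENNReal.ofReal_le_ofReal (le_of_eq ?_)
    field_simp; ring
  · have : 1 ≤ (1 + x) ^ (2 * α) := Real.one_le_rpow (by linarith) (by linarith)
    have : 0 ≤ ((1 + x) ^ (2 * α) - 1) / (4 * α) := div_nonneg (by linarith) (by linarith)
    positivity

/-- Up to a constant, the superposition of bumps dominates the derivative of `(1 + x)^(2α)` on `x ≥ 0`. -/
lemma exists_bumpSum_powDens_ge (α : ℝ) :
    ∃ m : ℝ, 0 < m ∧ ∀ x, 0 ≤ x → ENNReal.ofReal (m * (1 + x) ^ (2 * α - 1)) ≤ bumpSum (powDens α) x := by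
  refine ⟨min 1 (2 ^ (2 * α - 1)) * bumpMin, mul_pos (by positivity) bumpMin_pos, fun x hx => ?_⟩
  rw [mul_right_comm, ENNReal.ofReal_mul' bumpMin_pos.le]
  refine le_bumpSum (y := x) (by linarith) le_rfl fun s hs => ?_
  have hs0 : 0 < s := by linarith [hs.1]
  rw [powDens, indicator_of_mem (mem_Ioi.2 hs0)]
  refine ENNReal.ofReal_le_ofReal ?_
  have hp : 0 ≤ (1 + x) ^ (2 * α - 1) := by positivity
  rcases le_or_gt 0 (2 * α - 1) with h | h
  · calc _ ≤ 1 * (1 + x) ^ (2 * α - 1) := mul_le_mul_of_nonneg_right (min_le_left _ _) hp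
      _ ≤ _ := by rw [one_mul]; exact Real.rpow_le_rpow (by linarith) (by linarith [hs.1]) h
  · calc _ ≤ 2 ^ (2 * α - 1) * (1 + x) ^ (2 * α - 1) := mul_le_mul_of_nonneg_right (min_le_right _ _) hp
      _ = (2 * (1 + x)) ^ (2 * α - 1) := (Real.mul_rpow (by norm_num) (by linarith)).symm
      _ ≤ _ := Real.rpow_le_rpow_of_nonpos (by linarith) (by linarith [hs.2]) h.le

lemma stepSum_le (ν : ℝ → ℝ≥0∞) (x : ℝ) : stepSum ν x ≤ ∫⁻ s, ν s :=
  lintegral_mono fun s => mul_le_of_le_one_right' (by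
    rw [← ENNReal.ofReal_one]; exact ENNReal.ofReal_le_ofReal (step_lt_one s x).le)

lemma lintegral_enorm_sq (v : L2) : ∫⁻ x, ‖v x‖ₑ ^ 2 = ENNReal.ofReal (‖v‖ ^ 2) := by
  rw [← eLpNorm_two_sq, ← Lp.enorm_def, ← ofReal_norm, ENNReal.ofReal_pow (norm_nonneg _)]

lemma lintegral_stepSum_ne_top_of_finite {ν : ℝ → ℝ≥0∞} (h : ∫⁻ s, ν s ≠ ⊤) (v : L2) :
    ∫⁻ x, stepSum ν x * ‖v x‖ₑ ^ 2 ≠ ⊤ := by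
  refine ne_top_of_le_ne_top ?_ (lintegral_mono fun x => mul_le_mul' (stepSum_le ν x) le_rfl)
  rw [lintegral_const_mul' _ _ h, lintegral_enorm_sq]
  exact ENNReal.mul_ne_top h ENNReal.ofReal_ne_top

lemma lintegral_stepSum_powDens_ne_top {α : ℝ} (hα : 0 < α) {v : L2}
    (hv : ∫⁻ x, ENNReal.ofReal (powWeight α x ^ 2) * ‖v x‖ₑ ^ 2 ≠ ⊤) :
    ∫⁻ x, stepSum (powDens α) x * ‖v x‖ₑ ^ 2 ≠ ⊤ := by
  obtain ⟨C, hC, h⟩ := stepSum_powDens_le hα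
  refine ne_top_of_le_ne_top (ENNReal.mul_ne_top hC hv) ?_
  rw [← lintegral_const_mul' _ _ hC]
  refine lintegral_mono fun x => ?_
  rw [← mul_assoc]
  exact mul_le_mul' (h x) le_rfl

lemma tendsto_cut (v : L2) : Tendsto (fun R : ℕ => cut R v) atTop (𝓝 v) := by
  rw [tendsto_iff_norm_sub_tendsto_zero]
  have hsq : ∀ R : ℕ, ‖cut R v - v‖ ^ 2 = ∫ x, ‖(Ioc (-(R : ℝ)) R).indicator v x - v x‖ ^ 2 := fun R => by
    refine norm_sq_eq_integral (F := fun x => (Ioc (-(R : ℝ)) R).indicator v x - v x) ?_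
    filter_upwards [Lp.coeFn_sub (cut R v) v, cut_coe R v] with x h1 h2
    rw [h1, Pi.sub_apply, h2]
  have hlim : Tendsto (fun R : ℕ => ‖cut R v - v‖ ^ 2) atTop (𝓝 0) := by
    simp only [hsq]
    rw [← integral_zero ℝ ℝ]
    refine tendsto_integral_of_dominated_convergence (fun x => ‖v x‖ ^ 2) (fun R => ?_)
      ((memLp_two_iff_integrable_sq_norm (Lp.aestronglyMeasurable v)).1 (Lp.memLp v))
      (fun R => Eventually.of_forall fun x => ?_) (Eventually.of_forall fun x => ?_)
    · exact (((Lp.aestronglyMeasurable v).indicator measurableSet_Ioc).sub (Lp.aestronglyMeasurable v)).norm.pow 2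
    · by_cases hx : x ∈ Ioc (-(R : ℝ)) R
      · simp [indicator_of_mem hx]
      · simp [indicator_of_notMem hx]
    · refine tendsto_const_nhds.congr' ?_
      filter_upwards [eventually_gt_atTop ⌈|x|⌉₊] with R hR
      have h1 : |x| < R := Nat.lt_of_ceil_lt hR
      have hx : x ∈ Ioc (-(R : ℝ)) R := ⟨(abs_lt.1 h1).1, (abs_lt.1 h1).2.le⟩
      simp [indicator_of_mem hx]
  have := hlim.sqrt
  simpa [Real.sqrt_sq] using this

namespace Approximation

variable {D : Coeffs} {u₀ : L2} (A : Approximation D u₀)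

section Limit

variable {u : ℝ → L2} (hu : ∀ t, 0 ≤ t → WeakTendsto (fun n => A.u n t) (u t))

include hu

/-- Propagation of the weight `(1 + x₊)^α`. -/
lemma exists_powWeight_bound {α : ℝ} (hα : 0 ≤ α)
    (h0 : ∫⁻ x, ENNReal.ofReal (powWeight α x ^ 2) * ‖u₀ x‖ₑ ^ 2 ≠ ⊤) (T : ℝ) :
    ∃ C : ℝ≥0∞, C ≠ ⊤ ∧ ∀ t ∈ Icc 0 T, ∫⁻ x, ENNReal.ofReal (powWeight α x ^ 2) * ‖u t x‖ₑ ^ 2 ≤ C := by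
  have hM : ∀ t ∈ Icc 0 T, ∫⁻ x, ‖u t x‖ₑ ^ 2 ≤ ENNReal.ofReal (D.size ‖u₀‖ T ^ 2) := fun t ht => by
    rw [lintegral_enorm_sq]
    have := A.norm_limit_le' hu ht.1 ht.2
    exact ENNReal.ofReal_le_ofReal (by gcongr)
  rcases hα.eq_or_lt with rfl | hα
  · refine ⟨ENNReal.ofReal (D.size ‖u₀‖ T ^ 2), ENNReal.ofReal_ne_top, fun t ht => ?_⟩
    simp only [powWeight, Real.rpow_zero, one_pow, ENNReal.ofReal_one, one_mul]
    exact hM t ht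
  have hI := lintegral_stepSum_powDens_ne_top hα h0
  refine ⟨ENNReal.ofReal (D.size ‖u₀‖ T ^ 2) + ENNReal.ofReal (4 * α) *
    (ENNReal.ofReal (Real.exp (D.growth ‖u₀‖ T)) * ∫⁻ x, stepSum (powDens α) x * ‖u₀ x‖ₑ ^ 2),
    ENNReal.add_ne_top.2 ⟨ENNReal.ofReal_ne_top, ENNReal.mul_ne_top ENNReal.ofReal_ne_top
      (ENNReal.mul_ne_top ENNReal.ofReal_ne_top hI)⟩, fun t ht => ?_⟩
  have hm : Measurable fun x => ‖u t x‖ₑ ^ 2 := (Lp.stronglyMeasurable (u t)).measurable.enorm.pow_const _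
  calc ∫⁻ x, ENNReal.ofReal (powWeight α x ^ 2) * ‖u t x‖ₑ ^ 2
      ≤ ∫⁻ x, (‖u t x‖ₑ ^ 2 + ENNReal.ofReal (4 * α) * (stepSum (powDens α) x * ‖u t x‖ₑ ^ 2)) := by
        refine lintegral_mono fun x => ?_
        refine (mul_le_mul' (powWeight_sq_le hα x) le_rfl).trans (le_of_eq ?_)
        rw [add_mul, one_mul, mul_assoc]
    _ = (∫⁻ x, ‖u t x‖ₑ ^ 2) + ENNReal.ofReal (4 * α) * ∫⁻ x, stepSum (powDens α) x * ‖u t x‖ₑ ^ 2 := by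
        rw [lintegral_add_left hm, lintegral_const_mul' _ _ ENNReal.ofReal_ne_top]
    _ ≤ _ := by
        refine add_le_add (hM t ht) (mul_le_mul' le_rfl ?_)
        refine (A.lintegral_stepSum_limit_le ht.1 (hu t ht.1) (measurable_powDens α)).trans ?_
        refine mul_le_mul' (ENNReal.ofReal_le_ofReal (Real.exp_le_exp.2 ?_)) le_rfl
        exact D.growth_mono (norm_nonneg _) ht.1 ht.2

/-- Weak continuity in `L_2^α`: the weighted norms are bounded, and compactly supported functions
are dense. -/
lemma weaklyContinuous_rep {α : ℝ} (hα : 0 ≤ α)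
    (h0 : ∫⁻ x, ENNReal.ofReal (powWeight α x ^ 2) * ‖u₀ x‖ₑ ^ 2 ≠ ⊤) (T : ℝ) :
    WeaklyContinuous T α (rep u) := by
  obtain ⟨C, hC, hb⟩ := A.exists_powWeight_bound hu hα h0 T
  have hcp : Continuous fun x => (powWeight α x : ℂ) := Complex.continuous_ofReal.comp (continuous_powWeight hα)
  have hlin : ∀ t ∈ Icc 0 T, ∫⁻ x, ‖(powWeight α x : ℂ) * rep u t x‖ₑ ^ 2 ≤ C := fun t ht => by
    refine le_trans (le_of_eq (lintegral_congr_ae ?_)) (hb t ht)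
    filter_upwards [rep_ae_eq_of_nonneg u ht.1] with x hx
    rw [enorm_sq_mul, hx]
  have hmem : ∀ t ∈ Icc 0 T, MemL2Alpha α (rep u t) := fun t ht =>
    memLp_two_of_lintegral (hcp.aestronglyMeasurable.mul
      ((Lp.stronglyMeasurable (u t)).aestronglyMeasurable.congr (rep_ae_eq_of_nonneg u ht.1).symm))
      (ne_top_of_le_ne_top hC (hlin t ht))
  refine ⟨hmem, fun ψ hψ => ?_⟩
  set Ψ : L2 := hψ.toLp with hΨ
  have hΨc : Ψ =ᵐ[volume] fun x => (powWeight α x : ℂ) * ψ x := hψ.coeFn_toLp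
  refine continuousOn_of_uniform_approx_of_continuousOn fun V hV => ?_
  obtain ⟨r, hr, hrV⟩ := Metric.mem_uniformity_dist.1 hV
  have hM : 0 < Real.sqrt C.toReal + 1 := by positivity
  obtain ⟨R, hR⟩ := ((tendsto_cut Ψ).eventually (Metric.ball_mem_nhds Ψ
      (show 0 < r / (Real.sqrt C.toReal + 1) by positivity))).exists
  rw [dist_comm, dist_eq_norm] at hR
  -- on a bounded interval the weight is bounded, so it can be moved to the other factor
  obtain ⟨B, hB⟩ := (isCompact_Icc (a := -(R : ℝ)) (b := R)).exists_bound_of_continuousOn hcp.continuousOn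
  have hχ : MemLp ((Ioc (-(R : ℝ)) R).indicator fun x => (powWeight α x : ℂ)) ⊤ volume := by
    refine memLp_top_of_bound (hcp.aestronglyMeasurable.indicator measurableSet_Ioc) (max B 0)
      (Eventually.of_forall fun x => ?_)
    by_cases hx : x ∈ Ioc (-(R : ℝ)) R
    · rw [indicator_of_mem hx]
      exact (hB x (Ioc_subset_Icc_self hx)).trans (le_max_left _ _)
    · rw [indicator_of_notMem hx, norm_zero]
      exact le_max_right _ _
  set Φ : L2 := mulOp ((Ioc (-(R : ℝ)) R).indicator fun x => (powWeight α x : ℂ)) Ψ with hΦ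
  refine ⟨fun t => inner ℂ Φ (u t), A.continuousOn_inner_limit hu T Φ, fun t ht => hrV ?_⟩
  set W : L2 := (hmem t ht).toLp with hW
  have hWc : W =ᵐ[volume] fun x => (powWeight α x : ℂ) * rep u t x := (hmem t ht).coeFn_toLp
  have e1 : ∫ x, ((powWeight α x : ℂ) * rep u t x) * starRingEnd ℂ ((powWeight α x : ℂ) * ψ x) =
      inner ℂ Ψ W := by
    rw [inner_eq_integral_of_ae hΨc hWc]
    exact integral_congr_ae (Eventually.of_forall fun x => mul_comm _ _)
  have e2 : inner ℂ Φ (u t) = inner ℂ (cut R Ψ) W := by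
    rw [inner_eq_integral_of_ae (mulOp_coe hχ Ψ) (rep_ae_eq_of_nonneg u ht.1).symm,
      inner_eq_integral_of_ae (cut_coe R Ψ) hWc]
    refine integral_congr_ae (Eventually.of_forall fun x => ?_)
    by_cases hx : x ∈ Ioc (-(R : ℝ)) R
    · simp only [indicator_of_mem hx, map_mul, Complex.conj_ofReal]
      ring
    · simp [indicator_of_notMem hx]
  have hWn : ‖W‖ ≤ Real.sqrt C.toReal := by
    refine Real.le_sqrt_of_sq_le ?_
    have h1 : ENNReal.ofReal (‖W‖ ^ 2) ≤ C := by
      rw [← lintegral_enorm_sq]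
      refine le_trans (le_of_eq (lintegral_congr_ae ?_)) (hlin t ht)
      filter_upwards [hWc] with x hx
      rw [hx]
    exact (ENNReal.ofReal_le_iff_le_toReal hC).1 h1
  beta_reduce
  rw [e1, dist_eq_norm, e2, ← inner_sub_left]
  calc _ ≤ ‖Ψ - cut R Ψ‖ * ‖W‖ := norm_inner_le_norm _ _
    _ ≤ ‖Ψ - cut R Ψ‖ * (Real.sqrt C.toReal + 1) := by
      gcongr
      linarith
    _ < (r / (Real.sqrt C.toReal + 1)) * (Real.sqrt C.toReal + 1) := by gcongr
    _ = r := by field_simp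

end Limit

end Approximation

/-! ### The weights `ρ'` -/

lemma IsRhoWeight.deriv_left {α ε : ℝ} {ρ : ℝ → ℝ} (h : IsRhoWeight α ε ρ) {x : ℝ} (hx : x < -1) :
    deriv ρ x = Real.exp (2 * ε * x) * (2 * ε) := by
  have e : ρ =ᶠ[𝓝 x] fun y => Real.exp (2 * ε * y) := by
    filter_upwards [Iio_mem_nhds hx] with y hy
    exact h.left y (le_of_lt hy)
  rw [e.deriv_eq]
  have := ((hasDerivAt_id x).const_mul (2 * ε)).exp
  simpa using this.deriv

lemma IsRhoWeight.deriv_right_of_pos {α ε : ℝ} {ρ : ℝ → ℝ} (h : IsRhoWeight α ε ρ) (hα : 0 < α) {x : ℝ}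
    (hx : 0 < x) : deriv ρ x = 2 * α * (1 + x) ^ (2 * α - 1) := by
  have e : ρ =ᶠ[𝓝 x] fun y => (1 + y) ^ (2 * α) := by
    filter_upwards [Ioi_mem_nhds hx] with y hy
    exact h.right_pos hα y (le_of_lt hy)
  rw [e.deriv_eq]
  have h1 : 1 + x ≠ 0 := by linarith
  have := ((hasDerivAt_id x).const_add 1).rpow_const (p := 2 * α) (Or.inl h1)
  simpa using this.deriv

/-- The derivative of `-1 / ln (x + e)`. -/
noncomputable def logDens (x : ℝ) : ℝ := ((x + Real.exp 1) * Real.log (x + Real.exp 1) ^ 2)⁻¹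

lemma one_le_log_add_exp {x : ℝ} (hx : 0 ≤ x) : 1 ≤ Real.log (x + Real.exp 1) := by
  have := Real.log_le_log (Real.exp_pos 1) (show Real.exp 1 ≤ x + Real.exp 1 by linarith)
  rwa [Real.log_exp] at this

lemma hasDerivAt_neg_inv_log {x : ℝ} (hx : 0 ≤ x) :
    HasDerivAt (fun x => -(Real.log (x + Real.exp 1))⁻¹) (logDens x) x := by
  have h1 : x + Real.exp 1 ≠ 0 := by have := Real.exp_pos 1; linarith
  have h2 : Real.log (x + Real.exp 1) ≠ 0 := by have := one_le_log_add_exp hx; linarith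
  have := ((((hasDerivAt_id x).add_const (Real.exp 1)).log h1).inv h2).neg
  refine this.congr_deriv ?_
  simp only [id, logDens]
  field_simp

lemma logDens_nonneg {x : ℝ} (hx : 0 ≤ x) : 0 ≤ logDens x := by
  have := Real.exp_pos 1
  unfold logDens
  positivity

lemma logDens_anti {s x : ℝ} (hs : 0 ≤ s) (h : s ≤ x) : logDens x ≤ logDens s := by
  have h0 := Real.exp_pos 1
  have h1 := one_le_log_add_exp hs
  have h2 : Real.log (s + Real.exp 1) ≤ Real.log (x + Real.exp 1) := Real.log_le_log (by linarith) (by linarith)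
  have h3 : 0 ≤ x + Real.exp 1 := by linarith
  have h4 : 0 < s + Real.exp 1 := by linarith
  unfold logDens
  gcongr

lemma integrableOn_logDens : IntegrableOn logDens (Ioi 0) := by
  refine integrableOn_Ioi_deriv_of_nonneg' (fun x hx => hasDerivAt_neg_inv_log hx)
    (fun x hx => logDens_nonneg (le_of_lt hx)) (l := -0) ?_
  exact ((Real.tendsto_log_atTop.comp (tendsto_atTop_add_const_right _ _ tendsto_id)).inv_tendsto_atTop).neg

lemma IsRhoWeight.deriv_right_zero {ε : ℝ} {ρ : ℝ → ℝ} (h : IsRhoWeight 0 ε ρ) {x : ℝ} (hx : 0 < x) :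
    deriv ρ x = logDens x := by
  have e : ρ =ᶠ[𝓝 x] fun y => 2 + -(Real.log (y + Real.exp 1))⁻¹ := by
    filter_upwards [Ioi_mem_nhds hx] with y hy
    rw [h.right_zero rfl y (le_of_lt hy), sub_eq_add_neg]
  rw [e.deriv_eq]
  exact ((hasDerivAt_neg_inv_log hx.le).const_add 2).deriv

lemma ofReal_le_inv_mul {r : ℝ} {m : ℝ} (hm : 0 < m) {S : ℝ≥0∞}
    (h : ENNReal.ofReal r * ENNReal.ofReal m ≤ S) : ENNReal.ofReal r ≤ ENNReal.ofReal m⁻¹ * S := by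
  refine le_trans (le_of_eq ?_) (mul_le_mul' le_rfl h)
  rw [mul_comm, mul_assoc, ← ENNReal.ofReal_mul hm.le, mul_inv_cancel₀ hm.ne', ENNReal.ofReal_one, mul_one]

/-- Far to the left, `ρ'` is dominated by a superposition of bumps of finite total mass. -/
lemma IsRhoWeight.exists_left {α ε : ℝ} (hε : 0 < ε) {ρ : ℝ → ℝ} (h : IsRhoWeight α ε ρ) (v : L2) :
    ∃ ν : ℝ → ℝ≥0∞, Measurable ν ∧ ∫⁻ x, stepSum ν x * ‖v x‖ₑ ^ 2 ≠ ⊤ ∧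
      ∃ C : ℝ≥0∞, C ≠ ⊤ ∧ ∀ x < -2, ENNReal.ofReal (deriv ρ x) ≤ C * bumpSum ν x := by
  set ν : ℝ → ℝ≥0∞ := (Iic (-1)).indicator fun s => ENNReal.ofReal (Real.exp (2 * ε * s) * (2 * ε)) with hν
  refine ⟨ν, Measurable.indicator (by fun_prop) measurableSet_Iic, lintegral_stepSum_ne_top_of_finite ?_ v,
    ENNReal.ofReal bumpMin⁻¹, ENNReal.ofReal_ne_top, fun x hx => ofReal_le_inv_mul bumpMin_pos ?_⟩
  · rw [hν, lintegral_indicator measurableSet_Iic]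
    exact ((integrableOn_exp_mul_Iic (by positivity) _).mul_const _).lintegral_lt_top.ne
  · refine le_bumpSum (y := x) (by linarith) le_rfl fun s hs => ?_
    have hs1 : s ∈ Iic (-1 : ℝ) := by simp only [mem_Iic]; linarith [hs.2]
    rw [hν, indicator_of_mem hs1, h.deriv_left (by linarith)]
    refine ENNReal.ofReal_le_ofReal ?_
    have := hs.1.le
    gcongr

/-- Far to the right, `ρ'` is dominated by a superposition of bumps of which the same superposition
of steps is controlled by `(1 + x₊)^(2α)`. -/
lemma IsRhoWeight.exists_right {α ε : ℝ} (hα : 0 ≤ α) {ρ : ℝ → ℝ} (h : IsRhoWeight α ε ρ) {v : L2}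
    (hv : ∫⁻ x, ENNReal.ofReal (powWeight α x ^ 2) * ‖v x‖ₑ ^ 2 ≠ ⊤) :
    ∃ ν : ℝ → ℝ≥0∞, Measurable ν ∧ ∫⁻ x, stepSum ν x * ‖v x‖ₑ ^ 2 ≠ ⊤ ∧
      ∃ C : ℝ≥0∞, C ≠ ⊤ ∧ ∀ x > 1, ENNReal.ofReal (deriv ρ x) ≤ C * bumpSum ν x := by
  rcases hα.eq_or_lt with rfl | hα
  · set ν : ℝ → ℝ≥0∞ := (Ioi 0).indicator fun s => ENNReal.ofReal (logDens s) with hν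
    have hmeas : Measurable logDens := by unfold logDens; fun_prop
    refine ⟨ν, Measurable.indicator (by fun_prop) measurableSet_Ioi, lintegral_stepSum_ne_top_of_finite ?_ v,
      ENNReal.ofReal bumpMin⁻¹, ENNReal.ofReal_ne_top, fun x hx => ofReal_le_inv_mul bumpMin_pos ?_⟩
    · rw [hν, lintegral_indicator measurableSet_Ioi]
      exact integrableOn_logDens.lintegral_lt_top.ne
    · refine le_bumpSum (y := x - 1) le_rfl (by linarith) fun s hs => ?_
      have hs1 : 0 < s := by linarith [hs.1]
      rw [hν, indicator_of_mem (mem_Ioi.2 hs1), h.deriv_right_zero (by linarith)]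
      exact ENNReal.ofReal_le_ofReal (logDens_anti hs1.le (by linarith [hs.2]))
  · obtain ⟨m, hm, hb⟩ := exists_bumpSum_powDens_ge α
    refine ⟨powDens α, measurable_powDens α, lintegral_stepSum_powDens_ne_top hα hv,
      ENNReal.ofReal (2 * α / m), ENNReal.ofReal_ne_top, fun x hx => ?_⟩
    refine le_trans (le_of_eq ?_) (mul_le_mul' le_rfl (hb x (by linarith)))
    rw [h.deriv_right_of_pos hα (by linarith), ← ENNReal.ofReal_mul (by positivity)]
    congr 1
    field_simp

section Gradient

variable {D : Coeffs} {u₀ : L2} {ux : ℝ → ℝ → ℂ}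
  (hE : ∀ x₀, ∫⁻ z : ℝ × ℝ, ENNReal.ofReal (Real.exp (-D.growth ‖u₀‖ z.1) * bump x₀ z.2) *
      ‖ux z.1 z.2‖ₑ ^ 2 ≤ ENNReal.ofReal (wsq (step x₀) u₀))

include hE

/-- The weight `ρ'` is bounded by superpositions of bumps: far to the left and far to the right by
`IsRhoWeight.exists_left` and `IsRhoWeight.exists_right`, and on `[-2, 1]` by a multiple of one bump. -/
lemma memL2L2Weighted_deriv_rho (hux : Measurable fun z : ℝ × ℝ => ux z.1 z.2) (T : ℝ) {α ε : ℝ} (hα : 0 ≤ α)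
    (hε : 0 < ε) {ρ : ℝ → ℝ} (h : IsRhoWeight α ε ρ)
    (h0 : ∫⁻ x, ENNReal.ofReal (powWeight α x ^ 2) * ‖u₀ x‖ₑ ^ 2 ≠ ⊤) :
    MemL2L2Weighted T (deriv ρ) ux := by
  have hcd : Continuous (deriv ρ) := h.smooth.continuous_deriv (by simp)
  obtain ⟨ν₁, hν₁, hf₁, C₁, hC₁, hb₁⟩ := h.exists_left hε u₀
  obtain ⟨ν₂, hν₂, hf₂, C₂, hC₂, hb₂⟩ := h.exists_right hα h0
  obtain ⟨B, hB⟩ := (isCompact_Icc (a := (-2 : ℝ)) (b := 1)).exists_bound_of_continuousOn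
    (hcd.mul ((continuous_bump 0).inv₀ fun x => (bump_pos 0 x).ne')).continuousOn
  have hpt : ∀ x, ENNReal.ofReal (deriv ρ x) ≤
      ENNReal.ofReal B * ENNReal.ofReal (bump 0 x) + (C₁ * bumpSum ν₁ x + C₂ * bumpSum ν₂ x) := by
    intro x
    rcases lt_or_ge x (-2) with hx | hx
    · exact (hb₁ x hx).trans (le_self_add.trans le_add_self)
    rcases le_or_gt x 1 with hx1 | hx1
    · refine le_trans ?_ le_self_add
      have h1 := (le_abs_self _).trans (hB x ⟨hx, hx1⟩)
      rw [Pi.mul_apply, Pi.inv_apply, ← div_eq_mul_inv, div_le_iff₀ (bump_pos 0 x)] at h1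
      rw [← ENNReal.ofReal_mul' (bump_pos 0 x).le]
      exact ENNReal.ofReal_le_ofReal h1
    · exact (hb₂ x hx1).trans (le_add_self.trans le_add_self)
  refine memLp_two_of_lintegral ?_ ?_
  · have h1 : Measurable fun z : ℝ × ℝ => ((Real.sqrt (deriv ρ z.2) : ℝ) : ℂ) :=
      (Complex.continuous_ofReal.comp (hcd.sqrt.comp continuous_snd)).measurable
    exact (h1.mul hux).aestronglyMeasurable
  have hbm : ∀ ν : ℝ → ℝ≥0∞, Measurable ν → Measurable fun z : ℝ × ℝ => bumpSum ν z.2 * ‖ux z.1 z.2‖ₑ ^ 2 :=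
    fun ν hν => by
    have h1 : Measurable (bumpSum ν) := by
      have : Measurable fun p : ℝ × ℝ => ν p.2 * ENNReal.ofReal (bump p.2 p.1) :=
        (hν.comp measurable_snd).mul (ENNReal.measurable_ofReal.comp
          (continuous_bump_uncurry.measurable.comp measurable_swap))
      exact this.lintegral_prod_right'
    exact (h1.comp measurable_snd).mul (hux.enorm.pow_const _)
  have hb0 : Measurable fun z : ℝ × ℝ => ENNReal.ofReal (bump 0 z.2) * ‖ux z.1 z.2‖ₑ ^ 2 :=
    (ENNReal.measurable_ofReal.comp ((continuous_bump 0).measurable.comp measurable_snd)).mul (hux.enorm.pow_const _)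
  refine ne_top_of_le_ne_top (b := ENNReal.ofReal B * (∫⁻ z in strip T, ENNReal.ofReal (bump 0 z.2) * ‖ux z.1 z.2‖ₑ ^ 2)
      + (C₁ * (∫⁻ z in strip T, bumpSum ν₁ z.2 * ‖ux z.1 z.2‖ₑ ^ 2)
        + C₂ * ∫⁻ z in strip T, bumpSum ν₂ z.2 * ‖ux z.1 z.2‖ₑ ^ 2)) ?_ ?_
  · have hfin : ∀ {S X : ℝ≥0∞}, X ≠ ⊤ → S ≤ ENNReal.ofReal (Real.exp (D.growth ‖u₀‖ T)) * X → S ≠ ⊤ :=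
      fun hX hS => ne_top_of_le_ne_top (ENNReal.mul_ne_top ENNReal.ofReal_ne_top hX) hS
    refine ENNReal.add_ne_top.2 ⟨ENNReal.mul_ne_top ENNReal.ofReal_ne_top ?_,
      ENNReal.add_ne_top.2 ⟨ENNReal.mul_ne_top hC₁ ?_, ENNReal.mul_ne_top hC₂ ?_⟩⟩
    · exact hfin ENNReal.ofReal_ne_top (lintegral_strip_bump_le hE T 0)
    · exact hfin hf₁ (lintegral_strip_bumpSum_le hE hux T hν₁)
    · exact hfin hf₂ (lintegral_strip_bumpSum_le hE hux T hν₂)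
  · rw [← lintegral_const_mul' _ _ ENNReal.ofReal_ne_top, ← lintegral_const_mul' _ _ hC₁,
      ← lintegral_const_mul' _ _ hC₂, ← lintegral_add_left ((hbm ν₁ hν₁).const_mul _),
      ← lintegral_add_left (hb0.const_mul _)]
    refine lintegral_mono fun z => ?_
    -- also valid for negative values, where both sides vanish
    have e : ENNReal.ofReal (Real.sqrt (deriv ρ z.2) ^ 2) = ENNReal.ofReal (deriv ρ z.2) := by
      rcases le_or_gt 0 (deriv ρ z.2) with hp | hp
      · rw [Real.sq_sqrt hp]
      · rw [Real.sqrt_eq_zero_of_nonpos hp.le, ENNReal.ofReal_of_nonpos hp.le]; simp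
    simp only
    rw [enorm_sq_mul, e]
    refine (mul_le_mul' (hpt z.2) le_rfl).trans (le_of_eq ?_)
    ring

end Gradient

/-! ### Limits of the nonlinear terms -/

lemma integral_norm_mul_norm_le (f g : L2) : ∫ x, ‖f x‖ * ‖g x‖ ≤ ‖f‖ * ‖g‖ := by
  have h := integral_mul_norm_le_Lp_mul_Lq (μ := volume) (f := f) (g := g) Real.HolderConjugate.two_two
    (by simpa using Lp.memLp f) (by simpa using Lp.memLp g)
  have e : ∀ v : L2, (∫ x, ‖v x‖ ^ (2 : ℝ)) ^ (1 / 2 : ℝ) = ‖v‖ := fun v => by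
    simp only [Real.rpow_two]
    rw [← norm_sq_eq_integral (Filter.EventuallyEq.refl _ _), ← Real.sqrt_eq_rpow, Real.sqrt_sq (norm_nonneg _)]
  rwa [e f, e g] at h

lemma integrable_norm_mul_norm (f g : L2) : Integrable (fun x => ‖f x‖ * ‖g x‖) volume := by
  have := (integrable_mul_L2 (Lp.memLp f) (Lp.memLp g)).norm
  simpa only [norm_mul] using this

/-- Stability of the cubic form: a bounded weight that is small outside `(-R, R]` only sees the
difference of the arguments on `(-R, R]`. -/
lemma norm_inner_truncOp_sub_le {ψ : L2} {F : ℝ → ℂ} (hF : ψ =ᵐ[volume] F) {B r R : ℝ} (hB0 : 0 ≤ B)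
    (hr : 0 ≤ r) (hB : ∀ x, ‖F x‖ ≤ B) (hR : ∀ x ∉ Ioc (-R) R, ‖F x‖ ≤ r) (N : ℝ≥0) (v w : L2) {M : ℝ}
    (hv : ‖v‖ ≤ M) (hw : ‖w‖ ≤ M) :
    ‖inner ℂ ψ (truncOp N v) - inner ℂ ψ (truncOp N w)‖ ≤ 2 * M * (B * ‖cut R (v - w)‖ + r * (2 * M)) := by
  have hM : 0 ≤ M := (norm_nonneg _).trans hv
  rw [← inner_sub_right]
  have hd : (truncOp N v - truncOp N w : L2) =ᵐ[volume] fun x => trunc N (v x) - trunc N (w x) := by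
    filter_upwards [Lp.coeFn_sub (truncOp N v) (truncOp N w), truncOp_coe N v, truncOp_coe N w] with x h1 h2 h3
    rw [h1, Pi.sub_apply, h2, h3]
  rw [inner_eq_integral_of_ae hF hd]
  set c : L2 := cut R (v - w) with hc
  set e : L2 := v - w with he
  have i1 := integrable_norm_mul_norm c v
  have i2 := integrable_norm_mul_norm c w
  have i3 := integrable_norm_mul_norm e v
  have i4 := integrable_norm_mul_norm e w
  have h1 : ‖∫ x, starRingEnd ℂ (F x) * (trunc N (v x) - trunc N (w x))‖ ≤
      ∫ x, (B * (‖c x‖ * ‖v x‖ + ‖c x‖ * ‖w x‖) + r * (‖e x‖ * ‖v x‖ + ‖e x‖ * ‖w x‖)) := by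
    refine norm_integral_le_of_norm_le (((i1.add i2).const_mul B).add ((i3.add i4).const_mul r)) ?_
    filter_upwards [cut_coe R (v - w), Lp.coeFn_sub v w] with x h1 h2
    rw [norm_mul, RCLike.norm_conj]
    have h3 : ‖trunc N (v x) - trunc N (w x)‖ ≤ (‖v x‖ + ‖w x‖) * ‖e x‖ := by
      rw [he, h2, Pi.sub_apply]
      refine (norm_trunc_sub_le N _ _).trans ?_
      gcongr
      · exact min_le_left _ _
      · exact min_le_left _ _
    have h4 : ‖F x‖ * ‖e x‖ ≤ B * ‖c x‖ + r * ‖e x‖ := by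
      by_cases hx : x ∈ Ioc (-R) R
      · rw [hc, h1, indicator_of_mem hx, ← he]
        have := mul_le_mul_of_nonneg_right (hB x) (norm_nonneg (e x))
        have := mul_nonneg hr (norm_nonneg (e x))
        linarith
      · have := mul_le_mul_of_nonneg_right (hR x hx) (norm_nonneg (e x))
        have := mul_nonneg hB0 (norm_nonneg (c x))
        linarith
    calc ‖F x‖ * ‖trunc N (v x) - trunc N (w x)‖ ≤ ‖F x‖ * ((‖v x‖ + ‖w x‖) * ‖e x‖) := by gcongr
      _ = (‖v x‖ + ‖w x‖) * (‖F x‖ * ‖e x‖) := by ring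
      _ ≤ (‖v x‖ + ‖w x‖) * (B * ‖c x‖ + r * ‖e x‖) := by gcongr
      _ = _ := by ring
  refine h1.trans ?_
  have e1 : ∫ x, (B * (‖c x‖ * ‖v x‖ + ‖c x‖ * ‖w x‖) + r * (‖e x‖ * ‖v x‖ + ‖e x‖ * ‖w x‖)) =
      B * ((∫ x, ‖c x‖ * ‖v x‖) + ∫ x, ‖c x‖ * ‖w x‖) + r * ((∫ x, ‖e x‖ * ‖v x‖) + ∫ x, ‖e x‖ * ‖w x‖) := by
    have i12 : Integrable (fun x => B * (‖c x‖ * ‖v x‖ + ‖c x‖ * ‖w x‖)) volume := (i1.add i2).const_mul B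
    have i34 : Integrable (fun x => r * (‖e x‖ * ‖v x‖ + ‖e x‖ * ‖w x‖)) volume := (i3.add i4).const_mul r
    rw [integral_add i12 i34, integral_const_mul, integral_const_mul,
      integral_add i1 i2, integral_add i3 i4]
  rw [e1]
  have hce : ‖e‖ ≤ 2 * M := (norm_sub_le v w).trans (by linarith)
  have b1 : (∫ x, ‖c x‖ * ‖v x‖) ≤ ‖c‖ * M := (integral_norm_mul_norm_le c v).trans (by gcongr)
  have b2 : (∫ x, ‖c x‖ * ‖w x‖) ≤ ‖c‖ * M := (integral_norm_mul_norm_le c w).trans (by gcongr)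
  have b3 : (∫ x, ‖e x‖ * ‖v x‖) ≤ 2 * M * M := (integral_norm_mul_norm_le e v).trans (by gcongr)
  have b4 : (∫ x, ‖e x‖ * ‖w x‖) ≤ 2 * M * M := (integral_norm_mul_norm_le e w).trans (by gcongr)
  calc _ ≤ B * (‖c‖ * M + ‖c‖ * M) + r * (2 * M * M + 2 * M * M) := by gcongr
    _ = _ := by ring

/-- The quadratic nonlinearity tested against `ψ`. -/
noncomputable def quad (ψ v : L2) : ℂ := ∫ x, starRingEnd ℂ (ψ x) * (‖v x‖ * v x)

/-- Removal of the truncation for a fixed function. -/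
lemma tendsto_inner_truncOp_const {ψ : L2} {F : ℝ → ℂ} (hF : ψ =ᵐ[volume] F) {B : ℝ} (hB : ∀ x, ‖F x‖ ≤ B)
    (w : L2) {N : ℕ → ℕ} (hN : Tendsto N atTop atTop) :
    Tendsto (fun n => inner ℂ ψ (truncOp (N n) w)) atTop (𝓝 (quad ψ w)) := by
  have e : ∀ n, inner ℂ ψ (truncOp (N n) w) = ∫ x, starRingEnd ℂ (F x) * trunc (N n) (w x) := fun n =>
    inner_eq_integral_of_ae hF (truncOp_coe _ w)
  have e2 : quad ψ w = ∫ x, starRingEnd ℂ (F x) * (‖w x‖ * w x) := by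
    refine integral_congr_ae ?_
    filter_upwards [hF] with x hx
    rw [hx]
  have hFm : AEStronglyMeasurable F volume := (Lp.aestronglyMeasurable ψ).congr hF
  simp only [e]
  rw [e2]
  refine tendsto_integral_of_dominated_convergence (fun x => B * ‖w x‖ ^ 2) (fun n => ?_)
    ((Lp.memLp w).norm.integrable_sq.const_mul B) (fun n => Eventually.of_forall fun x => ?_)
    (Eventually.of_forall fun x => ?_)
  · exact (Complex.continuous_conj.comp_aestronglyMeasurable hFm).mul
      ((lipschitz_trunc (N n)).continuous.comp_aestronglyMeasurable (Lp.aestronglyMeasurable w))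
  · rw [norm_mul, RCLike.norm_conj, norm_trunc, sq]
    have := norm_nonneg (F x)
    gcongr
    · exact this.trans (hB x)
    · exact hB x
    · exact min_le_left _ _
  · refine tendsto_const_nhds.congr' ?_
    filter_upwards [hN.eventually_ge_atTop ⌈‖w x‖⌉₊] with n hn
    have : ‖w x‖ ≤ N n := Nat.ceil_le.1 hn
    rw [trunc]
    congr 3
    simp [min_eq_left this]

/-- Convergence in `L_2(-R,R)` for every `R` suffices for the quadratic term, since the test function
vanishes at infinity. -/
lemma tendsto_inner_truncOp {ψ g : L2} (h : IsWeakDeriv ψ g) {v : ℕ → L2} {w : L2} {M : ℝ}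
    (hv : ∀ n, ‖v n‖ ≤ M) (hw : ‖w‖ ≤ M) (hc : ∀ R, Tendsto (fun n => ‖cut R (v n - w)‖) atTop (𝓝 0))
    {N : ℕ → ℕ} (hN : Tendsto N atTop atTop) :
    Tendsto (fun n => inner ℂ ψ (truncOp (N n) (v n))) atTop (𝓝 (quad ψ w)) := by
  obtain ⟨F, hF, hB, hz⟩ := h.exists_rep
  set B : ℝ := Real.pi + ‖ψ‖ ^ 2 + ‖g‖ ^ 2 with hBdef
  have hB0 : 0 ≤ B := (norm_nonneg _).trans (hB 0)
  have hM : 0 ≤ M := (norm_nonneg _).trans hw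
  have hdiff : Tendsto (fun n => inner ℂ ψ (truncOp (N n) (v n)) - inner ℂ ψ (truncOp (N n) w)) atTop (𝓝 0) := by
    rw [Metric.tendsto_nhds]
    intro δ hδ
    set r : ℝ := δ / (8 * M ^ 2 + 1) with hr
    have hr0 : 0 < r := by positivity
    have hev := hz.eventually (Metric.ball_mem_nhds (0 : ℂ) hr0)
    rw [cocompact_eq_atBot_atTop, eventually_sup] at hev
    obtain ⟨R1, hR1⟩ := eventually_atBot.1 hev.1
    obtain ⟨R2, hR2⟩ := eventually_atTop.1 hev.2
    set R : ℝ := max (-R1) R2 with hRdef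
    -- the test function is small outside a bounded interval
    have hR : ∀ x ∉ Ioc (-R) R, ‖F x‖ ≤ r := fun x hx => by
      have hx' : x ≤ R1 ∨ R2 ≤ x := by
        by_contra! hcon
        refine hx ⟨?_, ?_⟩
        · have := le_max_left (-R1) R2
          linarith [hcon.1]
        · exact hcon.2.le.trans (le_max_right _ _)
      rcases hx' with h1 | h1
      · have := hR1 x h1
        exact (mem_ball_zero_iff.1 this).le
      · have := hR2 x h1
        exact (mem_ball_zero_iff.1 this).le
    have hlim : Tendsto (fun n => 2 * M * (B * ‖cut R (v n - w)‖ + r * (2 * M))) atTop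
        (𝓝 (2 * M * (B * 0 + r * (2 * M)))) :=
      (((hc R).const_mul B).add_const _).const_mul _
    have hlt : 2 * M * (B * 0 + r * (2 * M)) < δ := by
      have : r * (8 * M ^ 2 + 1) = δ := by rw [hr]; field_simp
      nlinarith [mul_nonneg hr0.le (sq_nonneg M)]
    filter_upwards [hlim.eventually_lt_const hlt] with n hn
    rw [dist_zero_right]
    exact (norm_inner_truncOp_sub_le hF hB0 hr0.le hB hR _ _ _ (hv n) hw).trans_lt hn
  simpa using hdiff.add (tendsto_inner_truncOp_const hF hB w hN)

/-- The frequency projection disappears in the limit, as the cut-off outgrows the truncation level. -/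
lemma tendsto_inner_bandD_truncOp {ψ g : L2} (h : IsWeakDeriv ψ g) {v : ℕ → L2} {w : L2} {M : ℝ}
    (hv : ∀ n, ‖v n‖ ≤ M) (hw : ‖w‖ ≤ M) (hc : ∀ R, Tendsto (fun n => ‖cut R (v n - w)‖) atTop (𝓝 0))
    {N : ℕ → ℕ} (hN : Tendsto N atTop atTop) {k : ℕ → ℝ} (hk : ∀ n, 0 < k n)
    (hdiv : Tendsto (fun n => (N n : ℝ) / k n) atTop (𝓝 0)) :
    Tendsto (fun n => inner ℂ (bandD (k n) 0 ψ) (truncOp (N n) (v n))) atTop (𝓝 (quad ψ w)) := by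
  have hM : 0 ≤ M := (norm_nonneg _).trans hw
  have h0 : Tendsto (fun n => inner ℂ (ψ - bandD (k n) 0 ψ) (truncOp (N n) (v n))) atTop (𝓝 0) := by
    have hlim := hdiv.const_mul ((2 * Real.pi)⁻¹ * ‖g‖ * M)
    rw [mul_zero] at hlim
    refine squeeze_zero_norm (fun n => ?_) hlim
    have hkn := hk n
    calc _ ≤ ‖ψ - bandD (k n) 0 ψ‖ * ‖truncOp (N n) (v n)‖ := norm_inner_le_norm _ _
      _ ≤ ((2 * Real.pi * k n)⁻¹ * ‖g‖) * (N n * M) := by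
        have h1 := h.norm_sub_bandD_le hkn
        have h2 := norm_truncOp_le (N n) (v n)
        have h3 := hv n
        gcongr
        refine h2.trans ?_
        push_cast
        gcongr
      _ = _ := by field_simp
  have := (tendsto_inner_truncOp h hv hw hc hN).sub h0
  rw [sub_zero] at this
  refine this.congr fun n => ?_
  rw [inner_sub_left]; ring

lemma norm_inner_bandD_truncOp_le {ψ g : L2} (h : IsWeakDeriv ψ g) (k : ℝ) (N : ℝ≥0) (u : L2) :
    ‖inner ℂ (bandD k 0 ψ) (truncOp N u)‖ ≤ (Real.pi + ‖ψ‖ ^ 2 + ‖g‖ ^ 2) * ‖u‖ ^ 2 := by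
  refine norm_inner_truncOp_le N ?_ u
  obtain ⟨F, hF, hB, -⟩ := (IsWeakDeriv.bandD_self k 0 ψ).exists_rep
  filter_upwards [hF] with x hx
  rw [hx]
  refine (hB x).trans ?_
  have h1 := norm_bandD_zero_le k ψ
  have h2 := norm_bandD_zero_le k g
  rw [zero_add, h.bandD_one]
  gcongr

/-- Complex conjugation of `L_2` functions. -/
noncomputable def conjL2 : L2 →L[ℝ] L2 :=
  ContinuousLinearMap.compLpL 2 volume (Complex.conjCLE : ℂ →L[ℝ] ℂ)

lemma conjL2_coe (v : L2) : conjL2 v =ᵐ[volume] fun x => starRingEnd ℂ (v x) :=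
  ContinuousLinearMap.coeFn_compLpL _ v

lemma inner_conjL2 {v : L2} {f : ℝ → ℂ} {F : L2} (hF : F =ᵐ[volume] f) :
    inner ℂ (conjL2 v) F = ∫ x, f x * v x := by
  rw [inner_eq_integral_of_ae (conjL2_coe v) hF]
  refine integral_congr_ae (Eventually.of_forall fun x => ?_)
  simp only [Complex.conj_conj]
  ring

lemma IsWeakDeriv.conj {f g : L2} (h : IsWeakDeriv f g) : IsWeakDeriv (conjL2 f) (conjL2 g) := by
  intro θ hθ hc
  have hd : ∀ x, deriv (fun x => starRingEnd ℂ (θ x)) x = starRingEnd ℂ (deriv θ x) := fun x =>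
    ((hθ.differentiable (by simp) x).hasDerivAt.star).deriv
  have h1 := h (fun x => starRingEnd ℂ (θ x)) (Complex.conjCLE.contDiff.comp hθ)
    (hc.comp_left (g := starRingEnd ℂ) (map_zero _))
  have h2 := congrArg (starRingEnd ℂ) h1
  rw [map_neg, ← integral_conj, ← integral_conj] at h2
  have e1 : ∫ x, (conjL2 f) x * deriv θ x = ∫ x, starRingEnd ℂ (f x * deriv (fun x => starRingEnd ℂ (θ x)) x) := by
    refine integral_congr_ae ?_
    filter_upwards [conjL2_coe f] with x hx
    rw [hx, hd, map_mul, Complex.conj_conj]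
  have e2 : ∫ x, (conjL2 g) x * θ x = ∫ x, starRingEnd ℂ (g x * starRingEnd ℂ (θ x)) := by
    refine integral_congr_ae ?_
    filter_upwards [conjL2_coe g] with x hx
    rw [hx, map_mul, Complex.conj_conj]
  rw [e1, e2, h2]

lemma IsTestFunction.conj {T : ℝ} {φ φt φ1 φ2 φ3 : ℝ → L2} (h : IsTestFunction T φ φt φ1 φ2 φ3) :
    IsTestFunction T (fun t => conjL2 (φ t)) (fun t => conjL2 (φt t)) (fun t => conjL2 (φ1 t))
      (fun t => conjL2 (φ2 t)) (fun t => conjL2 (φ3 t)) where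
  hasDeriv := fun t ht => conjL2.hasFDerivAt.comp_hasDerivWithinAt t (h.hasDeriv t ht)
  continuous_t := conjL2.continuous.comp_continuousOn h.continuous_t
  weak1 := fun t ht => (h.weak1 t ht).conj
  weak2 := fun t ht => (h.weak2 t ht).conj
  weak3 := fun t ht => (h.weak3 t ht).conj
  continuous1 := conjL2.continuous.comp_continuousOn h.continuous1
  continuous2 := conjL2.continuous.comp_continuousOn h.continuous2
  continuous3 := conjL2.continuous.comp_continuousOn h.continuous3
  final := by rw [h.final, map_zero]

/-! ### Passage to the limit in the weak form -/

/-- The regularized right-hand side tested against a function of `H³`: all derivatives are moved to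
the test function. -/
lemma inner_vf_eq (D : Coeffs) (N : ℝ≥0) (ε k : ℝ) {ψ ψ1 ψ2 ψ3 u : L2} (h1 : IsWeakDeriv ψ ψ1)
    (h2 : IsWeakDeriv ψ1 ψ2) (h3 : IsWeakDeriv ψ2 ψ3) (hu : bandD k 0 u = u) :
    inner ℂ ψ (vf D N ε k u) = inner ℂ ψ3 u + Complex.I * D.a * inner ℂ ψ2 u + D.b * inner ℂ ψ1 u
      - ε * inner ℂ ψ2 (bandD k 2 u)
      + Complex.I * D.lam * inner ℂ (bandD k 0 ψ) (truncOp N u)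
      - inner ℂ (bandD k 0 ψ) (mulOp (fun x => (D.d x : ℂ)) u)
      + D.β * inner ℂ (bandD k 0 ψ1) (truncOp N u) := by
  have flip : ∀ (j : ℕ) (v w : L2), inner ℂ v (bandD k j w) = (-1) ^ j * inner ℂ (bandD k j v) w := by
    intro j v w
    rw [inner_bandD k j v w, ← mul_assoc, ← mul_pow]; simp
  have proj : ∀ v : L2, inner ℂ (bandD k 0 v) u = inner ℂ v u := fun v => by rw [inner_bandD_zero, hu]
  have e1 : inner ℂ ψ (bandD k 1 u) = - inner ℂ ψ1 u := by
    rw [flip, h1.bandD_one, proj]; ring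
  have e2 : inner ℂ ψ (bandD k 2 u) = inner ℂ ψ2 u := by
    rw [flip, h1.bandD_succ k 1, h2.bandD_one, proj]; ring
  have e3 : inner ℂ ψ (bandD k 3 u) = - inner ℂ ψ3 u := by
    rw [flip, h1.bandD_succ k 2, h2.bandD_succ k 1, h3.bandD_one, proj]; ring
  have e4 : inner ℂ ψ (bandD k 4 u) = inner ℂ ψ2 (bandD k 2 u) := by
    rw [show (4 : ℕ) = 2 + 2 from rfl, ← bandD_bandD, flip, h1.bandD_succ k 1, h2.bandD_one, inner_bandD_zero,
      bandD_bandD]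
    norm_num
  have e5 : inner ℂ ψ (bandD k 1 (truncOp N u)) = - inner ℂ (bandD k 0 ψ1) (truncOp N u) := by
    rw [flip, h1.bandD_one]; ring
  simp only [vf, linOp, sourceOp, add_apply, sub_apply, smul_apply, neg_apply, inner_add_right, inner_sub_right,
    inner_smul_right, inner_neg_right, ← inner_bandD_zero, e1, e2, e3, e4, e5]
  ring

lemma exists_norm_le {f : ℝ → L2} {T : ℝ} (hf : ContinuousOn f (Icc 0 T)) : ∃ K, 0 ≤ K ∧ ∀ t ∈ Icc 0 T, ‖f t‖ ≤ K := by
  obtain ⟨K, hK⟩ := isCompact_Icc.exists_bound_of_continuousOn hf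
  exact ⟨max K 0, le_max_right _ _, fun t ht => (hK t ht).trans (le_max_left _ _)⟩

namespace Approximation

variable {D : Coeffs} {u₀ : L2} (A : Approximation D u₀)

lemma continuous_vf (n : ℕ) : Continuous fun t => vf D (A.N n) (A.ε n) (A.k n) (A.u n t) := by
  obtain ⟨K, hK⟩ := lipschitz_vf D (A.N n) (A.ε n) (A.k n)
  exact hK.continuous.comp (A.continuous n)

section WeakForm

variable {T : ℝ} {χ χt χ1 χ2 χ3 : ℝ → L2} (h : IsTestFunction T χ χt χ1 χ2 χ3)

include h

/-- The weak form of the regularized equation. -/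
lemma integral_inner_vf (hT : 0 < T) (n : ℕ) :
    ∫ t in Ioc 0 T, (inner ℂ (χt t) (A.u n t) + inner ℂ (χ t) (vf D (A.N n) (A.ε n) (A.k n) (A.u n t))) =
      - inner ℂ (χ 0) (A.u n 0) := by
  have hχ : ContinuousOn χ (Icc 0 T) := fun t ht => (h.hasDeriv t ht).continuousWithinAt
  rw [← intervalIntegral.integral_of_le hT.le,
    intervalIntegral.integral_eq_sub_of_hasDerivAt_of_le (f := fun t => inner ℂ (χ t) (A.u n t)) hT.le]
  · rw [h.final, inner_zero_left, zero_sub]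
  · exact hχ.inner (A.continuous n).continuousOn
  · intro t ht
    have h1 := (h.hasDeriv t (Ioo_subset_Icc_self ht)).hasDerivAt (Icc_mem_nhds ht.1 ht.2)
    exact (h1.inner ℂ (A.hasDerivAt n t ht.1)).congr_deriv (add_comm _ _)
  · refine ContinuousOn.intervalIntegrable ?_
    rw [uIcc_of_le hT.le]
    exact (h.continuous_t.inner (A.continuous n).continuousOn).add (hχ.inner (A.continuous_vf n).continuousOn)

/-- The artificial dissipation does not contribute to the limit. -/
lemma tendsto_dissipation (hT : 0 < T) :
    Tendsto (fun n => ∫ t in Ioc 0 T, (A.ε n : ℂ) * inner ℂ (χ2 t) (bandD (A.k n) 2 (A.u n t))) atTop (𝓝 0) := by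
  obtain ⟨K, hK0, hK⟩ := exists_norm_le h.continuous2
  have hlim : Tendsto (fun n => K * (Real.sqrt (A.ε n) / 2 * (T + D.size ‖u₀‖ T ^ 2))) atTop (𝓝 0) := by
    have h1 := (((A.tendsto_ε.sqrt).div_const 2).mul_const (T + D.size ‖u₀‖ T ^ 2)).const_mul K
    simpa using h1
  refine squeeze_zero_norm (fun n => ?_) hlim
  have hε := (A.ε_pos n).le
  have hcont : Continuous fun t => ‖bandD (A.k n) 2 (A.u n t)‖ ^ 2 := by
    have := A.continuous n
    fun_prop
  have hi : IntegrableOn (fun t => ‖bandD (A.k n) 2 (A.u n t)‖ ^ 2) (Ioc 0 T) volume :=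
    hcont.integrableOn_Ioc
  have hi1 : IntegrableOn (fun _ : ℝ => (1 : ℝ)) (Ioc 0 T) volume := continuous_const.integrableOn_Ioc
  have hd := A.dissipation n T hT.le
  rw [intervalIntegral.integral_of_le hT.le] at hd
  have hb : ‖∫ t in Ioc 0 T, (A.ε n : ℂ) * inner ℂ (χ2 t) (bandD (A.k n) 2 (A.u n t))‖ ≤
      ∫ t in Ioc 0 T, K * (Real.sqrt (A.ε n) / 2 * (1 + A.ε n * ‖bandD (A.k n) 2 (A.u n t)‖ ^ 2)) := by
    refine norm_integral_le_of_norm_le (((hi1.add (hi.const_mul _)).const_mul _).const_mul _) ?_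
    filter_upwards [ae_restrict_mem measurableSet_Ioc] with t ht
    set y := ‖bandD (A.k n) 2 (A.u n t)‖ with hy
    have hs := Real.sqrt_nonneg (A.ε n)
    have hs2 := Real.sq_sqrt hε
    -- `ε y = √ε · (√ε y) ≤ √ε (1 + ε y²) / 2`
    have h1 : A.ε n * y ≤ Real.sqrt (A.ε n) / 2 * (1 + A.ε n * y ^ 2) := by
      have h2 := mul_nonneg hs (sq_nonneg (Real.sqrt (A.ε n) * y - 1))
      calc A.ε n * y = Real.sqrt (A.ε n) ^ 2 * y := by rw [hs2]
        _ ≤ Real.sqrt (A.ε n) / 2 * (1 + Real.sqrt (A.ε n) ^ 2 * y ^ 2) := by nlinarith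
        _ = _ := by rw [hs2]
    rw [norm_mul, Complex.norm_real, Real.norm_eq_abs, abs_of_nonneg hε]
    calc A.ε n * ‖inner ℂ (χ2 t) (bandD (A.k n) 2 (A.u n t))‖ ≤ A.ε n * (K * y) := by
          have := (norm_inner_le_norm (𝕜 := ℂ) (χ2 t) (bandD (A.k n) 2 (A.u n t))).trans
            (mul_le_mul_of_nonneg_right (hK t (Ioc_subset_Icc_self ht)) (norm_nonneg _))
          gcongr
      _ = K * (A.ε n * y) := by ring
      _ ≤ _ := by gcongr
  refine hb.trans ?_
  rw [integral_const_mul, integral_const_mul, integral_add hi1 (hi.const_mul _), integral_const_mul]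
  have e : ∫ _ in Ioc 0 T, (1 : ℝ) = T := by simp [hT.le]
  rw [e]
  gcongr

variable {u : ℝ → L2} (hu : ∀ t, 0 ≤ t → WeakTendsto (fun n => A.u n t) (u t))
  (hc : ∀ᵐ t : ℝ, 0 < t → ∀ R, Tendsto (fun n => ‖cut R (A.u n t - u t)‖) atTop (𝓝 0))

include hu hc

/-- Passage to the limit in the weak form. -/
lemma integral_weak_form (hT : 0 < T) :
    ∫ t in Ioc 0 T, (inner ℂ (χt t) (u t) + (inner ℂ (χ3 t) (u t) + Complex.I * D.a * inner ℂ (χ2 t) (u t)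
        + D.b * inner ℂ (χ1 t) (u t) + Complex.I * D.lam * quad (χ t) (u t)
        - inner ℂ (χ t) (mulOp (fun x => (D.d x : ℂ)) (u t)) + D.β * quad (χ1 t) (u t))) =
      - inner ℂ (χ 0) u₀ := by
  have hχ : ContinuousOn χ (Icc 0 T) := fun t ht => (h.hasDeriv t ht).continuousWithinAt
  obtain ⟨K, hK0, hK⟩ := exists_norm_le hχ
  obtain ⟨Kt, hKt0, hKt⟩ := exists_norm_le h.continuous_t
  obtain ⟨K1, hK10, hK1⟩ := exists_norm_le h.continuous1
  obtain ⟨K2, hK20, hK2⟩ := exists_norm_le h.continuous2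
  obtain ⟨K3, hK30, hK3⟩ := exists_norm_le h.continuous3
  set M := D.size ‖u₀‖ T with hM
  have hM0 : 0 < M := D.size_pos (norm_nonneg u₀) T
  have hδ := D.δ_nonneg
  set E : ℕ → ℝ → ℂ := fun n t => (A.ε n : ℂ) * inner ℂ (χ2 t) (bandD (A.k n) 2 (A.u n t)) with hE
  set F : ℕ → ℝ → ℂ := fun n t => inner ℂ (χt t) (A.u n t)
    + inner ℂ (χ t) (vf D (A.N n) (A.ε n) (A.k n) (A.u n t)) with hF
  have cE : ∀ n, ContinuousOn (E n) (Icc 0 T) := fun n => continuousOn_const.mul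
    (h.continuous2.inner ((bandD (A.k n) 2).continuous.comp (A.continuous n)).continuousOn)
  have cF : ∀ n, ContinuousOn (F n) (Icc 0 T) := fun n =>
    (h.continuous_t.inner (A.continuous n).continuousOn).add (hχ.inner (A.continuous_vf n).continuousOn)
  have iE : ∀ n, IntegrableOn (E n) (Ioc 0 T) volume := fun n =>
    (cE n).integrableOn_Icc.mono_set Ioc_subset_Icc_self
  have iF : ∀ n, IntegrableOn (F n) (Ioc 0 T) volume := fun n =>
    (cF n).integrableOn_Icc.mono_set Ioc_subset_Icc_self
  have hFE : ∀ n, ∀ t ∈ Icc 0 T, F n t + E n t = inner ℂ (χt t) (A.u n t) + (inner ℂ (χ3 t) (A.u n t)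
      + Complex.I * D.a * inner ℂ (χ2 t) (A.u n t) + D.b * inner ℂ (χ1 t) (A.u n t)
      + Complex.I * D.lam * inner ℂ (bandD (A.k n) 0 (χ t)) (truncOp (A.N n) (A.u n t))
      - inner ℂ (bandD (A.k n) 0 (χ t)) (mulOp (fun x => (D.d x : ℂ)) (A.u n t))
      + D.β * inner ℂ (bandD (A.k n) 0 (χ1 t)) (truncOp (A.N n) (A.u n t))) := fun n t ht => by
    simp only [hF, hE]
    rw [inner_vf_eq D _ _ _ (h.weak1 t ht) (h.weak2 t ht) (h.weak3 t ht) (A.band n t)]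
    ring
  have hlim0 : Tendsto (fun n => ∫ t in Ioc 0 T, (F n t + E n t)) atTop (𝓝 (- inner ℂ (χ 0) u₀)) := by
    have h1 : Tendsto (fun n => - inner ℂ (χ 0) (A.u n 0)) atTop (𝓝 (- inner ℂ (χ 0) u₀)) := by
      simp only [A.init]
      exact (tendsto_const_nhds.inner ((tendsto_bandD_zero u₀).comp A.tendsto_k)).neg
    have h2 := h1.add (A.tendsto_dissipation h hT)
    rw [add_zero] at h2
    refine h2.congr fun n => ?_
    rw [integral_add (iF n) (iE n), A.integral_inner_vf h hT n]
  refine tendsto_nhds_unique (tendsto_integral_of_dominated_convergence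
    (fun _ => Kt * M + (K3 * M + |D.a| * (K2 * M) + |D.b| * (K1 * M)
      + |D.lam| * ((Real.pi + K ^ 2 + K1 ^ 2) * M ^ 2) + K * (D.δ * M)
      + |D.β| * ((Real.pi + K1 ^ 2 + K2 ^ 2) * M ^ 2)))
    (fun n => ((iF n).add (iE n)).aestronglyMeasurable) continuous_const.integrableOn_Ioc (fun n => ?_) ?_) hlim0
  · filter_upwards [ae_restrict_mem measurableSet_Ioc] with t ht
    have ht' := Ioc_subset_Icc_self ht
    have hun : ‖A.u n t‖ ≤ M := A.norm_le' ht.1.le ht.2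
    have key : ∀ {v : L2} {C : ℝ}, ‖v‖ ≤ C → ‖inner ℂ v (A.u n t)‖ ≤ C * M := fun {v C} hv =>
      (norm_inner_le_norm _ _).trans
        (mul_le_mul hv hun (norm_nonneg _) ((norm_nonneg v).trans hv))
    have b1 := norm_inner_bandD_truncOp_le (h.weak1 t ht') (A.k n) (A.N n) (A.u n t)
    have b2 := norm_inner_bandD_truncOp_le (h.weak2 t ht') (A.k n) (A.N n) (A.u n t)
    have b3 : ‖inner ℂ (bandD (A.k n) 0 (χ t)) (mulOp (fun x => (D.d x : ℂ)) (A.u n t))‖ ≤ K * (D.δ * M) := by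
      refine (norm_inner_le_norm _ _).trans (mul_le_mul ((norm_bandD_zero_le _ _).trans (hK t ht')) ?_
        (norm_nonneg _) hK0)
      exact (norm_mulOp_le hδ D.abs_d_le _).trans (by gcongr)
    have c0 := hK t ht'
    have c1 := hK1 t ht'
    have c2 := hK2 t ht'
    have p1 : (Real.pi + ‖χ t‖ ^ 2 + ‖χ1 t‖ ^ 2) * ‖A.u n t‖ ^ 2 ≤ (Real.pi + K ^ 2 + K1 ^ 2) * M ^ 2 := by gcongr
    have p2 : (Real.pi + ‖χ1 t‖ ^ 2 + ‖χ2 t‖ ^ 2) * ‖A.u n t‖ ^ 2 ≤ (Real.pi + K1 ^ 2 + K2 ^ 2) * M ^ 2 := by gcongr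
    simp only [Pi.add_apply]
    rw [hFE n t ht']
    refine (norm_add_le _ _).trans (add_le_add (key (hKt t ht')) ?_)
    refine (norm_add_le _ _).trans (add_le_add ((norm_sub_le _ _).trans (add_le_add
      ((norm_add_le _ _).trans (add_le_add ((norm_add_le _ _).trans (add_le_add
      ((norm_add_le _ _).trans (add_le_add (key (hK3 t ht')) ?_)) ?_)) ?_)) b3)) ?_)
    · rw [norm_mul, norm_mul, Complex.norm_I, one_mul, Complex.norm_real, Real.norm_eq_abs]
      exact mul_le_mul_of_nonneg_left (key c2) (abs_nonneg _)
    · rw [norm_mul, Complex.norm_real, Real.norm_eq_abs]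
      exact mul_le_mul_of_nonneg_left (key c1) (abs_nonneg _)
    · rw [norm_mul, norm_mul, Complex.norm_I, one_mul, Complex.norm_real, Real.norm_eq_abs]
      exact mul_le_mul_of_nonneg_left (b1.trans p1) (abs_nonneg _)
    · rw [norm_mul, Complex.norm_real, Real.norm_eq_abs]
      exact mul_le_mul_of_nonneg_left (b2.trans p2) (abs_nonneg _)
  · filter_upwards [ae_restrict_mem measurableSet_Ioc, ae_restrict_of_ae hc] with t ht hct
    have ht' := Ioc_subset_Icc_self ht
    have hw := hu t ht.1.le
    have hc' := hct ht.1
    have hn : ∀ n, ‖A.u n t‖ ≤ M := fun n => A.norm_le' ht.1.le ht.2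
    have hun : ‖u t‖ ≤ M := A.norm_limit_le' hu ht.1.le ht.2
    have l1 := tendsto_inner_bandD_truncOp (h.weak1 t ht') hn hun hc' A.tendsto_N A.k_pos A.tendsto_div
    have l2 := tendsto_inner_bandD_truncOp (h.weak2 t ht') hn hun hc' A.tendsto_N A.k_pos A.tendsto_div
    have l3 : Tendsto (fun n => inner ℂ (bandD (A.k n) 0 (χ t)) (mulOp (fun x => (D.d x : ℂ)) (A.u n t))) atTop
        (𝓝 (inner ℂ (χ t) (mulOp (fun x => (D.d x : ℂ)) (u t)))) := by
      have s1 := hw.clm (mulOp (fun x => (D.d x : ℂ))) (χ t)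
      have s2 : Tendsto (fun n => inner ℂ (bandD (A.k n) 0 (χ t) - χ t) (mulOp (fun x => (D.d x : ℂ)) (A.u n t)))
          atTop (𝓝 0) := by
        have hz := (tendsto_iff_norm_sub_tendsto_zero.1 ((tendsto_bandD_zero (χ t)).comp A.tendsto_k)).mul_const
          (D.δ * M)
        rw [zero_mul] at hz
        refine squeeze_zero_norm (fun n => (norm_inner_le_norm _ _).trans ?_) hz
        have := (norm_mulOp_le hδ D.abs_d_le (A.u n t)).trans (mul_le_mul_of_nonneg_left (hn n) hδ)
        exact mul_le_mul_of_nonneg_left this (norm_nonneg _)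
      have s3 := s1.add s2
      rw [add_zero] at s3
      refine s3.congr fun n => ?_
      rw [inner_sub_left]; ring
    refine Tendsto.congr (fun n => (hFE n t ht').symm) ?_
    exact (hw (χt t)).add ((((((hw (χ3 t)).add ((hw (χ2 t)).const_mul _)).add ((hw (χ1 t)).const_mul _)).add
      (l1.const_mul _)).sub l3).add (l2.const_mul _))

end WeakForm

end Approximation

/-! ### Existence of weak solutions -/

lemma integral_seven {f1 f2 f3 f4 f5 f6 f7 : ℝ → ℂ} (h1 : Integrable f1) (h2 : Integrable f2) (h3 : Integrable f3)
    (h4 : Integrable f4) (h5 : Integrable f5) (h6 : Integrable f6) (h7 : Integrable f7) :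
    ∫ x, (f1 x - f2 x + f3 x + f4 x - f5 x + f6 x - f7 x) =
      (∫ x, f1 x) - (∫ x, f2 x) + (∫ x, f3 x) + (∫ x, f4 x) - (∫ x, f5 x) + (∫ x, f6 x) - ∫ x, f7 x := by
  have s2 : Integrable fun x => f1 x - f2 x := h1.sub h2
  have s3 : Integrable fun x => f1 x - f2 x + f3 x := s2.add h3
  have s4 : Integrable fun x => f1 x - f2 x + f3 x + f4 x := s3.add h4
  have s5 : Integrable fun x => f1 x - f2 x + f3 x + f4 x - f5 x := s4.sub h5
  have s6 : Integrable fun x => f1 x - f2 x + f3 x + f4 x - f5 x + f6 x := s5.add h6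
  rw [integral_sub s6 h7, integral_add s5 h6, integral_sub s4 h5, integral_add s3 h4, integral_add s2 h3,
    integral_sub h1 h2]

lemma integrable_quad {p p1 : L2} (h : IsWeakDeriv p p1) (v : L2) :
    Integrable (fun x => (‖v x‖ * v x : ℂ) * p x) volume := by
  obtain ⟨F, hF, hB, -⟩ := h.exists_rep
  have hi : Integrable (fun x => (‖v x‖ * v x : ℂ)) volume :=
    integrable_mul_L2 (Lp.memLp v).norm.ofReal (Lp.memLp v)
  refine hi.mul_bdd (c := Real.pi + ‖p‖ ^ 2 + ‖p1‖ ^ 2) (Lp.aestronglyMeasurable p) ?_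
  filter_upwards [hF] with x hx
  rw [hx]
  exact hB x

lemma quad_conjL2 (p v : L2) : quad (conjL2 p) v = ∫ x, (‖v x‖ * v x : ℂ) * p x := by
  refine integral_congr_ae ?_
  filter_upwards [conjL2_coe p] with x hx
  rw [hx, Complex.conj_conj, mul_comm]

/-- The integrand of the weak formulation at a fixed time, in terms of inner products. -/
lemma integral_weak_integrand (D : Coeffs) {p pt p1 p2 p3 v : L2} (h : IsWeakDeriv p p1) (h1 : IsWeakDeriv p1 p2)
    {V : ℝ → ℂ} (hV : V =ᵐ[volume] v) :
    ∫ x, (Complex.I * V x * pt x - D.a * V x * p2 x + Complex.I * D.b * V x * p1 x + Complex.I * V x * p3 x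
        - D.lam * (‖V x‖ * V x) * p x + Complex.I * D.β * (‖V x‖ * V x) * p1 x - Complex.I * D.d x * V x * p x) =
      Complex.I * (inner ℂ (conjL2 pt) v + (inner ℂ (conjL2 p3) v + Complex.I * D.a * inner ℂ (conjL2 p2) v
        + D.b * inner ℂ (conjL2 p1) v + Complex.I * D.lam * quad (conjL2 p) v
        - inner ℂ (conjL2 p) (mulOp (fun x => (D.d x : ℂ)) v) + D.β * quad (conjL2 p1) v)) := by
  have i : ∀ q : L2, Integrable (fun x => v x * q x) volume := fun q =>
    integrable_mul_L2 (Lp.memLp v) (Lp.memLp q)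
  have hd := mulOp_coe D.memLp_d v
  have id : Integrable (fun x => (D.d x * v x : ℂ) * p x) volume := by
    refine (integrable_mul_L2 (Lp.memLp (mulOp (fun x => (D.d x : ℂ)) v)) (Lp.memLp p)).congr ?_
    filter_upwards [hd] with x hx
    rw [hx]
  have e : ∀ q : L2, inner ℂ (conjL2 q) v = ∫ x, v x * q x := fun q =>
    inner_conjL2 (Filter.EventuallyEq.refl _ _)
  rw [e, e, e, e, inner_conjL2 hd, quad_conjL2, quad_conjL2]
  have hc : ∫ x, (Complex.I * V x * pt x - D.a * V x * p2 x + Complex.I * D.b * V x * p1 x + Complex.I * V x * p3 x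
        - D.lam * (‖V x‖ * V x) * p x + Complex.I * D.β * (‖V x‖ * V x) * p1 x - Complex.I * D.d x * V x * p x) =
      ∫ x, (Complex.I * (v x * pt x) - D.a * (v x * p2 x) + Complex.I * D.b * (v x * p1 x)
        + Complex.I * (v x * p3 x) - D.lam * ((‖v x‖ * v x) * p x) + Complex.I * D.β * ((‖v x‖ * v x) * p1 x)
        - Complex.I * ((D.d x * v x) * p x)) := by
    refine integral_congr_ae ?_
    filter_upwards [hV] with x hx
    rw [hx]; ring
  rw [hc]
  refine (integral_seven ((i pt).const_mul _) ((i p2).const_mul _) ((i p1).const_mul _) ((i p3).const_mul _)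
    ((integrable_quad h v).const_mul _) ((integrable_quad h1 v).const_mul _) (id.const_mul _)).trans ?_
  simp only [integral_const_mul]
  linear_combination (-(D.a : ℂ) * (∫ x, v x * p2 x) - D.lam * ∫ x, (‖v x‖ * v x : ℂ) * p x) * Complex.I_mul_I

/-- The weak formulation pairs without complex conjugation, hence the inner products are taken with the
conjugate of the test function. -/
lemma Approximation.isWeakSolution_rep {D : Coeffs} {u₀ : L2} (A : Approximation D u₀) {u : ℝ → L2}
    (hu : ∀ t, 0 ≤ t → WeakTendsto (fun n => A.u n t) (u t))
    (hc : ∀ᵐ t : ℝ, 0 < t → ∀ R, Tendsto (fun n => ‖cut R (A.u n t - u t)‖) atTop (𝓝 0))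
    {f : ℝ → ℂ} (hf : u₀ =ᵐ[volume] f) {T : ℝ} (hT : 0 < T) :
    IsWeakSolution D.a D.b D.lam D.β D.d f T (rep u) := by
  refine ⟨A.memLinftyL2_rep hu T, fun φ φt φ1 φ2 φ3 h => ?_⟩
  have key := A.integral_weak_form h.conj hu hc hT
  rw [inner_conjL2 hf] at key
  have e := setIntegral_congr_fun (μ := volume) measurableSet_Ioo fun t (ht : t ∈ Ioo 0 T) =>
    integral_weak_integrand D (pt := φt t) (p3 := φ3 t) (h.weak1 t (Ioo_subset_Icc_self ht))
      (h.weak2 t (Ioo_subset_Icc_self ht)) (rep_ae_eq_of_nonneg u ht.1.le)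
  rw [e, integral_const_mul, ← integral_Ioc_eq_integral_Ioo, key]
  ring

/-- A bound of the local smoothing norm in terms of `T`, the norm of the initial value and the norm of
the damping coefficient. -/
noncomputable def smoothingBound (a b β T m δ : ℝ) : ℝ≥0 :=
  Real.toNNReal (Real.exp (2 * T * (a ^ 2 + |b| + β ^ 2 * (Real.exp (δ * T) * (m + 1)) ^ 2 + δ + 2)) * m ^ 2 / bumpMin)

/-- The coefficients of the equation with the norm of `d` as the bound. -/
noncomputable def coeffsOf (a b lam β : ℝ) {d : ℝ → ℝ} (hd : MemLp d ⊤ volume) : Coeffs where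
  a := a
  b := b
  lam := lam
  β := β
  δ := (eLpNorm d ⊤ volume).toReal
  d := d
  memLp_d := hd.ofReal
  δ_nonneg := ENNReal.toReal_nonneg
  abs_d_le := by
    filter_upwards [ae_le_eLpNormEssSup (f := d) (μ := volume)] with x hx
    rw [Complex.norm_real, ← toReal_enorm]
    rw [← eLpNorm_exponent_top] at hx
    exact ENNReal.toReal_mono hd.2.ne hx

lemma MemL2Alpha.memLp {α : ℝ} (hα : 0 ≤ α) {f : ℝ → ℂ} (h : MemL2Alpha α f) : MemLp f 2 volume := by
  have hp : Continuous fun x => ((powWeight α x)⁻¹ : ℂ) :=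
    (Complex.continuous_ofReal.comp (continuous_powWeight hα)).inv₀ fun x => by
      have := one_le_powWeight hα x
      exact Complex.ofReal_ne_zero.2 (by linarith)
  have hb : MemLp (fun x => ((powWeight α x)⁻¹ : ℂ)) ⊤ volume :=
    memLp_top_of_forall_norm_le hp.aestronglyMeasurable (C := 1) fun x => by
      have := one_le_powWeight hα x
      rw [norm_inv, Complex.norm_real, Real.norm_eq_abs, abs_of_pos (by linarith)]
      exact inv_le_one_of_one_le₀ this
  refine (h.mul' hb : MemLp _ 2 volume).ae_eq (Eventually.of_forall fun x => ?_)
  have := one_le_powWeight hα x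
  have hne : (powWeight α x : ℂ) ≠ 0 := Complex.ofReal_ne_zero.2 (by linarith)
  field_simp

/-- Existence with the explicit constant `smoothingBound`. The limit is constructed independently of `T`,
`α` and the weights, so one pair `u`, `u_x` serves them all. -/
theorem exists_weak_solution (a b lam β : ℝ) {α : ℝ} (hα : 0 ≤ α) {f : ℝ → ℂ} (hf : MemL2Alpha α f) {d : ℝ → ℝ}
    (hd : MemLp d ⊤ volume) :
    ∃ u ux : ℝ → ℝ → ℂ, ∀ T : ℝ, 0 < T →
      IsWeakSolution a b lam β d f T u ∧ WeaklyContinuous T α u ∧ IsWeakXDeriv T u ux ∧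
      sigma T ux ≤ smoothingBound a b β T (eLpNorm f 2 volume).toReal (eLpNorm d ⊤ volume).toReal ∧
      ∀ ε : ℝ, 0 < ε → ∀ ρ : ℝ → ℝ, IsRhoWeight α ε ρ → MemL2L2Weighted T (deriv ρ) ux := by
  have hf2 := hf.memLp hα
  set D := coeffsOf a b lam β hd with hD
  set u₀ : L2 := hf2.toLp with hu₀
  have hu₀f : u₀ =ᵐ[volume] f := hf2.coeFn_toLp
  obtain ⟨A⟩ := exists_approximation D u₀
  obtain ⟨B, u, hu, hc⟩ := A.exists_strong_limit
  obtain ⟨ux, hux, hE, hw⟩ := B.exists_weakXDeriv hu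
  have h0 : ∫⁻ x, ENNReal.ofReal (powWeight α x ^ 2) * ‖u₀ x‖ₑ ^ 2 ≠ ⊤ := by
    have e : ∫⁻ x, ENNReal.ofReal (powWeight α x ^ 2) * ‖u₀ x‖ₑ ^ 2 = ∫⁻ x, ‖(powWeight α x : ℂ) * f x‖ₑ ^ 2 := by
      refine lintegral_congr_ae ?_
      filter_upwards [hu₀f] with x hx
      rw [enorm_sq_mul, hx]
    rw [e, ← eLpNorm_two_sq]
    exact ENNReal.pow_ne_top hf.2.ne
  refine ⟨rep u, ux, fun T hT => ⟨B.isWeakSolution_rep hu hc hu₀f hT, B.weaklyContinuous_rep hu hα h0 T, hw T, ?_,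
    fun ε hε ρ hρ => memL2L2Weighted_deriv_rho hE hux T hα hε hρ h0⟩⟩
  refine (sigma_le hE T).trans (le_of_eq ?_)
  have hn : ‖u₀‖ = (eLpNorm f 2 volume).toReal := Lp.norm_toLp f hf2
  rw [hn]
  rfl

end HNLS

theorem theorem3p3 (a b lam β : ℝ) :
    ∃ c : ℝ → ℝ → ℝ → ℝ≥0,
      ∀ (α : ℝ) (u₀ : ℝ → ℂ) (d : ℝ → ℝ),
        0 ≤ α → HNLS.MemL2Alpha α u₀ → MemLp d ⊤ volume →
        ∃ u ux : ℝ → ℝ → ℂ, ∀ T : ℝ, 0 < T →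
          HNLS.IsWeakSolution a b lam β d u₀ T u ∧
          HNLS.WeaklyContinuous T α u ∧
          HNLS.IsWeakXDeriv T u ux ∧
          HNLS.sigma T ux ≤
            c T (eLpNorm u₀ 2 volume).toReal (eLpNorm d ⊤ volume).toReal ∧
          ∀ ε : ℝ, 0 < ε → ∀ ρ : ℝ → ℝ, HNLS.IsRhoWeight α ε ρ →
            HNLS.MemL2L2Weighted T (deriv ρ) ux :=
  ⟨HNLS.smoothingBound a b β, fun _ _ _ hα hf hd => HNLS.exists_weak_solution a b lam β hα hf hd⟩
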